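/- Let $N\ge 1$ and $0<s<1$. Let $E\subset\mathbb R^N$ be an open set with smooth boundary $\Sigma=\partial E$, let $\nu$ be the unit normal field of $\Sigma$ pointing to the exterior of $E$, and let $dx$ on $\Sigma$ denote the $(N-1)$-dimensional surface measure. Assume that $\int_\Sigma (1+|x|)^{-N-s}\,dx<\infty$ (this holds, for instance, whenever $\Sigma$ is compact). For an open set $F$ with smooth boundary and $q\in\partial F$ let $$H^s_{\partial F}(q)=\text{p.v.}\int_{\mathbb R^N}\frac{\chi_F(x)-\chi_{\mathbb R^N\setminus F}(x)}{|x-q|^{N+s}}\,dx$$ be the nonlocal mean curvature, and for $p\in\Sigma$ let $$\mathcal J^s_\Sigma[h](p)=\text{p.v.}\int_\Sigma\frac{h(x)-h(p)}{|p-x|^{N+s}}\,dx+h(p)\int_\Sigma\frac{\langle\nu(p)-\nu(x),\nu(p)\rangle}{|p-x|^{N+s}}\,dx$$ be the nonlocal Jacobi operator. Let $h\in C^\infty(\Sigma)\cap L^\infty(\Sigma)$, and suppose that for all $t$ in a neighborhood of $0$ there is given an open set $E_{th}$ with smooth boundary $\Sigma_{th}=\partial E_{th}$ which is parametrized diffeomorphically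 by $x\mapsto x+t\,h(x)\,\nu(x)$, $x\in\Sigma$, and whose exterior unit normal $\nu_{t}$ satisfies $\langle\nu_t(x+t h(x)\nu(x)),\nu(x)\rangle>0$ for all $x\in\Sigma$. Fix $p\in\Sigma$ and put $p_t=p+t\,h(p)\,\nu(p)\in\Sigma_{th}$. Then the principal value defining $H^s_{\Sigma_{th}}(p_t)$ converges for all $t$ near $0$, the principal value and the (absolute) integral defining $\mathcal J^s_\Sigma[h](p)$ converge, the function $t\mapsto H^s_{\Sigma_{th}}(p_t)$ is differentiable at $t=0$, and $$\frac{d}{dt}H^s_{\Sigma_{th}}(p_t)\Big|_{t=0}=2\,\mathcal J^s_\Sigma[h](p).$$ -/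

import Mathlib

open MeasureTheory Set Filter Topology
open scoped ContDiff

noncomputable section

/-- On the open set `U`, the set `E` is the sublevel set `{φ < 0}` of a smooth function `φ`
without critical points. -/
structure IsDefiningFunctionOn {N : ℕ} (E U : Set (EuclideanSpace ℝ (Fin N)))
    (φ : EuclideanSpace ℝ (Fin N) → ℝ) : Prop where
  isOpen : IsOpen U
  contDiffOn : ContDiffOn ℝ ∞ φ U
  gradient_ne_zero : ∀ x ∈ U, gradient φ x ≠ 0
  inter_eq : E ∩ U = {x | φ x < 0} ∩ U

/-- `E` is an open set with smooth boundary (lying locally on one side of it). -/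
structure IsSmoothOpenSet {N : ℕ} (E : Set (EuclideanSpace ℝ (Fin N))) : Prop where
  isOpen : IsOpen E
  exists_definingFunction : ∀ x ∈ frontier E, ∃ U φ, x ∈ U ∧ IsDefiningFunctionOn E U φ

/-- `n` is the unit normal vector of `∂E` at `x ∈ ∂E` pointing to the exterior of `E`. -/
def IsOuterNormalAt {N : ℕ} (E : Set (EuclideanSpace ℝ (Fin N)))
    (x n : EuclideanSpace ℝ (Fin N)) : Prop :=
  x ∈ frontier E ∧ ∃ U φ, x ∈ U ∧ IsDefiningFunctionOn E U φ ∧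
    n = ‖gradient φ x‖⁻¹ • gradient φ x

/-- The exterior unit normal field `ν` of `∂E` (a junk value off the regular part of `∂E`). -/
def outerNormal {N : ℕ} (E : Set (EuclideanSpace ℝ (Fin N)))
    (x : EuclideanSpace ℝ (Fin N)) : EuclideanSpace ℝ (Fin N) :=
  Classical.epsilon (IsOuterNormalAt E x)

/-- The surface measure of `∂E`: the `(N-1)`-dimensional Hausdorff measure, normalized so as to
agree with Lebesgue measure on hyperplanes. -/
def surfaceMeasure {N : ℕ} (E : Set (EuclideanSpace ℝ (Fin N))) :
    Measure (EuclideanSpace ℝ (Fin N)) :=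
  (Measure.euclideanHausdorffMeasure (N - 1)).restrict (frontier E)

/-- `p.v. ∫ f dμ` converges, the singularity being at `p`: `f` is absolutely integrable off every
ball around `p`, and the integrals off these balls converge as the radius tends to zero. -/
def PVConverges {N : ℕ} (μ : Measure (EuclideanSpace ℝ (Fin N)))
    (f : EuclideanSpace ℝ (Fin N) → ℝ) (p : EuclideanSpace ℝ (Fin N)) : Prop :=
  (∀ ε : ℝ, 0 < ε → IntegrableOn f {x | ε < ‖x - p‖} μ) ∧
    ∃ L : ℝ, Tendsto (fun ε : ℝ => ∫ x in {x | ε < ‖x - p‖}, f x ∂μ) (𝓝[>] 0) (𝓝 L)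

/-- `p.v. ∫ f dμ`, the singularity being at `p`. -/
def principalValue {N : ℕ} (μ : Measure (EuclideanSpace ℝ (Fin N)))
    (f : EuclideanSpace ℝ (Fin N) → ℝ) (p : EuclideanSpace ℝ (Fin N)) : ℝ :=
  limUnder (𝓝[>] (0 : ℝ)) (fun ε : ℝ => ∫ x in {x | ε < ‖x - p‖}, f x ∂μ)

/-- The integrand `(χ_E(x) - χ_{ℝ^N ∖ E}(x)) / |x - p|^{N+s}`. -/
def meanCurvatureIntegrand {N : ℕ} (s : ℝ) (E : Set (EuclideanSpace ℝ (Fin N)))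
    (p x : EuclideanSpace ℝ (Fin N)) : ℝ :=
  (E.indicator (fun _ => (1 : ℝ)) x - Eᶜ.indicator (fun _ => (1 : ℝ)) x) /
    ‖x - p‖ ^ ((N : ℝ) + s)

/-- The nonlocal mean curvature `H^s_{∂E}(p)`. -/
def nonlocalMeanCurvature {N : ℕ} (s : ℝ) (E : Set (EuclideanSpace ℝ (Fin N)))
    (p : EuclideanSpace ℝ (Fin N)) : ℝ :=
  principalValue volume (meanCurvatureIntegrand s E p) p

/-- The integrand `(h(x) - h(p)) / |p - x|^{N+s}` of the nonlocal Jacobi operator. -/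
def jacobiIntegrand {N : ℕ} (s : ℝ) (h : EuclideanSpace ℝ (Fin N) → ℝ)
    (p x : EuclideanSpace ℝ (Fin N)) : ℝ :=
  (h x - h p) / ‖p - x‖ ^ ((N : ℝ) + s)

/-- The integrand `⟨ν(p) - ν(x), ν(p)⟩ / |p - x|^{N+s}` of the nonlocal Jacobi operator. -/
def jacobiPotentialIntegrand {N : ℕ} (s : ℝ) (E : Set (EuclideanSpace ℝ (Fin N)))
    (p x : EuclideanSpace ℝ (Fin N)) : ℝ :=
  inner ℝ (outerNormal E p - outerNormal E x) (outerNormal E p) / ‖p - x‖ ^ ((N : ℝ) + s)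

/-- The nonlocal Jacobi operator `J^s_{∂E}[h](p)`. -/
def nonlocalJacobi {N : ℕ} (s : ℝ) (E : Set (EuclideanSpace ℝ (Fin N)))
    (h : EuclideanSpace ℝ (Fin N) → ℝ) (p : EuclideanSpace ℝ (Fin N)) : ℝ :=
  principalValue (surfaceMeasure E) (jacobiIntegrand s h p) p +
    h p * ∫ x, jacobiPotentialIntegrand s E p x ∂(surfaceMeasure E)

/-- The map `x ↦ x + t h(x) ν(x)`. -/
def normalShift {N : ℕ} (E : Set (EuclideanSpace ℝ (Fin N)))
    (h : EuclideanSpace ℝ (Fin N) → ℝ) (t : ℝ) (x : EuclideanSpace ℝ (Fin N)) :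
    EuclideanSpace ℝ (Fin N) :=
  x + (t * h x) • outerNormal E x

/-- `F` is the set `E_{th}`: an open set with smooth boundary, whose boundary is parametrized by
`x ↦ x + t h(x) ν(x)`, `x ∈ ∂E` (a diffeomorphism of `∂E` onto `∂F`), and whose exterior normal
points to the same side as `ν`. -/
structure IsNormalPerturbation {N : ℕ} (E : Set (EuclideanSpace ℝ (Fin N)))
    (h : EuclideanSpace ℝ (Fin N) → ℝ) (t : ℝ) (F : Set (EuclideanSpace ℝ (Fin N))) : Prop where
  isSmoothOpenSet : IsSmoothOpenSet F
  frontier_eq : frontier F = normalShift E h t '' frontier E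
  exists_inverse : ∃ g : EuclideanSpace ℝ (Fin N) → EuclideanSpace ℝ (Fin N),
    ContDiffOn ℝ ∞ g (frontier F) ∧ ∀ x ∈ frontier E, g (normalShift E h t x) = x
  inner_normal_pos : ∀ x ∈ frontier E,
    0 < inner ℝ (outerNormal F (normalShift E h t x)) (outerNormal E x)

end

-- Write `N = M + 1`, `β = N + s` and `d = h(p) ν(p)`, and let `F_t = E_{th} - t d`. The translation
-- brings `p_t` back to `p`, so that the nonlocal mean curvature at `p_t` is the principal value at
-- `p` of `± |x - p|^(-β)`, with `+` on `F_t` and `-` off it. At time zero the boundary of `F_t`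
-- moves with normal velocity `h(x) - ⟨ν(x), d⟩`, and the sign jumps by 2 across it. Formally the
-- derivative is therefore `2 p.v. ∫_Σ |x - p|^(-β) (h(x) - h(p) ⟨ν(x), ν(p)⟩) dx`, and this is `2
-- J[h](p)`, because `h(x) - h(p) ⟨ν(x), ν(p)⟩ = (h(x) - h(p)) + h(p) ⟨ν(p) - ν(x), ν(p)⟩`.
--
-- To differentiate under the singular integral, the kernel is split into a far part `max(|z|,
-- ε)^(-β)`, continuous with good decay, and a near part `max(0, |z|^(-β) - ε^(-β))`, which vanishes
-- off the ball of radius `ε`.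
--
-- Far part. For compactly supported test functions the first variation formula follows from charts,
-- Fubini and a partition of unity (`IsPerturbationFamily.hasDerivAt_integral`). It passes to
-- decaying functions (`hasDerivAt_integral_of_decay`) once the tails contribute `o(1) |t|`. This
-- holds because `E_{th}` and `E_0` differ only in the region swept out by the boundary
-- (`symmDiff_subset`), whose weighted volume is at most `K |t|` times the weighted area
-- (`exists_lintegral_tube_le`). No curvature bound on `Σ` is needed: since the normal shifts are
-- diffeomorphisms for all small times, `1 + r S`, with `S` the shape operator, is invertible on the
-- whole range of `r` swept out, and this alone bounds its determinant.
--
-- Near part. Around `p` the sets `F_t` are subgraphs of functions `Γ(t, ·)` with `Γ(t, 0) = 0`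
-- (`exists_moving_graph`). The kernel is even, so only the even part of the sign counts. On the
-- fibre over `v` it is a signed interval with endpoints `-Γ(t, -v)` and `Γ(t, v)`, of length
-- `O(|v|^2)`. This gives a density `O(|v|^(2-β))`, integrable in dimension `M` because `s < 1`. The
-- time derivative has the same bound, again by cancellation between `v` and `-v`, so dominated
-- differentiation applies (`hasDerivAt_integral_evenSign`). The result is a symmetrized integral
-- over the graph. It is twice the surface principal value, since Euclidean balls and balls in the
-- parameter differ only to second order (`tendsto_integral_inter_gt`).
--
-- Integrals over `Σ` are computed through the area formula for graphs, which is derived from the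
-- linear case by local bi-Lipschitz comparison.

local notation "𝔼[" n "]" => EuclideanSpace ℝ (Fin n)

/-! ### Orthogonal frames -/

/-- A linear identification of `V × ℝ` with `X` which is an isometry for the Euclidean norm of the
product. -/
structure IsFrame {M : ℕ} (ι : (𝔼[M] × ℝ) ≃L[ℝ] 𝔼[M + 1]) : Prop where
  norm_sq : ∀ q : 𝔼[M] × ℝ, ‖ι q‖ ^ 2 = ‖q.1‖ ^ 2 + q.2 ^ 2

namespace IsFrame

variable {M : ℕ} {ι : (𝔼[M] × ℝ) ≃L[ℝ] 𝔼[M + 1]}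

theorem inner_apply (hι : IsFrame ι) (q q' : 𝔼[M] × ℝ) :
    inner ℝ (ι q) (ι q') = inner ℝ q.1 q'.1 + q.2 * q'.2 := by
  have h1 := hι.norm_sq (q + q')
  have h2 := hι.norm_sq q
  have h3 := hι.norm_sq q'
  rw [map_add, norm_add_sq_real] at h1
  simp only [Prod.fst_add, Prod.snd_add] at h1
  rw [norm_add_sq_real] at h1
  nlinarith

theorem norm_fst_le (hι : IsFrame ι) (q : 𝔼[M] × ℝ) : ‖q.1‖ ≤ ‖ι q‖ := by
  have h := hι.norm_sq q
  exact abs_le_of_sq_le_sq' (by nlinarith [sq_nonneg q.2]) (norm_nonneg _) |>.2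

theorem abs_snd_le (hι : IsFrame ι) (q : 𝔼[M] × ℝ) : |q.2| ≤ ‖ι q‖ := by
  have h := hι.norm_sq q
  exact abs_le_of_sq_le_sq (by nlinarith [sq_nonneg ‖q.1‖]) (norm_nonneg _)

theorem norm_le (hι : IsFrame ι) (q : 𝔼[M] × ℝ) : ‖ι q‖ ≤ ‖q.1‖ + |q.2| := by
  have h := hι.norm_sq q
  refine (abs_le_of_sq_le_sq' ?_ (by positivity)).2
  nlinarith [mul_nonneg (norm_nonneg q.1) (abs_nonneg q.2), sq_abs q.2]

theorem measurePreserving (hι : IsFrame ι) : MeasurePreserving ι volume volume := by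
  -- The norm of `𝔼[M] × ℝ` is the sup norm. It is the `L²` product norm for which `ι` is an
  -- isometry, and changing between the two norms preserves volume.
  let L : WithLp 2 (𝔼[M] × ℝ) ≃ₗᵢ[ℝ] 𝔼[M + 1] :=
    { toLinearEquiv := ((WithLp.prodContinuousLinearEquiv 2 ℝ 𝔼[M] ℝ).trans ι).toLinearEquiv
      norm_map' := fun q => by
        have h := hι.norm_sq (q.fst, q.snd)
        have h2 := WithLp.prod_norm_sq_eq_of_L2 q
        rw [Real.norm_eq_abs, sq_abs] at h2
        have h3 : ‖ι (q.fst, q.snd)‖ ^ 2 = ‖q‖ ^ 2 := by rw [h, h2]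
        exact (pow_left_inj₀ (norm_nonneg _) (norm_nonneg _) two_ne_zero).1 h3 }
  exact L.measurePreserving.comp (WithLp.volume_preserving_toLp 𝔼[M] ℝ)

theorem exists_of_norm_eq_one {e : 𝔼[M + 1]} (he : ‖e‖ = 1) :
    ∃ ι : (𝔼[M] × ℝ) ≃L[ℝ] 𝔼[M + 1], IsFrame ι ∧ ι (0, 1) = e := by
  have he0 : e ≠ 0 := by
    rintro rfl
    simp at he
  have : Fact (Module.finrank ℝ 𝔼[M + 1] = M + 1) := ⟨by simp⟩
  have hfin : Module.finrank ℝ (ℝ ∙ e)ᗮ = M := Submodule.finrank_orthogonal_span_singleton he0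
  let b := (stdOrthonormalBasis ℝ (ℝ ∙ e)ᗮ).reindex (finCongr hfin)
  let L : 𝔼[M] ≃ₗᵢ[ℝ] (ℝ ∙ e)ᗮ := b.repr.symm
  let f : (𝔼[M] × ℝ) →ₗ[ℝ] 𝔼[M + 1] :=
    LinearMap.coprod ((ℝ ∙ e)ᗮ.subtype ∘ₗ L.toLinearEquiv.toLinearMap)
      (LinearMap.toSpanSingleton ℝ _ e)
  have hf : ∀ q, f q = (L q.1 : 𝔼[M + 1]) + q.2 • e := fun q => by simp [f]
  have hnorm : ∀ q, ‖f q‖ ^ 2 = ‖q.1‖ ^ 2 + q.2 ^ 2 := fun q => by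
    have h0 : inner ℝ (L q.1 : 𝔼[M + 1]) e = 0 := by
      have := Submodule.mem_orthogonal_singleton_iff_inner_left.1 (L q.1).2
      exact this
    rw [hf, norm_add_sq_real, inner_smul_right, h0, norm_smul, he]
    have : ‖(L q.1 : 𝔼[M + 1])‖ = ‖q.1‖ := by rw [Submodule.norm_coe, L.norm_map]
    rw [this]
    simp
  have hinj : Function.Injective f := by
    rw [injective_iff_map_eq_zero]
    intro q hq
    have h := hnorm q
    rw [hq, norm_zero] at h
    have h1 : ‖q.1‖ = 0 := by nlinarith [sq_nonneg ‖q.1‖, sq_nonneg q.2]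
    have h2 : q.2 = 0 := by nlinarith [sq_nonneg ‖q.1‖, sq_nonneg q.2]
    exact Prod.ext (norm_eq_zero.1 h1) h2
  let ι := (LinearMap.linearEquivOfInjective f hinj (by simp)).toContinuousLinearEquiv
  refine ⟨ι, ⟨hnorm⟩, ?_⟩
  change f (0, 1) = e
  rw [hf]
  simp

end IsFrame

/-! ### The surface measure of a graph -/

section GraphMeasure

variable {M : ℕ} {ι : (𝔼[M] × ℝ) ≃L[ℝ] 𝔼[M + 1]}

/-- The parametrization of the graph of `γ` in the frame `ι` with origin `x₀`. -/
def graphMap {M : ℕ} (ι : (𝔼[M] × ℝ) ≃L[ℝ] 𝔼[M + 1]) (x₀ : 𝔼[M + 1]) (γ : 𝔼[M] → ℝ)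
    (v : 𝔼[M]) : 𝔼[M + 1] :=
  x₀ + ι (v, γ v)

/-- The projection of `X` to `V` in the frame `ι` with origin `x₀`. -/
def frameProj {M : ℕ} (ι : (𝔼[M] × ℝ) ≃L[ℝ] 𝔼[M + 1]) (x₀ x : 𝔼[M + 1]) : 𝔼[M] :=
  (ι.symm (x - x₀)).1

theorem continuous_frameProj (x₀ : 𝔼[M + 1]) : Continuous (frameProj ι x₀) := by
  unfold frameProj
  fun_prop

@[simp]
theorem frameProj_add (x₀ : 𝔼[M + 1]) (q : 𝔼[M] × ℝ) : frameProj ι x₀ (x₀ + ι q) = q.1 := by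
  simp [frameProj]

@[simp]
theorem frameProj_graphMap (x₀ : 𝔼[M + 1]) (γ : 𝔼[M] → ℝ) (v : 𝔼[M]) :
    frameProj ι x₀ (graphMap ι x₀ γ v) = v := by
  simp [graphMap]

/-- Where `f` takes equal values so does `g`; hence `g` factors through `f` by a `K`-Lipschitz map
defined on `f '' A`, and such a map multiplies `d`-dimensional measure by at most `K ^ d`. -/
theorem euclideanHausdorffMeasure_image_le_of_dist_le {Y Z : Type*} {d : ℕ} [Nonempty 𝔼[d]]
    [MetricSpace Y] [MeasurableSpace Y] [BorelSpace Y] [MetricSpace Z] [MeasurableSpace Z]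
    [BorelSpace Z] {T : Type*} [Nonempty T] {f : T → Y} {g : T → Z} {A : Set T} {K : NNReal}
    (h : ∀ a ∈ A, ∀ b ∈ A, dist (g a) (g b) ≤ K * dist (f a) (f b)) :
    μHE[d] (g '' A) ≤ (K : ENNReal) ^ d * μHE[d] (f '' A) := by
  have hinv : ∀ a ∈ A, f (Function.invFunOn f A (f a)) = f a ∧ Function.invFunOn f A (f a) ∈ A :=
    fun a ha => ⟨Function.invFunOn_apply_eq ha, Function.invFunOn_apply_mem ha⟩
  have hg : ∀ a ∈ A, g (Function.invFunOn f A (f a)) = g a := fun a ha => by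
    have := h _ (hinv a ha).2 a ha
    rw [(hinv a ha).1, dist_self, mul_zero] at this
    exact dist_le_zero.1 this
  have hL : LipschitzOnWith K (g ∘ Function.invFunOn f A) (f '' A) := by
    refine LipschitzOnWith.of_dist_le_mul ?_
    rintro _ ⟨a, ha, rfl⟩ _ ⟨b, hb, rfl⟩
    simp only [Function.comp_apply, hg a ha, hg b hb]
    exact h a ha b hb
  have himg : g '' A = (g ∘ Function.invFunOn f A) '' (f '' A) := by
    rw [image_image]
    exact image_congr fun a ha => (hg a ha).symm
  rw [himg, Measure.euclideanHausdorffMeasure_def, Measure.euclideanHausdorffMeasure_def,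
    Measure.smul_apply, Measure.smul_apply]
  have h1 := hL.hausdorffMeasure_image_le (d := (d : ℝ)) (Nat.cast_nonneg d)
  rw [ENNReal.rpow_natCast] at h1
  calc _ ≤ (Measure.addHaarScalarFactor (volume : Measure 𝔼[d]) μH[d]) •
        ((K : ENNReal) ^ d * μH[d] (f '' A)) := by gcongr
    _ = _ := by rw [mul_smul_comm]

/-- Countably many of the neighbourhoods cover `s`. After `A` is cut into disjoint pieces,
additivity is needed for `ν` only; for `m` subadditivity is enough. The generality matters: `m` will
also be the weighted volume of the tube over a set, which is not additive. -/
theorem le_measure_of_locally_le {T : Type*} [TopologicalSpace T] [SecondCountableTopology T]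
    [MeasurableSpace T] [OpensMeasurableSpace T] {m : Set T → ENNReal} {ν : Measure T} {s : Set T}
    (h0 : m ∅ = 0) (hm : ∀ B : ℕ → Set T, m (⋃ n, B n) ≤ ∑' n, m (B n))
    (h : ∀ x ∈ s, ∃ U ∈ 𝓝 x, ∀ A ⊆ U, A ⊆ s → MeasurableSet A → m A ≤ ν A) {A : Set T} (hA : A ⊆ s)
    (hAm : MeasurableSet A) : m A ≤ ν A := by
  choose! U hU hle using h
  obtain ⟨t, hts, htc, hcov⟩ := TopologicalSpace.countable_cover_nhdsWithin
    (f := fun x => interior (U x)) (s := s)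
    fun x hx => mem_nhdsWithin_of_mem_nhds (interior_mem_nhds.2 (hU x hx))
  rcases t.eq_empty_or_nonempty with rfl | hne
  · have : A = ∅ := by
      have := hA.trans hcov
      simpa using this
    simp [this, h0]
  obtain ⟨f, rfl⟩ := htc.exists_eq_range hne
  let B : ℕ → Set T := fun n => A ∩ disjointed (fun n => interior (U (f n))) n
  have hBm : ∀ n, MeasurableSet (B n) := fun n =>
    hAm.inter (MeasurableSet.disjointed (fun n => isOpen_interior.measurableSet) n)
  have hBd : Pairwise (Function.onFun Disjoint B) := fun i j hij =>
    (disjoint_disjointed _ hij).mono inter_subset_right inter_subset_right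
  have hAB : A = ⋃ n, B n := by
    rw [← inter_iUnion, iUnion_disjointed, eq_comm, inter_eq_left]
    exact (hA.trans hcov).trans (by simp)
  rw [hAB, measure_iUnion hBd hBm]
  refine (hm B).trans ?_
  refine ENNReal.tsum_le_tsum fun n => hle (f n) (hts (mem_range_self n)) _ ?_ ?_ (hBm n)
  · exact inter_subset_right.trans ((disjointed_subset _ n).trans interior_subset)
  · exact inter_subset_left.trans hA

/-- The Gram matrix of the columns is the identity plus a rank one matrix, so its determinant is `1
+ ‖l‖ ^ 2`. -/
theorem normDet_graph (hι : IsFrame ι) (l : 𝔼[M] →L[ℝ] ℝ) :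
    LinearMap.normDet (ι.toLinearMap ∘ₗ (LinearMap.id.prod l.toLinearMap)) =
      √(1 + ‖l‖ ^ 2) := by
  set f := ι.toLinearMap ∘ₗ (LinearMap.id.prod l.toLinearMap)
  let b := EuclideanSpace.basisFun (Fin M) ℝ
  have h := f.normDet_sq_eq_det_gram b
  have hgram : Matrix.gram ℝ (fun x => f (b x)) =
      1 + Matrix.replicateCol Unit (fun i => l (b i)) *
        Matrix.replicateRow Unit (fun i => l (b i)) := by
    ext i j
    have : inner ℝ (f (b i)) (f (b j)) = inner ℝ (b i) (b j) + l (b i) * l (b j) :=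
      hι.inner_apply (b i, l (b i)) (b j, l (b j))
    rw [Matrix.gram_apply, this, b.inner_eq_ite]
    simp [Matrix.mul_apply, Matrix.one_apply]
  have hl : ‖l‖ ^ 2 = ∑ i, l (b i) * l (b i) := by
    have hr : ∀ i, l (b i) = inner ℝ ((InnerProductSpace.toDual ℝ _).symm l) (b i) := fun i => by
      rw [InnerProductSpace.toDual_symm_apply]
    rw [← (InnerProductSpace.toDual ℝ 𝔼[M]).symm.norm_map l, ← b.sum_sq_norm_inner_left]
    refine Finset.sum_congr rfl fun i _ => ?_
    rw [hr, Real.norm_eq_abs, sq_abs, sq]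
  rw [hgram, Matrix.det_one_add_replicateCol_mul_replicateRow, dotProduct, ← hl] at h
  rw [← show f.normDet ^ 2 = 1 + ‖l‖ ^ 2 from h, Real.sqrt_sq f.normDet_nonneg]

end GraphMeasure

/-! ### The area formula for graphs -/

section GraphArea

variable {M : ℕ} {ι : (𝔼[M] × ℝ) ≃L[ℝ] 𝔼[M + 1]}

theorem IsFrame.dist_le_dist_graphMap (hι : IsFrame ι) (x₀ : 𝔼[M + 1]) (γ : 𝔼[M] → ℝ)
    (a b : 𝔼[M]) : dist a b ≤ dist (graphMap ι x₀ γ a) (graphMap ι x₀ γ b) := by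
  rw [dist_eq_norm, dist_eq_norm, graphMap, graphMap, add_sub_add_left_eq_sub, ← map_sub]
  exact hι.norm_fst_le ((a, γ a) - (b, γ b))

/-- The area element of the graph of `γ`. -/
noncomputable def areaElement {M : ℕ} (γ : 𝔼[M] → ℝ) (v : 𝔼[M]) : ℝ :=
  √(1 + ‖fderiv ℝ γ v‖ ^ 2)

theorem one_le_areaElement (γ : 𝔼[M] → ℝ) (v : 𝔼[M]) : 1 ≤ areaElement γ v := by
  rw [areaElement, Real.one_le_sqrt]
  nlinarith [sq_nonneg ‖fderiv ℝ γ v‖]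

theorem areaElement_pos (γ : 𝔼[M] → ℝ) (v : 𝔼[M]) : 0 < areaElement γ v :=
  zero_lt_one.trans_le (one_le_areaElement γ v)

/-- Near `v₀` the graph map differs from its differential `D` by a `c`-Lipschitz map, and neither of
the two contracts distances; so each is `(1 + c)`-Lipschitz with respect to the other. The image `D
'' A` has measure `J₀ * volume A`. The exponent `M + 1` collects `M` Lipschitz factors and one for
the oscillation of the area element. -/
theorem IsFrame.exists_nhds_graph_measure_le (hι : IsFrame ι) (x₀ : 𝔼[M + 1]) {γ : 𝔼[M] → ℝ}
    {v₀ : 𝔼[M]} (hγ : ContDiffAt ℝ 1 γ v₀) {c : NNReal} (hc : 0 < c) :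
    ∃ U ∈ 𝓝 v₀, ∀ A ⊆ U, MeasurableSet A →
      μHE[M] (graphMap ι x₀ γ '' A) ≤
        (1 + c : ENNReal) ^ (M + 1) * ∫⁻ v in A, ENNReal.ofReal (areaElement γ v) ∧
      ∫⁻ v in A, ENNReal.ofReal (areaElement γ v) ≤
        (1 + c : ENNReal) ^ (M + 1) * μHE[M] (graphMap ι x₀ γ '' A) := by
  set J₀ := areaElement γ v₀
  have hJ₀ : 0 < J₀ := areaElement_pos γ v₀
  have hd : HasStrictFDerivAt γ (fderiv ℝ γ v₀) v₀ := hγ.hasStrictFDerivAt one_ne_zero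
  set l := fderiv ℝ γ v₀ with hl
  let D : 𝔼[M] →L[ℝ] 𝔼[M + 1] := (ι : (𝔼[M] × ℝ) →L[ℝ] 𝔼[M + 1]) ∘L
    ((ContinuousLinearMap.id ℝ 𝔼[M]).prod l)
  have hDd : HasStrictFDerivAt (graphMap ι x₀ γ) D v₀ := by
    have h1 : HasStrictFDerivAt (fun v => (v, γ v)) ((ContinuousLinearMap.id ℝ 𝔼[M]).prod l) v₀ :=
      (hasStrictFDerivAt_id v₀).prodMk hd
    exact (ι.hasStrictFDerivAt.comp v₀ h1).const_add x₀
  have hDn : ∀ a, ‖a‖ ≤ ‖D a‖ := fun a => hι.norm_fst_le (a, l a)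
  obtain ⟨U₁, hU₁, hap⟩ := hDd.approximates_deriv_on_nhds (c := c) (Or.inr hc)
  have hcont : ContinuousAt (areaElement γ) v₀ := by
    have : ContinuousAt (fderiv ℝ γ) v₀ :=
      (hγ.fderiv_right (m := 0) (by norm_num)).continuousAt
    exact ((this.norm.pow 2).const_add 1).sqrt
  have hc1 : (1 : ℝ) < 1 + c := by
    have : (0 : ℝ) < c := hc
    linarith
  have hU₂ : ∀ᶠ v in 𝓝 v₀, areaElement γ v < (1 + c) * J₀ :=
    hcont.eventually_lt_const (by nlinarith)
  have hU₃ : ∀ᶠ v in 𝓝 v₀, J₀ < (1 + c) * areaElement γ v :=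
    (hcont.const_mul (1 + c : ℝ)).eventually_const_lt (by
      change J₀ < (1 + c) * J₀
      nlinarith)
  refine ⟨U₁ ∩ ({v | areaElement γ v < (1 + c) * J₀} ∩ {v | J₀ < (1 + c) * areaElement γ v}),
    inter_mem hU₁ (inter_mem hU₂ hU₃), fun A hA hAm => ?_⟩
  have happ : ∀ a ∈ A, ∀ b ∈ A,
      ‖graphMap ι x₀ γ a - graphMap ι x₀ γ b - D (a - b)‖ ≤ c * ‖a - b‖ :=
    fun a ha b hb => hap a (hA ha).1 b (hA hb).1
  have hle1 : μHE[M] (graphMap ι x₀ γ '' A) ≤ ((1 + c : NNReal) : ENNReal) ^ M * μHE[M] (D '' A) := by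
    refine euclideanHausdorffMeasure_image_le_of_dist_le fun a ha b hb => ?_
    rw [dist_eq_norm, dist_eq_norm, ← map_sub]
    have h1 := happ a ha b hb
    have h2 := hDn (a - b)
    have h3 := norm_le_norm_add_norm_sub' (graphMap ι x₀ γ a - graphMap ι x₀ γ b) (D (a - b))
    have h4 : (c : ℝ) * ‖a - b‖ ≤ c * ‖D (a - b)‖ := by gcongr
    push_cast
    linarith
  have hle2 : μHE[M] (D '' A) ≤ ((1 + c : NNReal) : ENNReal) ^ M * μHE[M] (graphMap ι x₀ γ '' A) := by
    refine euclideanHausdorffMeasure_image_le_of_dist_le fun a ha b hb => ?_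
    rw [dist_eq_norm, dist_eq_norm, ← map_sub]
    have h1 := happ a ha b hb
    have h2 := hι.dist_le_dist_graphMap x₀ γ a b
    rw [dist_eq_norm, dist_eq_norm] at h2
    have h3 := norm_le_norm_add_norm_sub (graphMap ι x₀ γ a - graphMap ι x₀ γ b) (D (a - b))
    have h4 : (c : ℝ) * ‖a - b‖ ≤ c * ‖graphMap ι x₀ γ a - graphMap ι x₀ γ b‖ := by gcongr
    push_cast
    linarith
  have hDA : μHE[M] (D '' A) = ENNReal.ofReal J₀ * volume A := by
    have h := LinearMap.euclideanHausdorffMeasure_image_eq_normDet_mul_volume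
      (ι.toLinearMap ∘ₗ (LinearMap.id.prod l.toLinearMap)) A
    rw [normDet_graph hι l, finrank_euclideanSpace, Fintype.card_fin] at h
    exact h
  have h1c : ((1 + c : NNReal) : ENNReal) = 1 + c := by push_cast; rfl
  have h1c' : (1 + c : ENNReal) = ENNReal.ofReal (1 + (c : ℝ)) := by
    rw [ENNReal.ofReal_add zero_le_one c.coe_nonneg]
    simp
  rw [h1c, hDA] at hle1 hle2
  have hJ1 : ENNReal.ofReal J₀ * volume A ≤
      (1 + c : ENNReal) * ∫⁻ v in A, ENNReal.ofReal (areaElement γ v) := by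
    rw [← setLIntegral_const, ← lintegral_const_mul' _ _ (by simp)]
    refine setLIntegral_mono_ae' hAm (ae_of_all _ fun v hv => ?_)
    rw [h1c', ← ENNReal.ofReal_mul (by positivity)]
    exact ENNReal.ofReal_le_ofReal (hA hv).2.2.le
  have hJ2 : ∫⁻ v in A, ENNReal.ofReal (areaElement γ v) ≤
      (1 + c : ENNReal) * (ENNReal.ofReal J₀ * volume A) := by
    rw [← setLIntegral_const, ← lintegral_const_mul' _ _ (by simp)]
    refine setLIntegral_mono_ae' hAm (ae_of_all _ fun v hv => ?_)
    rw [h1c', ← ENNReal.ofReal_mul (by positivity)]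
    exact ENNReal.ofReal_le_ofReal (hA hv).2.1.le
  constructor
  · rw [pow_succ, mul_assoc]
    exact hle1.trans (by gcongr)
  · rw [pow_succ', mul_assoc]
    exact hJ2.trans (by gcongr)

theorem ENNReal.le_of_forall_one_add_pow_mul_le {a b : ENNReal} (n : ℕ)
    (h : ∀ c : NNReal, 0 < c → a ≤ (1 + c : ENNReal) ^ n * b) : a ≤ b := by
  have hcont : Tendsto (fun c : NNReal => ((1 + c : NNReal) : ENNReal) ^ n * b) (𝓝[>] 0)
      (𝓝 (((1 + 0 : NNReal) : ENNReal) ^ n * b)) := by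
    refine ENNReal.Tendsto.mul_const ?_ (Or.inl (by simp))
    have : Continuous fun c : NNReal => (((1 + c) ^ n : NNReal) : ENNReal) := by fun_prop
    have h2 := this.continuousAt (x := 0)
    simp only [ENNReal.coe_pow] at h2
    exact h2.mono_left nhdsWithin_le_nhds
  simp only [add_zero, ENNReal.coe_one, one_pow, one_mul] at hcont
  refine ge_of_tendsto hcont ?_
  filter_upwards [self_mem_nhdsWithin] with c hc
  simpa using h c hc

/-- The area formula for graphs. -/
theorem IsFrame.map_frameProj_graph (hι : IsFrame ι) (x₀ : 𝔼[M + 1]) {γ : 𝔼[M] → ℝ} {s : Set 𝔼[M]}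
    (hs : IsOpen s) (hγ : ContDiffOn ℝ 1 γ s) :
    ((μHE[M]).restrict (graphMap ι x₀ γ '' s)).map (frameProj ι x₀) =
      (volume.restrict s).withDensity fun v => ENNReal.ofReal (areaElement γ v) := by
  have hproj := (continuous_frameProj (ι := ι) x₀).measurable
  set μ := ((μHE[M]).restrict (graphMap ι x₀ γ '' s)).map (frameProj ι x₀) with hμ
  set ν := (volume.restrict s).withDensity fun v => ENNReal.ofReal (areaElement γ v) with hν
  have hμA : ∀ A, MeasurableSet A → μ A = μHE[M] (graphMap ι x₀ γ '' (A ∩ s)) := fun A hA => by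
    rw [hμ, Measure.map_apply hproj hA, Measure.restrict_apply (hproj hA)]
    congr 1
    ext x
    constructor
    · rintro ⟨hx, v, hv, rfl⟩
      rw [mem_preimage, frameProj_graphMap] at hx
      exact ⟨v, ⟨hx, hv⟩, rfl⟩
    · rintro ⟨v, hv, rfl⟩
      refine ⟨?_, v, hv.2, rfl⟩
      rw [mem_preimage, frameProj_graphMap]
      exact hv.1
  have hνA : ∀ A, MeasurableSet A → ν A = ∫⁻ v in A ∩ s, ENNReal.ofReal (areaElement γ v) :=
    fun A hA => by rw [hν, withDensity_apply _ hA, Measure.restrict_restrict hA]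
  -- The two measures agree up to a factor `(1 + c) ^ (M + 1)` on small sets, hence on all
  -- measurable subsets of `s`; then `c` tends to zero.
  have key : ∀ c : NNReal, 0 < c → ∀ A ⊆ s, MeasurableSet A →
      μ A ≤ (1 + c : ENNReal) ^ (M + 1) * ν A ∧ ν A ≤ (1 + c : ENNReal) ^ (M + 1) * μ A := by
    intro c hc A hAs hA
    have hloc : ∀ x ∈ s, ∃ U ∈ 𝓝 x, ∀ A ⊆ U, A ⊆ s → MeasurableSet A →
        μ A ≤ (1 + c : ENNReal) ^ (M + 1) * ν A ∧ ν A ≤ (1 + c : ENNReal) ^ (M + 1) * μ A := by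
      intro x hx
      obtain ⟨U, hU, hle⟩ := hι.exists_nhds_graph_measure_le x₀
        (hγ.contDiffAt (hs.mem_nhds hx)) hc
      refine ⟨U, hU, fun A hAU hAs hA => ?_⟩
      rw [hμA A hA, hνA A hA, inter_eq_left.2 hAs]
      exact hle A hAU hA
    constructor
    · have := le_measure_of_locally_le (m := μ) (ν := (1 + c : ENNReal) ^ (M + 1) • ν) (s := s)
        measure_empty (fun B => measure_iUnion_le B)
        (fun x hx => by
          obtain ⟨U, hU, hle⟩ := hloc x hx
          exact ⟨U, hU, fun A h1 h2 h3 => (hle A h1 h2 h3).1⟩) hAs hA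
      simpa using this
    · have := le_measure_of_locally_le (m := ν) (ν := (1 + c : ENNReal) ^ (M + 1) • μ) (s := s)
        measure_empty (fun B => measure_iUnion_le B)
        (fun x hx => by
          obtain ⟨U, hU, hle⟩ := hloc x hx
          exact ⟨U, hU, fun A h1 h2 h3 => (hle A h1 h2 h3).2⟩) hAs hA
      simpa using this
  ext A hA
  have hAs : μ A = μ (A ∩ s) ∧ ν A = ν (A ∩ s) := by
    have h := hA.inter hs.measurableSet
    rw [hμA A hA, hμA _ h, hνA A hA, hνA _ h, inter_assoc, inter_self]
    exact ⟨rfl, rfl⟩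
  rw [hAs.1, hAs.2]
  have hm := hA.inter hs.measurableSet
  exact le_antisymm
    (ENNReal.le_of_forall_one_add_pow_mul_le (M + 1) fun c hc =>
      (key c hc _ inter_subset_right hm).1)
    (ENNReal.le_of_forall_one_add_pow_mul_le (M + 1) fun c hc =>
      (key c hc _ inter_subset_right hm).2)

theorem continuousOn_areaElement {γ : 𝔼[M] → ℝ} {s : Set 𝔼[M]} (hs : IsOpen s)
    (hγ : ContDiffOn ℝ 1 γ s) : ContinuousOn (areaElement γ) s := by
  have h := hγ.continuousOn_fderiv_of_isOpen hs le_rfl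
  exact ((h.norm.pow 2).const_add 1).sqrt

theorem measurableSet_graphMap_image (x₀ : 𝔼[M + 1]) {γ : 𝔼[M] → ℝ} {s : Set 𝔼[M]}
    (hs : MeasurableSet s) (hγ : ContinuousOn γ s) : MeasurableSet (graphMap ι x₀ γ '' s) := by
  refine hs.image_of_continuousOn_injOn ?_ ?_
  · unfold graphMap
    fun_prop
  · intro a _ b _ hab
    simpa using congrArg (frameProj ι x₀) hab

/-- Change of variables in integrals over graphs. -/
theorem IsFrame.integral_graph (hι : IsFrame ι) (x₀ : 𝔼[M + 1]) {γ : 𝔼[M] → ℝ} {s : Set 𝔼[M]}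
    (hs : IsOpen s) (hγ : ContDiffOn ℝ 1 γ s) {f : 𝔼[M + 1] → ℝ} {g : 𝔼[M] → ℝ}
    (hg : AEStronglyMeasurable g (volume.restrict s))
    (hfg : ∀ v ∈ s, f (graphMap ι x₀ γ v) = g v) :
    (IntegrableOn f (graphMap ι x₀ γ '' s) μHE[M] ↔
      IntegrableOn (fun v => areaElement γ v * g v) s) ∧
    ∫ x in graphMap ι x₀ γ '' s, f x ∂μHE[M] = ∫ v in s, areaElement γ v * g v := by
  have hproj := (continuous_frameProj (ι := ι) x₀).measurable
  have hmap := hι.map_frameProj_graph x₀ hs hγ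
  have hms := measurableSet_graphMap_image (ι := ι) x₀ hs.measurableSet hγ.continuousOn
  have hJ : AEMeasurable (fun v => ENNReal.ofReal (areaElement γ v)) (volume.restrict s) :=
    ((continuousOn_areaElement hs hγ).aemeasurable hs.measurableSet).ennreal_ofReal
  have hae : f =ᵐ[(μHE[M]).restrict (graphMap ι x₀ γ '' s)] g ∘ frameProj ι x₀ := by
    refine (ae_restrict_iff' hms).2 (ae_of_all _ ?_)
    rintro _ ⟨v, hv, rfl⟩
    rw [Function.comp_apply, frameProj_graphMap, hfg v hv]
  have hg' : AEStronglyMeasurable g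
      (((μHE[M]).restrict (graphMap ι x₀ γ '' s)).map (frameProj ι x₀)) := by
    rw [hmap]
    exact hg.mono_ac (withDensity_absolutelyContinuous _ _)
  have htop : ∀ᵐ v ∂(volume.restrict s), ENNReal.ofReal (areaElement γ v) < ⊤ :=
    ae_of_all _ fun v => ENNReal.ofReal_lt_top
  have hsm : ∀ v, (ENNReal.ofReal (areaElement γ v)).toReal • g v = areaElement γ v * g v :=
    fun v => by rw [ENNReal.toReal_ofReal (areaElement_pos γ v).le, smul_eq_mul]
  constructor
  · rw [IntegrableOn, integrable_congr hae, ← integrable_map_measure hg' hproj.aemeasurable, hmap,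
      integrable_withDensity_iff_integrable_smul₀' hJ htop, IntegrableOn]
    simp_rw [hsm]
  · rw [integral_congr_ae hae]
    simp only [Function.comp_apply]
    rw [← integral_map hproj.aemeasurable hg', hmap,
      integral_withDensity_eq_integral_toReal_smul₀ hJ htop]
    simp_rw [hsm]

end GraphArea

/-! ### Outer normals -/

section OuterNormal

variable {N : ℕ} {E : Set 𝔼[N]}

theorem IsDefiningFunctionOn.differentiableAt {U : Set 𝔼[N]} {φ : 𝔼[N] → ℝ}
    (h : IsDefiningFunctionOn E U φ) {x : 𝔼[N]} (hx : x ∈ U) : DifferentiableAt ℝ φ x :=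
  (h.contDiffOn.contDiffAt (h.isOpen.mem_nhds hx)).differentiableAt (by simp)

theorem IsDefiningFunctionOn.eventually_mem_iff {U : Set 𝔼[N]} {φ : 𝔼[N] → ℝ}
    (h : IsDefiningFunctionOn E U φ) {x : 𝔼[N]} (hx : x ∈ U) :
    ∀ᶠ y in 𝓝 x, (y ∈ E ↔ φ y < 0) := by
  filter_upwards [h.isOpen.mem_nhds hx] with y hy
  have := Set.ext_iff.1 h.inter_eq y
  simpa [hy] using this

theorem notMem_of_mem_frontier (hE : IsOpen E) {x : 𝔼[N]} (hx : x ∈ frontier E) : x ∉ E := by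
  rw [hE.frontier_eq] at hx
  exact hx.2

/-- A boundary point lies outside the open set `E`, so `φ x ≥ 0` there. If `φ x > 0`, a whole
neighbourhood would miss `E`. -/
theorem IsDefiningFunctionOn.eq_zero {U : Set 𝔼[N]} {φ : 𝔼[N] → ℝ} (hE : IsOpen E)
    (h : IsDefiningFunctionOn E U φ) {x : 𝔼[N]} (hx : x ∈ U) (hxE : x ∈ frontier E) :
    φ x = 0 := by
  have hloc := h.eventually_mem_iff hx
  have h1 : ¬ φ x < 0 := fun h0 => notMem_of_mem_frontier hE hxE (hloc.self_of_nhds.2 h0)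
  refine le_antisymm ?_ (not_lt.1 h1)
  by_contra! h2
  have h3 : ∀ᶠ y in 𝓝 x, y ∉ E := by
    filter_upwards [hloc, (h.differentiableAt hx).continuousAt.eventually_const_lt h2] with y hy hy2
    rw [hy]
    exact not_lt.2 hy2.le
  exact (mem_closure_iff_frequently.1 (frontier_subset_closure hxE)) h3

theorem HasGradientAt.eventually_neg_of_inner_neg {φ : 𝔼[N] → ℝ} {g x d : 𝔼[N]}
    (hφ : HasGradientAt φ g x) (h0 : φ x = 0) (hd : inner ℝ g d < 0) :
    ∀ᶠ t in 𝓝[>] (0 : ℝ), φ (x + t • d) < 0 := by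
  have h1 : HasDerivAt (fun t : ℝ => φ (x + t • d)) (inner ℝ g d) 0 := by
    have h2 : HasDerivAt (fun t : ℝ => x + t • d) d 0 := by
      simpa using ((hasDerivAt_id (0 : ℝ)).smul_const d).const_add x
    have h3 : HasFDerivAt φ (InnerProductSpace.toDual ℝ _ g) (x + (0 : ℝ) • d) := by
      simpa using hφ.hasFDerivAt
    exact h3.comp_hasDerivAt (0 : ℝ) h2
  have h4 := (hasDerivAt_iff_tendsto_slope.1 h1).mono_left
    (nhdsWithin_mono _ (show Ioi (0 : ℝ) ⊆ {0}ᶜ from fun t ht => ne_of_gt ht))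
  filter_upwards [h4.eventually_lt_const hd, self_mem_nhdsWithin] with t ht ht0
  rw [slope_def_field, zero_smul, add_zero, h0, sub_zero, sub_zero] at ht
  have : (0 : ℝ) < t := ht0
  by_contra! h5
  exact absurd ht (not_lt.2 (by positivity))

/-- If the unit vectors `n₁` and `n₂` differed, then by strict Cauchy–Schwarz `φ₁` would decrease
and `φ₂` increase in the direction `n₂ - n₁`, so the two sublevel sets would differ arbitrarily
close to `x`. This is why the normal selected by `Classical.epsilon` does not depend on the defining
function. -/
theorem normalized_gradient_eq {φ₁ φ₂ : 𝔼[N] → ℝ} {x g₁ g₂ : 𝔼[N]} (h₁ : HasGradientAt φ₁ g₁ x)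
    (h₂ : HasGradientAt φ₂ g₂ x) (hg₁ : g₁ ≠ 0) (hg₂ : g₂ ≠ 0) (h₁0 : φ₁ x = 0) (h₂0 : φ₂ x = 0)
    (hloc : ∀ᶠ y in 𝓝 x, (φ₁ y < 0 ↔ φ₂ y < 0)) : ‖g₁‖⁻¹ • g₁ = ‖g₂‖⁻¹ • g₂ := by
  by_contra hne
  set n₁ := ‖g₁‖⁻¹ • g₁ with hn₁
  set n₂ := ‖g₂‖⁻¹ • g₂ with hn₂
  have hu₁ : ‖n₁‖ = 1 := by
    rw [hn₁, norm_smul, norm_inv, norm_norm, inv_mul_cancel₀ (norm_ne_zero_iff.2 hg₁)]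
  have hu₂ : ‖n₂‖ = 1 := by
    rw [hn₂, norm_smul, norm_inv, norm_norm, inv_mul_cancel₀ (norm_ne_zero_iff.2 hg₂)]
  have hlt : inner ℝ n₁ n₂ < 1 := (inner_lt_one_iff_real_of_norm_eq_one hu₁ hu₂).2 hne
  have hg₁' : g₁ = ‖g₁‖ • n₁ := by
    rw [hn₁, smul_smul, mul_inv_cancel₀ (norm_ne_zero_iff.2 hg₁), one_smul]
  have hg₂' : g₂ = ‖g₂‖ • n₂ := by
    rw [hn₂, smul_smul, mul_inv_cancel₀ (norm_ne_zero_iff.2 hg₂), one_smul]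
  have hp₁ : 0 < ‖g₁‖ := norm_pos_iff.2 hg₁
  have hp₂ : 0 < ‖g₂‖ := norm_pos_iff.2 hg₂
  have hi₁ : inner ℝ g₁ (n₂ - n₁) < 0 := by
    rw [hg₁', inner_smul_left, inner_sub_right, real_inner_self_eq_norm_sq, hu₁]
    simp only [conj_trivial]
    nlinarith
  have hi₂ : inner ℝ (-g₂) (n₂ - n₁) < 0 := by
    rw [hg₂', inner_neg_left, inner_smul_left, inner_sub_right, real_inner_self_eq_norm_sq, hu₂,
      real_inner_comm]
    simp only [conj_trivial]
    nlinarith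
  have hneg : HasGradientAt (fun y => -φ₂ y) (-g₂) x := by
    rw [hasGradientAt_iff_hasFDerivAt, map_neg]
    exact h₂.hasFDerivAt.neg
  have e₁ := h₁.eventually_neg_of_inner_neg h₁0 hi₁
  have e₂ := hneg.eventually_neg_of_inner_neg (by simp [h₂0]) hi₂
  have e₃ : ∀ᶠ t in 𝓝[>] (0 : ℝ), (φ₁ (x + t • (n₂ - n₁)) < 0 ↔ φ₂ (x + t • (n₂ - n₁)) < 0) := by
    have hc : ContinuousAt (fun t : ℝ => x + t • (n₂ - n₁)) 0 := by fun_prop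
    have : Tendsto (fun t : ℝ => x + t • (n₂ - n₁)) (𝓝[>] 0) (𝓝 x) := by
      have h5 := hc.tendsto
      simp only [zero_smul, add_zero] at h5
      exact h5.mono_left nhdsWithin_le_nhds
    exact this.eventually hloc
  obtain ⟨t, ht₁, ht₂, ht₃⟩ := (e₁.and (e₂.and e₃)).exists
  have := ht₃.1 ht₁
  linarith

theorem IsSmoothOpenSet.isOuterNormalAt_outerNormal (hE : IsSmoothOpenSet E) {x : 𝔼[N]}
    (hx : x ∈ frontier E) : IsOuterNormalAt E x (outerNormal E x) := by
  obtain ⟨U, φ, hxU, hφ⟩ := hE.exists_definingFunction x hx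
  exact Classical.epsilon_spec (p := IsOuterNormalAt E x) ⟨_, hx, U, φ, hxU, hφ, rfl⟩

theorem IsSmoothOpenSet.norm_outerNormal (hE : IsSmoothOpenSet E) {x : 𝔼[N]}
    (hx : x ∈ frontier E) : ‖outerNormal E x‖ = 1 := by
  obtain ⟨_, U, φ, hxU, hφ, h⟩ := hE.isOuterNormalAt_outerNormal hx
  rw [h, norm_smul, norm_inv, norm_norm,
    inv_mul_cancel₀ (norm_ne_zero_iff.2 (hφ.gradient_ne_zero x hxU))]

/-- The outer normal may be computed from any function, differentiable at the point with nonzero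
gradient, whose sublevel set is locally `E`. -/
theorem IsSmoothOpenSet.outerNormal_eq (hE : IsSmoothOpenSet E) {x g : 𝔼[N]} {φ : 𝔼[N] → ℝ}
    (hx : x ∈ frontier E) (hφ : HasGradientAt φ g x) (hg : g ≠ 0) (h0 : φ x = 0)
    (hloc : ∀ᶠ y in 𝓝 x, (y ∈ E ↔ φ y < 0)) : outerNormal E x = ‖g‖⁻¹ • g := by
  obtain ⟨_, U, φ', hxU, hφ', h⟩ := hE.isOuterNormalAt_outerNormal hx
  rw [h]
  refine normalized_gradient_eq (hφ'.differentiableAt hxU).hasGradientAt hφ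
    (hφ'.gradient_ne_zero x hxU) hg (hφ'.eq_zero hE.isOpen hxU hx) h0 ?_
  filter_upwards [hloc, hφ'.eventually_mem_iff hxU] with y h1 h2
  rw [← h1, h2]

end OuterNormal

/-! ### Sublevel sets as subgraphs -/

/-- The implicit function theorem gives the zero set. The sign is read off from the strict
monotonicity of `Θ` in the last variable, which holds on a product ball where that partial
derivative is positive. -/
theorem exists_implicit_sublevel {P : Type*} [NormedAddCommGroup P] [NormedSpace ℝ P]
    [CompleteSpace P] {n : ℕ} (hn : n ≠ 0) {Θ : P × ℝ → ℝ} {a : P} {b : ℝ}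
    (h : ContDiffAt ℝ n Θ (a, b)) (h0 : Θ (a, b) = 0) (hpos : 0 < fderiv ℝ Θ (a, b) (0, 1)) :
    ∃ Γ : P → ℝ, ContDiffAt ℝ n Γ a ∧ Γ a = b ∧ (∀ᶠ q in 𝓝 a, Θ (q, Γ q) = 0) ∧
      ∀ᶠ z in 𝓝 (a, b), (Θ z < 0 ↔ z.2 < Γ z.1) ∧ (Θ z = 0 ↔ z.2 = Γ z.1) := by
  have hn' : (n : WithTop ℕ∞) ≠ 0 := by exact_mod_cast hn
  have hinv : (fderiv ℝ Θ (a, b) ∘L ContinuousLinearMap.inr ℝ P ℝ).IsInvertible := by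
    refine ⟨ContinuousLinearEquiv.unitsEquivAut ℝ (Units.mk0 _ hpos.ne'), ?_⟩
    ext
    simp
  refine ⟨h.implicitFunction hn' hinv, h.contDiffAt_implicitFunction hn' hinv,
    h.implicitFunction_apply_self hn' hinv, ?_, ?_⟩
  · have := h.eventually_apply_implicitFunction hn' hinv
    rwa [h0] at this
  · set Γ := h.implicitFunction hn' hinv
    have hΓc : ContinuousAt Γ a := (h.contDiffAt_implicitFunction hn' hinv).continuousAt
    have hΓa : Γ a = b := h.implicitFunction_apply_self hn' hinv
    have hΓ0 : ∀ᶠ q in 𝓝 a, Θ (q, Γ q) = 0 := by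
      have := h.eventually_apply_implicitFunction hn' hinv
      rwa [h0] at this
    have hd : ∀ᶠ z in 𝓝 (a, b), DifferentiableAt ℝ Θ z ∧ 0 < fderiv ℝ Θ z (0, 1) := by
      have h1 : ∀ᶠ z in 𝓝 (a, b), ContDiffAt ℝ n Θ z := h.eventually (by simp)
      have h2 : ContinuousAt (fun z => fderiv ℝ Θ z (0, 1)) (a, b) := by
        have h3 : ContinuousAt (fderiv ℝ Θ) (a, b) :=
          (h.fderiv_right (m := 0) (by
            have : 1 ≤ n := Nat.one_le_iff_ne_zero.2 hn
            exact_mod_cast this)).continuousAt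
        exact h3.clm_apply continuousAt_const
      filter_upwards [h1, h2.eventually_const_lt hpos] with z hz1 hz2
      exact ⟨hz1.differentiableAt hn', hz2⟩
    obtain ⟨ε, hε, hball⟩ := Metric.eventually_nhds_iff_ball.1 hd
    have hb : ∀ᶠ q in 𝓝 a, Γ q ∈ Metric.ball b ε :=
      hΓc.eventually (by rw [hΓa]; exact Metric.ball_mem_nhds b hε)
    have hq : ∀ᶠ q in 𝓝 a, q ∈ Metric.ball a ε := Metric.ball_mem_nhds a hε
    rw [nhds_prod_eq]
    filter_upwards [(hΓ0.and (hb.and hq)).prod_mk (Metric.ball_mem_nhds b hε)] with z hz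
    obtain ⟨⟨hz0, hzb, hza⟩, hz2⟩ := hz
    have hmem : ∀ y ∈ Metric.ball b ε, (z.1, y) ∈ Metric.ball (a, b) ε := fun y hy => by
      rw [← ball_prod_same]
      exact ⟨hza, hy⟩
    have hder : ∀ y ∈ Metric.ball b ε,
        HasDerivAt (fun y => Θ (z.1, y)) (fderiv ℝ Θ (z.1, y) (0, 1)) y := fun y hy => by
      have h1 := (hball _ (hmem y hy)).1.hasFDerivAt
      have h2 : HasDerivAt (fun y : ℝ => (z.1, y)) (0, 1) y :=
        (hasDerivAt_const y z.1).prodMk (hasDerivAt_id y)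
      exact h1.comp_hasDerivAt y h2
    have hmono : StrictMonoOn (fun y => Θ (z.1, y)) (Metric.ball b ε) := by
      refine strictMonoOn_of_deriv_pos (convex_ball b ε)
        (fun y hy => (hder y hy).continuousAt.continuousWithinAt) fun y hy => ?_
      rw [Metric.isOpen_ball.interior_eq] at hy
      rw [(hder y hy).deriv]
      exact (hball _ (hmem y hy)).2
    have h1 := hmono.lt_iff_lt hz2 hzb
    have h2 := hmono.injOn.eq_iff hz2 hzb
    simp only [hz0] at h1 h2
    exact ⟨h1, h2⟩

theorem ContinuousAt.eventually_of_eq {S T : Type*} [TopologicalSpace S] [TopologicalSpace T]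
    {f : S → T} {a : S} {b : T} {P : T → Prop} (hf : ContinuousAt f a) (hab : f a = b)
    (hP : ∀ᶠ y in 𝓝 b, P y) : ∀ᶠ x in 𝓝 a, P (f x) := by
  subst hab
  exact hf.eventually hP

/-! ### Graph charts -/

/-- In the frame `ι` with origin `x₀`, on the cylinder `‖v‖ < δ`, `|y| < η`, the set `E` is the
subgraph of `γ`. -/
structure IsGraphChart {M : ℕ} (E : Set 𝔼[M + 1]) (x₀ : 𝔼[M + 1])
    (ι : (𝔼[M] × ℝ) ≃L[ℝ] 𝔼[M + 1]) (δ η : ℝ) (γ : 𝔼[M] → ℝ) : Prop where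
  frame : IsFrame ι
  pos : 0 < δ
  contDiffOn : ContDiffOn ℝ 5 γ (Metric.ball 0 δ)
  map_zero : γ 0 = 0
  abs_lt : ∀ v ∈ Metric.ball (0 : 𝔼[M]) δ, |γ v| < η
  mem_iff : ∀ v ∈ Metric.ball (0 : 𝔼[M]) δ, ∀ y : ℝ, |y| < η → (x₀ + ι (v, y) ∈ E ↔ y < γ v)

/-- The upward unit normal of the graph of `γ`. -/
noncomputable def graphNormal {M : ℕ} (ι : (𝔼[M] × ℝ) ≃L[ℝ] 𝔼[M + 1]) (γ : 𝔼[M] → ℝ)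
    (v : 𝔼[M]) : 𝔼[M + 1] :=
  (areaElement γ v)⁻¹ • ι (-gradient γ v, 1)

theorem norm_gradient_eq {M : ℕ} (γ : 𝔼[M] → ℝ) (v : 𝔼[M]) : ‖gradient γ v‖ = ‖fderiv ℝ γ v‖ := by
  rw [gradient, LinearIsometryEquiv.norm_map]

theorem inner_gradient_eq {M : ℕ} (γ : 𝔼[M] → ℝ) (v a : 𝔼[M]) :
    inner ℝ (gradient γ v) a = fderiv ℝ γ v a := by
  rw [gradient, InnerProductSpace.toDual_symm_apply]

theorem IsFrame.norm_upward {M : ℕ} {ι : (𝔼[M] × ℝ) ≃L[ℝ] 𝔼[M + 1]} (hι : IsFrame ι)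
    (γ : 𝔼[M] → ℝ) (v : 𝔼[M]) : ‖ι (-gradient γ v, 1)‖ = areaElement γ v := by
  rw [areaElement, eq_comm, Real.sqrt_eq_iff_mul_self_eq (by positivity) (norm_nonneg _), ← sq,
    hι.norm_sq, norm_neg, norm_gradient_eq]
  ring

theorem IsFrame.norm_graphNormal {M : ℕ} {ι : (𝔼[M] × ℝ) ≃L[ℝ] 𝔼[M + 1]} (hι : IsFrame ι)
    (γ : 𝔼[M] → ℝ) (v : 𝔼[M]) : ‖graphNormal ι γ v‖ = 1 := by
  rw [graphNormal, norm_smul, hι.norm_upward, norm_inv, Real.norm_of_nonneg (areaElement_pos γ v).le,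
    inv_mul_cancel₀ (areaElement_pos γ v).ne']

theorem IsFrame.inner_graphNormal {M : ℕ} {ι : (𝔼[M] × ℝ) ≃L[ℝ] 𝔼[M + 1]} (hι : IsFrame ι)
    (γ : 𝔼[M] → ℝ) (v : 𝔼[M]) (q : 𝔼[M] × ℝ) :
    inner ℝ (graphNormal ι γ v) (ι q) = (areaElement γ v)⁻¹ * (q.2 - fderiv ℝ γ v q.1) := by
  rw [graphNormal, inner_smul_left, hι.inner_apply, inner_neg_left, inner_gradient_eq]
  simp only [conj_trivial, one_mul]
  ring

theorem contDiffOn_graphNormal {M : ℕ} {ι : (𝔼[M] × ℝ) ≃L[ℝ] 𝔼[M + 1]} {γ : 𝔼[M] → ℝ}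
    {s : Set 𝔼[M]} {n : ℕ} (hs : IsOpen s) (hγ : ContDiffOn ℝ (n + 1 : ℕ) γ s) :
    ContDiffOn ℝ n (graphNormal ι γ) s := by
  have h1 : ContDiffOn ℝ n (fderiv ℝ γ) s := hγ.fderiv_of_isOpen hs (by norm_cast)
  have h2 : ContDiffOn ℝ n (gradient γ) s :=
    ((InnerProductSpace.toDual ℝ 𝔼[M]).symm.toContinuousLinearEquiv.contDiff).comp_contDiffOn h1
  have h3 : ContDiffOn ℝ n (areaElement γ) s := by
    have : ContDiffOn ℝ n (fun v => √(1 + ‖gradient γ v‖ ^ 2)) s := by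
      refine ContDiffOn.sqrt (contDiffOn_const.add (h2.norm_sq ℝ)) fun v _ => by positivity
    simp only [norm_gradient_eq] at this
    exact this
  refine (h3.inv fun v _ => (areaElement_pos γ v).ne').smul ?_
  exact ι.contDiff.comp_contDiffOn (h2.neg.prodMk contDiffOn_const)

theorem contDiffOn_graphMap {M : ℕ} {ι : (𝔼[M] × ℝ) ≃L[ℝ] 𝔼[M + 1]} {γ : 𝔼[M] → ℝ}
    {x₀ : 𝔼[M + 1]} {s : Set 𝔼[M]} {n : WithTop ℕ∞} (hγ : ContDiffOn ℝ n γ s) :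
    ContDiffOn ℝ n (graphMap ι x₀ γ) s :=
  contDiffOn_const.add (ι.contDiff.comp_contDiffOn (contDiffOn_id.prodMk hγ))

namespace IsGraphChart

variable {M : ℕ} {E : Set 𝔼[M + 1]} {x₀ : 𝔼[M + 1]} {ι : (𝔼[M] × ℝ) ≃L[ℝ] 𝔼[M + 1]} {δ η : ℝ}
  {γ : 𝔼[M] → ℝ}

theorem mem_ball_zero (h : IsGraphChart E x₀ ι δ η γ) : (0 : 𝔼[M]) ∈ Metric.ball 0 δ :=
  Metric.mem_ball_self h.pos

theorem graphMap_zero (h : IsGraphChart E x₀ ι δ η γ) : graphMap ι x₀ γ 0 = x₀ := by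
  rw [graphMap, h.map_zero]
  simp [show ((0 : 𝔼[M]), (0 : ℝ)) = 0 from rfl]

theorem contDiffAt (h : IsGraphChart E x₀ ι δ η γ) {v : 𝔼[M]} (hv : v ∈ Metric.ball 0 δ) :
    ContDiffAt ℝ 5 γ v :=
  h.contDiffOn.contDiffAt (Metric.isOpen_ball.mem_nhds hv)

theorem continuousAt (h : IsGraphChart E x₀ ι δ η γ) {v : 𝔼[M]} (hv : v ∈ Metric.ball 0 δ) :
    ContinuousAt γ v :=
  (h.contDiffAt hv).continuousAt

theorem eventually_mem_iff (h : IsGraphChart E x₀ ι δ η γ) {v : 𝔼[M]} (hv : v ∈ Metric.ball 0 δ)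
    {y : ℝ} (hy : |y| < η) :
    ∀ᶠ x in 𝓝 (x₀ + ι (v, y)), (x ∈ E ↔ (ι.symm (x - x₀)).2 < γ (ι.symm (x - x₀)).1) := by
  have hc : ContinuousAt (fun x => ι.symm (x - x₀)) (x₀ + ι (v, y)) := by fun_prop
  have hval : ι.symm (x₀ + ι (v, y) - x₀) = (v, y) := by simp
  have h1 : ∀ᶠ q in 𝓝 (v, y), q.1 ∈ Metric.ball 0 δ ∧ |q.2| < η := by
    have h2 : ∀ᶠ q in 𝓝 (v, y), q.1 ∈ Metric.ball 0 δ :=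
      continuousAt_fst.eventually (Metric.isOpen_ball.mem_nhds hv)
    have h3 : ContinuousAt (fun q : 𝔼[M] × ℝ => |q.2|) (v, y) := by fun_prop
    exact h2.and (h3.eventually_lt_const hy)
  have h4 := hc.eventually_of_eq hval h1
  filter_upwards [h4] with x hx
  have := h.mem_iff _ hx.1 _ hx.2
  rwa [Prod.mk.eta, ι.apply_symm_apply, add_sub_cancel] at this

/-- Above the graph a whole neighbourhood misses `E`, and below it the point belongs to the open set
`E`. Points of the graph are limits of points of `E` from below. -/
theorem mem_frontier_iff (h : IsGraphChart E x₀ ι δ η γ) (hE : IsOpen E) {v : 𝔼[M]}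
    (hv : v ∈ Metric.ball 0 δ) {y : ℝ} (hy : |y| < η) :
    x₀ + ι (v, y) ∈ frontier E ↔ y = γ v := by
  constructor
  · intro hf
    have h1 : ¬ y < γ v := fun h0 => notMem_of_mem_frontier hE hf ((h.mem_iff v hv y hy).2 h0)
    refine le_antisymm ?_ (not_lt.1 h1)
    by_contra! h2
    have hval : ι.symm (x₀ + ι (v, y) - x₀) = (v, y) := by simp
    have hc : ContinuousAt (fun x => ι.symm (x - x₀)) (x₀ + ι (v, y)) := by fun_prop
    have h3 : ∀ᶠ q in 𝓝 (v, y), γ q.1 < q.2 :=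
      ContinuousAt.eventually_lt
        (ContinuousAt.comp (f := Prod.fst) (x := (v, y)) (h.continuousAt hv) continuousAt_fst)
        continuousAt_snd h2
    have h4 : ∀ᶠ x in 𝓝 (x₀ + ι (v, y)), x ∉ E := by
      filter_upwards [h.eventually_mem_iff hv hy, hc.eventually_of_eq hval h3]
        with x hx1 hx2
      rw [hx1]
      exact not_lt.2 hx2.le
    exact (mem_closure_iff_frequently.1 (frontier_subset_closure hf)) h4
  · rintro rfl
    rw [hE.frontier_eq]
    refine ⟨?_, fun hmem => lt_irrefl _ ((h.mem_iff v hv _ hy).1 hmem)⟩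
    have hc : ContinuousAt (fun y : ℝ => x₀ + ι (v, y)) (γ v) := by fun_prop
    have hlim : Tendsto (fun y : ℝ => x₀ + ι (v, y)) (𝓝[<] (γ v)) (𝓝 (x₀ + ι (v, γ v))) :=
      hc.tendsto.mono_left nhdsWithin_le_nhds
    refine mem_closure_of_tendsto hlim ?_
    have hab : ∀ᶠ y in 𝓝[<] (γ v), |y| < η :=
      (continuous_abs.continuousAt.eventually_lt_const hy).filter_mono nhdsWithin_le_nhds
    filter_upwards [hab, self_mem_nhdsWithin] with y hy1 hy2
    exact (h.mem_iff v hv y hy1).2 hy2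

theorem graphMap_mem_frontier (h : IsGraphChart E x₀ ι δ η γ) (hE : IsOpen E) {v : 𝔼[M]}
    (hv : v ∈ Metric.ball 0 δ) : graphMap ι x₀ γ v ∈ frontier E :=
  (h.mem_frontier_iff hE hv (h.abs_lt v hv)).2 rfl

theorem mem_frontier (h : IsGraphChart E x₀ ι δ η γ) (hE : IsOpen E) : x₀ ∈ frontier E := by
  have := h.graphMap_mem_frontier hE h.mem_ball_zero
  rwa [h.graphMap_zero] at this

/-- Points of the boundary in the cylinder lie on the graph. -/
theorem exists_eq_graphMap (h : IsGraphChart E x₀ ι δ η γ) (hE : IsOpen E) {x : 𝔼[M + 1]}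
    (hx : x ∈ frontier E) (hxδ : ‖x - x₀‖ < δ) (hxη : ‖x - x₀‖ < η) :
    frameProj ι x₀ x ∈ Metric.ball 0 δ ∧ graphMap ι x₀ γ (frameProj ι x₀ x) = x := by
  set q := ι.symm (x - x₀) with hq
  have hx' : x = x₀ + ι (q.1, q.2) := by
    rw [Prod.mk.eta, hq, ι.apply_symm_apply, add_sub_cancel]
  have hιq : ι q = x - x₀ := ι.apply_symm_apply _
  have h1 : q.1 ∈ Metric.ball (0 : 𝔼[M]) δ := by
    rw [mem_ball_zero_iff]
    exact (h.frame.norm_fst_le q).trans_lt (by rwa [hιq])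
  have h2 : |q.2| < η := (h.frame.abs_snd_le q).trans_lt (by rwa [hιq])
  rw [hx'] at hx
  have h3 := (h.mem_frontier_iff hE h1 h2).1 hx
  refine ⟨h1, ?_⟩
  change x₀ + ι (q.1, γ q.1) = x
  rw [← h3, ← hx']

/-- Height minus `γ` is a local defining function, with gradient `ι (-∇γ, 1)`. -/
theorem outerNormal_graphMap (h : IsGraphChart E x₀ ι δ η γ) (hE : IsSmoothOpenSet E) {v : 𝔼[M]}
    (hv : v ∈ Metric.ball 0 δ) :
    outerNormal E (graphMap ι x₀ γ v) = graphNormal ι γ v := by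
  have hne : ι (-gradient γ v, 1) ≠ 0 := by
    rw [← norm_pos_iff, h.frame.norm_upward]
    exact areaElement_pos γ v
  have hval : ι.symm (graphMap ι x₀ γ v - x₀) = (v, γ v) := by simp [graphMap]
  have hd : HasGradientAt (fun x => (ι.symm (x - x₀)).2 - γ (ι.symm (x - x₀)).1)
      (ι (-gradient γ v, 1)) (graphMap ι x₀ γ v) := by
    rw [hasGradientAt_iff_hasFDerivAt]
    have h1 : HasFDerivAt (fun x => ι.symm (x - x₀)) (ι.symm : 𝔼[M + 1] →L[ℝ] 𝔼[M] × ℝ)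
        (graphMap ι x₀ γ v) :=
      ι.symm.hasFDerivAt.comp _ ((hasFDerivAt_id _).sub_const x₀)
    have h2 : HasFDerivAt γ (fderiv ℝ γ v) (ι.symm (graphMap ι x₀ γ v - x₀)).1 := by
      rw [hval]
      exact ((h.contDiffAt hv).differentiableAt (by simp)).hasFDerivAt
    have h3 := h1.snd.sub (h2.comp (graphMap ι x₀ γ v) h1.fst)
    refine h3.congr_fderiv ?_
    ext z
    obtain ⟨q, rfl⟩ := ι.surjective z
    rw [InnerProductSpace.toDual_apply_apply, h.frame.inner_apply, inner_neg_left,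
      inner_gradient_eq]
    simp
    ring
  have hloc := h.eventually_mem_iff hv (h.abs_lt v hv)
  rw [hE.outerNormal_eq (h.graphMap_mem_frontier hE.isOpen hv) hd hne (by simp [hval]) ?_,
    h.frame.norm_upward, graphNormal]
  filter_upwards [hloc] with x hx
  rw [hx, sub_neg]

theorem fderiv_zero (h : IsGraphChart E x₀ ι δ η γ) (hE : IsSmoothOpenSet E)
    (he : ι (0, 1) = outerNormal E x₀) : fderiv ℝ γ 0 = 0 := by
  have h1 := h.outerNormal_graphMap hE h.mem_ball_zero
  rw [h.graphMap_zero, ← he] at h1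
  ext a
  have h2 := h.frame.inner_graphNormal γ 0 (a, 0)
  rw [← h1, h.frame.inner_apply] at h2
  have h3 := (areaElement_pos γ 0).ne'
  simp only [inner_zero_left, mul_zero, add_zero, zero_sub, zero_eq_mul, inv_eq_zero, h3,
    false_or, neg_eq_zero] at h2
  exact h2

end IsGraphChart

theorem ContDiffAt.exists_contDiffOn_ball {P F : Type*} [NormedAddCommGroup P] [NormedSpace ℝ P]
    [NormedAddCommGroup F] [NormedSpace ℝ F] {n : ℕ} {f : P → F} {a : P} (h : ContDiffAt ℝ n f a) :
    ∃ ε > 0, ContDiffOn ℝ n f (Metric.ball a ε) := by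
  obtain ⟨ε, hε, hb⟩ := Metric.eventually_nhds_iff_ball.1 (h.eventually (by simp))
  exact ⟨ε, hε, fun x hx => (hb x hx).contDiffWithinAt⟩

/-- The boundary of a smooth open set is locally a graph over its tangent plane. -/
theorem IsSmoothOpenSet.exists_isGraphChart {M : ℕ} {E : Set 𝔼[M + 1]} (hE : IsSmoothOpenSet E)
    {x₀ : 𝔼[M + 1]} (hx₀ : x₀ ∈ frontier E) :
    ∃ ι δ η γ, IsGraphChart E x₀ ι δ η γ ∧ ι (0, 1) = outerNormal E x₀ := by
  obtain ⟨_, U, φ, hxU, hφ, hn⟩ := hE.isOuterNormalAt_outerNormal hx₀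
  obtain ⟨ι, hι, he⟩ := IsFrame.exists_of_norm_eq_one (hE.norm_outerNormal hx₀)
  have hz : x₀ + ι ((0 : 𝔼[M]), (0 : ℝ)) = x₀ := by
    simp [show ((0 : 𝔼[M]), (0 : ℝ)) = 0 from rfl]
  have hφc : ContDiffAt ℝ ∞ φ x₀ := hφ.contDiffOn.contDiffAt (hφ.isOpen.mem_nhds hxU)
  let Θ : 𝔼[M] × ℝ → ℝ := fun q => φ (x₀ + ι q)
  -- Finitely many derivatives suffice. From five, one is lost in passing to the normal, leaving `Γ`
  -- of class `C⁴`; its time derivative is then more than the `C²` required by the odd bounds.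
  have hΘc : ContDiffAt ℝ (5 : ℕ) Θ (0, 0) := by
    have h1 : ContDiffAt ℝ (5 : ℕ) φ (x₀ + ι ((0 : 𝔼[M]), (0 : ℝ))) := by
      rw [hz]
      exact contDiffAt_infty.1 hφc 5
    exact h1.comp (0, 0) (contDiffAt_const.add ι.contDiff.contDiffAt)
  have hΘ0 : Θ (0, 0) = 0 := by
    simp only [Θ, hz]
    exact hφ.eq_zero hE.isOpen hxU hx₀
  have hpos : 0 < fderiv ℝ Θ (0, 0) (0, 1) := by
    have h1 : HasFDerivAt φ (fderiv ℝ φ x₀) (x₀ + ι ((0 : 𝔼[M]), (0 : ℝ))) := by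
      rw [hz]
      exact (hφ.differentiableAt hxU).hasFDerivAt
    have h2 : HasFDerivAt Θ _ (0, 0) := h1.comp (0, 0) (ι.hasFDerivAt.const_add x₀)
    rw [h2.fderiv, ContinuousLinearMap.comp_apply]
    change 0 < fderiv ℝ φ x₀ (ι (0, 1))
    rw [he, hn, ← inner_gradient_eq, inner_smul_right, real_inner_self_eq_norm_sq]
    have := norm_pos_iff.2 (hφ.gradient_ne_zero x₀ hxU)
    positivity
  obtain ⟨γ, hγc, hγ0, -, hiff⟩ := exists_implicit_sublevel (by norm_num) hΘc hΘ0 hpos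
  have hloc : ∀ᶠ q in 𝓝 ((0 : 𝔼[M]), (0 : ℝ)), (x₀ + ι q ∈ E ↔ q.2 < γ q.1) := by
    have hc : ContinuousAt (fun q => x₀ + ι q) ((0 : 𝔼[M]), (0 : ℝ)) := by fun_prop
    filter_upwards [hiff, hc.eventually_of_eq hz (hφ.eventually_mem_iff hxU)]
      with q h1 h2
    rw [h2, ← h1.1]
  obtain ⟨η, hη, hball⟩ := Metric.eventually_nhds_iff_ball.1 hloc
  obtain ⟨δ₁, hδ₁, hsm⟩ := hγc.exists_contDiffOn_ball
  have hsmall : ∀ᶠ v in 𝓝 (0 : 𝔼[M]), |γ v| < η :=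
    hγc.continuousAt.abs.eventually_lt_const (by simpa [hγ0] using hη)
  obtain ⟨δ₂, hδ₂, hlt⟩ := Metric.eventually_nhds_iff_ball.1 hsmall
  -- Capping the radius by `η` as well keeps the cylinder inside the product ball on which
  -- membership in `E` is decided.
  refine ⟨ι, min (min δ₁ δ₂) η, η, γ, ⟨hι, by positivity, ?_, hγ0, ?_, ?_⟩, he⟩
  · exact hsm.mono (Metric.ball_subset_ball ((min_le_left _ _).trans (min_le_left _ _)))
  · exact fun v hv =>
      hlt v (Metric.ball_subset_ball ((min_le_left _ _).trans (min_le_right _ _)) hv)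
  · intro v hv y hy
    refine hball (v, y) ?_
    rw [← ball_prod_same]
    refine ⟨Metric.ball_subset_ball (min_le_right _ _) hv, ?_⟩
    rwa [mem_ball_zero_iff, Real.norm_eq_abs]

/-! ### Normal perturbations -/

/-- The hypotheses on the normal perturbations `Et t`, `|t| < t₀`, of `E` in the direction `h`. -/
structure IsPerturbationFamily {M : ℕ} (E : Set 𝔼[M + 1]) (h : 𝔼[M + 1] → ℝ)
    (Et : ℝ → Set 𝔼[M + 1]) (C t₀ : ℝ) : Prop where
  smooth : IsSmoothOpenSet E
  contDiffOn : ContDiffOn ℝ ∞ h (frontier E)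
  nonneg : 0 ≤ C
  abs_le : ∀ x ∈ frontier E, |h x| ≤ C
  pos : 0 < t₀
  perturbation : ∀ t, |t| < t₀ → IsNormalPerturbation E h t (Et t)

/-- Normal coordinates `(v, r) ↦ ψ(v) + r ν(ψ(v))` along the graph of `γ`. -/
noncomputable def normalMap {M : ℕ} (ι : (𝔼[M] × ℝ) ≃L[ℝ] 𝔼[M + 1]) (x₀ : 𝔼[M + 1])
    (γ : 𝔼[M] → ℝ) (q : 𝔼[M] × ℝ) : 𝔼[M + 1] :=
  graphMap ι x₀ γ q.1 + q.2 • graphNormal ι γ q.1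

/-- Off the boundary of `F`, the space is the union of the disjoint open sets `F` and `(closure
F)ᶜ`. -/
theorem IsPreconnected.mem_of_disjoint_frontier {T : Type*} [TopologicalSpace T] {F S : Set T}
    (hS : IsPreconnected S) (hF : IsOpen F) (hd : ∀ x ∈ S, x ∉ frontier F) {x y : T} (hx : x ∈ S)
    (hy : y ∈ S) (hxF : x ∈ F) : y ∈ F := by
  refine hS.subset_left_of_subset_union (v := (closure F)ᶜ) hF isClosed_closure.isOpen_compl ?_ ?_ ⟨x, hx, hxF⟩ hy
  · exact (disjoint_compl_right_iff_subset.2 subset_closure)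
  · intro z hz
    by_cases hzF : z ∈ F
    · exact Or.inl hzF
    · refine Or.inr fun hcl => hd z hz ?_
      rw [hF.frontier_eq]
      exact ⟨hcl, hzF⟩

theorem IsPreconnected.mem_iff_of_disjoint_frontier {T : Type*} [TopologicalSpace T] {F S : Set T}
    (hS : IsPreconnected S) (hF : IsOpen F) (hd : ∀ x ∈ S, x ∉ frontier F) {x y : T} (hx : x ∈ S)
    (hy : y ∈ S) : x ∈ F ↔ y ∈ F :=
  ⟨hS.mem_of_disjoint_frontier hF hd hx hy, hS.mem_of_disjoint_frontier hF hd hy hx⟩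

/-- First-order expansion of a defining function along the line through `y`. This converts the sign
condition on the normals into the statement on which side of its boundary a perturbed set lies. -/
theorem IsSmoothOpenSet.eventually_mem_of_inner_pos {N : ℕ} {F : Set 𝔼[N]}
    (hF : IsSmoothOpenSet F) {y m : 𝔼[N]} (hy : y ∈ frontier F)
    (hm : 0 < inner ℝ (outerNormal F y) m) :
    (∀ᶠ t in 𝓝[>] (0 : ℝ), y + t • (-m) ∈ F) ∧ ∀ᶠ t in 𝓝[>] (0 : ℝ), y + t • m ∉ F := by
  obtain ⟨_, U, φ, hyU, hφ, hn⟩ := hF.isOuterNormalAt_outerNormal hy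
  have hg := (hφ.differentiableAt hyU).hasGradientAt
  have h0 := hφ.eq_zero hF.isOpen hyU hy
  have hpos : 0 < inner ℝ (gradient φ y) m := by
    rw [hn, inner_smul_left] at hm
    have := norm_pos_iff.2 (hφ.gradient_ne_zero y hyU)
    simp only [conj_trivial] at hm
    exact (pos_iff_pos_of_mul_pos hm).1 (by positivity)
  have hlim : ∀ d : 𝔼[N], Tendsto (fun t : ℝ => y + t • d) (𝓝[>] 0) (𝓝 y) := fun d => by
    have hc : ContinuousAt (fun t : ℝ => y + t • d) 0 := by fun_prop
    have h5 := hc.tendsto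
    simp only [zero_smul, add_zero] at h5
    exact h5.mono_left nhdsWithin_le_nhds
  have hloc := hφ.eventually_mem_iff hyU
  constructor
  · filter_upwards [(hlim (-m)).eventually hloc, hg.eventually_neg_of_inner_neg h0
      (d := -m) (by rw [inner_neg_right]; linarith)] with t h1 h2
    exact h1.2 h2
  · have hneg : HasGradientAt (fun y => -φ y) (-gradient φ y) y := by
      rw [hasGradientAt_iff_hasFDerivAt, map_neg]
      exact hg.hasFDerivAt.neg
    filter_upwards [(hlim m).eventually hloc, hneg.eventually_neg_of_inner_neg (by simp [h0])
      (d := m) (by rw [inner_neg_left]; linarith)] with t h1 h2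
    rw [h1]
    linarith

namespace IsGraphChart

variable {M : ℕ} {E : Set 𝔼[M + 1]} {x₀ : 𝔼[M + 1]} {ι : (𝔼[M] × ℝ) ≃L[ℝ] 𝔼[M + 1]} {δ η : ℝ}
  {γ : 𝔼[M] → ℝ}

theorem contDiffAt_graphMap (hc : IsGraphChart E x₀ ι δ η γ) {v : 𝔼[M]}
    (hv : v ∈ Metric.ball 0 δ) : ContDiffAt ℝ 5 (graphMap ι x₀ γ) v :=
  (contDiffOn_graphMap hc.contDiffOn).contDiffAt (Metric.isOpen_ball.mem_nhds hv)

theorem contDiffAt_graphNormal (hc : IsGraphChart E x₀ ι δ η γ) {v : 𝔼[M]}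
    (hv : v ∈ Metric.ball 0 δ) : ContDiffAt ℝ (4 : ℕ) (graphNormal ι γ) v :=
  (contDiffOn_graphNormal (n := 4) Metric.isOpen_ball hc.contDiffOn).contDiffAt
    (Metric.isOpen_ball.mem_nhds hv)

theorem contDiffAt_normalMap (hc : IsGraphChart E x₀ ι δ η γ) {q : 𝔼[M] × ℝ}
    (hq : q.1 ∈ Metric.ball 0 δ) : ContDiffAt ℝ (4 : ℕ) (normalMap ι x₀ γ) q := by
  have h1 : ContDiffAt ℝ (4 : ℕ) (graphMap ι x₀ γ) q.1 :=
    (hc.contDiffAt_graphMap hq).of_le (by norm_cast)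
  have h2 := hc.contDiffAt_graphNormal hq
  exact (h1.comp q contDiffAt_fst).add (contDiffAt_snd.smul (h2.comp q contDiffAt_fst))

theorem hasFDerivAt_graphMap (hc : IsGraphChart E x₀ ι δ η γ) {v : 𝔼[M]}
    (hv : v ∈ Metric.ball 0 δ) :
    HasFDerivAt (graphMap ι x₀ γ) ((ι : (𝔼[M] × ℝ) →L[ℝ] 𝔼[M + 1]) ∘L
      ((ContinuousLinearMap.id ℝ 𝔼[M]).prod (fderiv ℝ γ v))) v := by
  have h1 : HasFDerivAt (fun v => (v, γ v))
      ((ContinuousLinearMap.id ℝ 𝔼[M]).prod (fderiv ℝ γ v)) v :=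
    (hasFDerivAt_id v).prodMk ((hc.contDiffAt hv).differentiableAt (by simp)).hasFDerivAt
  exact (ι.hasFDerivAt.comp v h1).const_add x₀

theorem fderiv_graphMap (hc : IsGraphChart E x₀ ι δ η γ) {v : 𝔼[M]} (hv : v ∈ Metric.ball 0 δ)
    (a : 𝔼[M]) : fderiv ℝ (graphMap ι x₀ γ) v a = ι (a, fderiv ℝ γ v a) := by
  rw [(hc.hasFDerivAt_graphMap hv).fderiv]
  rfl

theorem fderiv_normalMap (hc : IsGraphChart E x₀ ι δ η γ) {q : 𝔼[M] × ℝ}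
    (hq : q.1 ∈ Metric.ball 0 δ) (b : 𝔼[M] × ℝ) :
    fderiv ℝ (normalMap ι x₀ γ) q b = ι (b.1, fderiv ℝ γ q.1 b.1) +
      q.2 • fderiv ℝ (graphNormal ι γ) q.1 b.1 + b.2 • graphNormal ι γ q.1 := by
  have h1 : HasFDerivAt (graphMap ι x₀ γ) _ q.1 :=
    ((hc.contDiffAt_graphMap hq).differentiableAt (by simp)).hasFDerivAt
  have h2 : HasFDerivAt (graphNormal ι γ) _ q.1 :=
    ((hc.contDiffAt_graphNormal hq).differentiableAt (by simp)).hasFDerivAt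
  have h3 : HasFDerivAt (normalMap ι x₀ γ) _ q :=
    (h1.comp q hasFDerivAt_fst).add (hasFDerivAt_snd.smul (h2.comp q hasFDerivAt_fst))
  rw [h3.fderiv]
  simp only [add_apply, ContinuousLinearMap.comp_apply,
    smul_apply, ContinuousLinearMap.smulRight_apply,
    ContinuousLinearMap.coe_fst', ContinuousLinearMap.coe_snd', Function.comp_apply,
    hc.fderiv_graphMap hq, add_assoc]

theorem normalShift_graphMap (hc : IsGraphChart E x₀ ι δ η γ) (hE : IsSmoothOpenSet E)
    (h : 𝔼[M + 1] → ℝ) (t : ℝ) {v : 𝔼[M]} (hv : v ∈ Metric.ball 0 δ) :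
    normalShift E h t (graphMap ι x₀ γ v) = normalMap ι x₀ γ (v, t * h (graphMap ι x₀ γ v)) := by
  rw [normalShift, hc.outerNormal_graphMap hE hv, normalMap]

theorem contDiffAt_comp_graphMap (hc : IsGraphChart E x₀ ι δ η γ) (hE : IsSmoothOpenSet E)
    {h : 𝔼[M + 1] → ℝ} (hh : ContDiffOn ℝ ∞ h (frontier E)) {v : 𝔼[M]}
    (hv : v ∈ Metric.ball 0 δ) : ContDiffAt ℝ 5 (fun v => h (graphMap ι x₀ γ v)) v := by
  have h1 : ContDiffOn ℝ 5 h (frontier E) := contDiffOn_infty.1 hh 5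
  exact (h1.comp (contDiffOn_graphMap hc.contDiffOn)
    fun v hv => hc.graphMap_mem_frontier hE.isOpen hv).contDiffAt (Metric.isOpen_ball.mem_nhds hv)

end IsGraphChart

/-! ### Nondegeneracy of normal coordinates along the moving boundary -/

namespace IsPerturbationFamily

variable {M : ℕ} {E : Set 𝔼[M + 1]} {h : 𝔼[M + 1] → ℝ} {Et : ℝ → Set 𝔼[M + 1]} {C t₀ : ℝ}
  {x₀ : 𝔼[M + 1]} {ι : (𝔼[M] × ℝ) ≃L[ℝ] 𝔼[M + 1]} {δ η : ℝ} {γ : 𝔼[M] → ℝ}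

theorem normalShift_mem_frontier (hP : IsPerturbationFamily E h Et C t₀) {t : ℝ} (ht : |t| < t₀)
    {x : 𝔼[M + 1]} (hx : x ∈ frontier E) : normalShift E h t x ∈ frontier (Et t) := by
  rw [(hP.perturbation t ht).frontier_eq]
  exact mem_image_of_mem _ hx

theorem dist_normalShift_le (hP : IsPerturbationFamily E h Et C t₀) (t t' : ℝ) {x : 𝔼[M + 1]}
    (hx : x ∈ frontier E) :
    dist (normalShift E h t x) (normalShift E h t' x) ≤ C * |t - t'| := by
  rw [dist_eq_norm, normalShift, normalShift, add_sub_add_left_eq_sub, ← sub_smul, norm_smul,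
    hP.smooth.norm_outerNormal hx, mul_one, ← sub_mul, Real.norm_eq_abs, abs_mul, mul_comm]
  exact mul_le_mul_of_nonneg_right (hP.abs_le x hx) (abs_nonneg _)

/-- The normal coordinates are nondegenerate along the path of each boundary point. -/
theorem injective_fderiv_normalMap (hP : IsPerturbationFamily E h Et C t₀)
    (hc : IsGraphChart E x₀ ι δ η γ) {t : ℝ} (ht : |t| < t₀) {v : 𝔼[M]}
    (hv : v ∈ Metric.ball 0 δ) :
    Function.Injective (fderiv ℝ (normalMap ι x₀ γ) (v, t * h (graphMap ι x₀ γ v))) := by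
  set ψ := graphMap ι x₀ γ
  set G := normalMap ι x₀ γ
  have hpert := hP.perturbation t ht
  have hE := hP.smooth
  have hvx : ψ v ∈ frontier E := hc.graphMap_mem_frontier hE.isOpen hv
  rw [injective_iff_map_eq_zero]
  rintro ⟨a, c⟩ hac
  set H : 𝔼[M] → ℝ := fun v => h (ψ v)
  have hHd : HasFDerivAt H (fderiv ℝ H v) v :=
    ((hc.contDiffAt_comp_graphMap hE hP.contDiffOn hv).differentiableAt (by simp)).hasFDerivAt
  have hGd : HasFDerivAt G (fderiv ℝ G (v, t * H v)) (v, t * H v) :=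
    ((hc.contDiffAt_normalMap (q := (v, t * H v)) hv).differentiableAt (by simp)).hasFDerivAt
  have hpair : HasFDerivAt (fun v => (v, t * H v))
      ((ContinuousLinearMap.id ℝ 𝔼[M]).prod (t • fderiv ℝ H v)) v :=
    (hasFDerivAt_id v).prodMk (hHd.const_mul t)
  have hΦ : HasFDerivAt (fun v => G (v, t * H v)) _ v :=
    HasFDerivAt.comp (g := G) (f := fun v => (v, t * H v)) v hGd hpair
  set L := (fderiv ℝ G (v, t * H v)) ∘L ((ContinuousLinearMap.id ℝ 𝔼[M]).prod (t • fderiv ℝ H v))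
  have hLa : L a = (t * fderiv ℝ H v a - c) • graphNormal ι γ v := by
    have h1 : L a = fderiv ℝ G (v, t * H v) (a, t * fderiv ℝ H v a) := rfl
    have h2 : ((a, t * fderiv ℝ H v a) : 𝔼[M] × ℝ) = (a, c) + (0, t * fderiv ℝ H v a - c) := by
      simp
    rw [h1, h2, map_add, hac, zero_add, hc.fderiv_normalMap (q := (v, t * H v)) hv]
    simp [show ((0 : 𝔼[M]), (0 : ℝ)) = 0 from rfl]
  have hball : ∀ᶠ v' in 𝓝 v, v' ∈ Metric.ball 0 δ := Metric.isOpen_ball.mem_nhds hv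
  have hshift : ∀ v' ∈ Metric.ball 0 δ, G (v', t * H v') = normalShift E h t (ψ v') :=
    fun v' hv' => (hc.normalShift_graphMap hE h t hv').symm
  have hfr : ∀ᶠ v' in 𝓝 v, G (v', t * H v') ∈ frontier (Et t) := by
    filter_upwards [hball] with v' hv'
    rw [hshift v' hv']
    exact hP.normalShift_mem_frontier ht (hc.graphMap_mem_frontier hE.isOpen hv')
  have hF := hpert.isSmoothOpenSet
  obtain ⟨_, U, φ, hyU, hφ, hn⟩ := hF.isOuterNormalAt_outerNormal
    (hP.normalShift_mem_frontier ht hvx)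
  rw [← hshift v hv] at hyU hn
  have hφ0 : ∀ᶠ v' in 𝓝 v, φ (G (v', t * H v')) = 0 := by
    filter_upwards [hfr, hΦ.continuousAt.eventually (hφ.isOpen.mem_nhds hyU)] with v' h1 h2
    exact hφ.eq_zero hF.isOpen h2 h1
  have hφd : HasFDerivAt (fun v' => φ (G (v', t * H v'))) _ v :=
    (hφ.differentiableAt hyU).hasFDerivAt.comp v hΦ
  -- The shifted parametrization stays in `∂(Et t)`, so `L a` is tangent to it; but the normal of
  -- `E` is transversal to `∂(Et t)` by the sign condition.
  have hφL : fderiv ℝ φ (G (v, t * H v)) (L a) = 0 := by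
    have h1 : HasFDerivAt (fun v' => φ (G (v', t * H v'))) (0 : 𝔼[M] →L[ℝ] ℝ) v :=
      (hasFDerivAt_const (0 : ℝ) v).congr_of_eventuallyEq hφ0
    exact congrArg (fun l : 𝔼[M] →L[ℝ] ℝ => l a) (hφd.unique h1)
  have hpos := hpert.inner_normal_pos (ψ v) hvx
  rw [hc.outerNormal_graphMap hE hv, ← hshift v hv, hn, inner_smul_left, conj_trivial] at hpos
  have hgn : inner ℝ (gradient φ (G (v, t * H v))) (graphNormal ι γ v) ≠ 0 :=
    (right_ne_zero_of_mul hpos.ne')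
  rw [inner_gradient_eq] at hgn
  rw [hLa, map_smul, smul_eq_mul, mul_eq_zero, or_iff_left hgn] at hφL
  rw [hφL, zero_smul] at hLa
  obtain ⟨g, hg, hgi⟩ := hpert.exists_inverse
  have hgd : HasFDerivWithinAt g _ (frontier (Et t)) (G (v, t * H v)) :=
    ((hg.differentiableOn (by simp)) _ hfr.self_of_nhds).hasFDerivWithinAt
  -- The smooth inverse recovers the original parametrization, whose differential is injective; so
  -- `L a = 0` forces `a = 0`. The choice of derivative of `g` within the boundary is immaterial for
  -- the chain rule.
  have hgΦ := hgd.comp_hasFDerivAt v hΦ hfr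
  have hψ : HasFDerivAt ψ _ v := hgΦ.congr_of_eventuallyEq (by
    filter_upwards [hball] with v' hv'
    rw [Function.comp_apply, hshift v' hv', hgi _ (hc.graphMap_mem_frontier hE.isOpen hv')])
  have hψa : ι (a, fderiv ℝ γ v a) = 0 := by
    rw [← hc.fderiv_graphMap hv a, hψ.fderiv, ContinuousLinearMap.comp_apply]
    change fderivWithin ℝ g (frontier (Et t)) (G (v, t * H v)) (L a) = 0
    rw [hLa, map_zero]
  have ha : a = 0 := by
    have := hc.frame.norm_fst_le (a, fderiv ℝ γ v a)
    rw [hψa, norm_zero] at this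
    exact norm_le_zero_iff.1 this
  have hc0 : c = 0 := by
    rw [ha, map_zero] at hφL
    linarith
  rw [ha, hc0]
  rfl

/-- Parameters of points of the boundary of `Et t` which are close to a given one are close. -/
theorem exists_dist_lt (hP : IsPerturbationFamily E h Et C t₀) (hx₀ : x₀ ∈ frontier E) {t : ℝ}
    (ht : |t| < t₀) {r : ℝ} (hr : 0 < r) :
    ∃ ε > 0, ∀ x ∈ frontier E, dist (normalShift E h t x) (normalShift E h t x₀) < ε →
      dist x x₀ < r := by
  obtain ⟨g, hg, hgi⟩ := (hP.perturbation t ht).exists_inverse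
  have hcont := hg.continuousOn _ (hP.normalShift_mem_frontier ht hx₀)
  obtain ⟨ε, hε, hb⟩ := Metric.continuousWithinAt_iff.1 hcont r hr
  refine ⟨ε, hε, fun x hx hd => ?_⟩
  have := hb (hP.normalShift_mem_frontier ht hx) hd
  rwa [hgi x hx, hgi x₀ hx₀] at this

end IsPerturbationFamily

/-! ### The moving sets near and away from their boundaries -/

namespace IsPerturbationFamily

variable {M : ℕ} {E : Set 𝔼[M + 1]} {h : 𝔼[M + 1] → ℝ} {Et : ℝ → Set 𝔼[M + 1]} {C t₀ : ℝ}
  {x₀ : 𝔼[M + 1]} {ι : (𝔼[M] × ℝ) ≃L[ℝ] 𝔼[M + 1]} {δ η : ℝ} {γ : 𝔼[M] → ℝ}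

theorem continuousAt_height (hP : IsPerturbationFamily E h Et C t₀)
    (hc : IsGraphChart E x₀ ι δ η γ) (τ : ℝ) :
    ContinuousAt (fun w : ℝ × 𝔼[M] => w.1 * h (graphMap ι x₀ γ w.2)) (τ, 0) := by
  have h1 : ContinuousAt (fun v => h (graphMap ι x₀ γ v)) 0 :=
    (hc.contDiffAt_comp_graphMap hP.smooth hP.contDiffOn hc.mem_ball_zero).continuousAt
  exact continuousAt_fst.mul (ContinuousAt.comp (f := Prod.snd) (x := (τ, (0 : 𝔼[M]))) h1
    continuousAt_snd)

/-- Locally, `∂(Et t)` is the graph `r = t h` in normal coordinates. -/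
theorem eventually_mem_frontier_iff (hP : IsPerturbationFamily E h Et C t₀)
    (hc : IsGraphChart E x₀ ι δ η γ) {τ : ℝ} (hτ : |τ| < t₀) {R : 𝔼[M + 1] → 𝔼[M] × ℝ}
    (hR : ∀ᶠ q in 𝓝 ((0 : 𝔼[M]), τ * h x₀), R (normalMap ι x₀ γ q) = q) :
    ∀ᶠ w in 𝓝 (τ, ((0 : 𝔼[M]), τ * h x₀)), (normalMap ι x₀ γ w.2 ∈ frontier (Et w.1) ↔
      w.2.2 = w.1 * h (graphMap ι x₀ γ w.2.1)) := by
  have hE := hP.smooth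
  have hx₀ := hc.mem_frontier hE.isOpen
  set G := normalMap ι x₀ γ
  obtain ⟨ε₁, hε₁, hR⟩ := Metric.eventually_nhds_iff_ball.1 hR
  have hlim : ∀ᶠ w in 𝓝 (τ, (0 : 𝔼[M])), |w.1 * h (graphMap ι x₀ γ w.2) - τ * h x₀| < ε₁ := by
    have h1 := ((hP.continuousAt_height hc τ).sub_const (τ * h x₀)).abs
    refine h1.eventually_lt_const ?_
    simpa [hc.graphMap_zero] using hε₁
  obtain ⟨ε₂, hε₂, hlim⟩ := Metric.eventually_nhds_iff_ball.1 hlim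
  have hη : 0 < η := (abs_nonneg _).trans_lt (hc.abs_lt 0 hc.mem_ball_zero)
  have hδ := hc.pos
  -- Only continuity of the inverse at the single time `τ` is used. A point moves by at most `C * |t
  -- - τ|` between the two times, so a point of `∂(Et t)` near the base point has its time-`τ`
  -- position near it too, and hence a parameter near `x₀`. This makes the statement uniform in `t`.
  obtain ⟨ε₃, hε₃, hpar⟩ := hP.exists_dist_lt hx₀ hτ
    (r := min (min ε₁ ε₂) (min δ η)) (by positivity)
  have hG0 : G (0, τ * h x₀) = normalShift E h τ x₀ := by
    have := hc.normalShift_graphMap hE h τ hc.mem_ball_zero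
    rw [hc.graphMap_zero] at this
    exact this.symm
  have hGc : ContinuousAt G (0, τ * h x₀) :=
    (hc.contDiffAt_normalMap (q := (0, τ * h x₀)) hc.mem_ball_zero).continuousAt
  have e1 : ∀ᶠ w in 𝓝 (τ, ((0 : 𝔼[M]), τ * h x₀)),
      C * |w.1 - τ| + dist (G w.2) (normalShift E h τ x₀) < ε₃ := by
    have h1 : ContinuousAt (fun w : ℝ × (𝔼[M] × ℝ) =>
        C * |w.1 - τ| + dist (G w.2) (normalShift E h τ x₀)) (τ, ((0 : 𝔼[M]), τ * h x₀)) := by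
      have h2 : ContinuousAt (fun w : ℝ × (𝔼[M] × ℝ) => G w.2) (τ, ((0 : 𝔼[M]), τ * h x₀)) :=
        ContinuousAt.comp (f := Prod.snd) (x := (τ, ((0 : 𝔼[M]), τ * h x₀))) hGc continuousAt_snd
      exact ContinuousAt.add (by fun_prop) (h2.dist continuousAt_const)
    refine h1.eventually_lt_const ?_
    simpa [hG0] using hε₃
  have e2 : ∀ᶠ w in 𝓝 (τ, ((0 : 𝔼[M]), τ * h x₀)), w.1 ∈ Metric.ball τ ε₂ :=
    continuousAt_fst.eventually (Metric.ball_mem_nhds τ hε₂)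
  have e3 : ∀ᶠ w in 𝓝 (τ, ((0 : 𝔼[M]), τ * h x₀)), w.2 ∈ Metric.ball ((0 : 𝔼[M]), τ * h x₀) ε₁ :=
    continuousAt_snd.eventually (Metric.ball_mem_nhds ((0 : 𝔼[M]), τ * h x₀) hε₁)
  have e4 : ∀ᶠ w in 𝓝 (τ, ((0 : 𝔼[M]), τ * h x₀)), |w.1| < t₀ :=
    (show ContinuousAt (fun w : ℝ × (𝔼[M] × ℝ) => |w.1|) _ by fun_prop).eventually_lt_const hτ
  have e5 : ∀ᶠ w in 𝓝 (τ, ((0 : 𝔼[M]), τ * h x₀)), w.2.1 ∈ Metric.ball 0 δ :=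
    (continuousAt_fst.comp continuousAt_snd).eventually
      (Metric.isOpen_ball.mem_nhds hc.mem_ball_zero)
  filter_upwards [e1, e2, e3, e4, e5] with ⟨t, q⟩ h1 h2 h3 h4 h5
  simp only at h1 h2 h3 h4 h5 ⊢
  constructor
  · intro hmem
    rw [(hP.perturbation t h4).frontier_eq] at hmem
    obtain ⟨x, hx, hxq⟩ := hmem
    have hdx : dist x x₀ < min (min ε₁ ε₂) (min δ η) := by
      refine hpar x hx ?_
      have h6 := hP.dist_normalShift_le τ t hx
      have h7 := dist_triangle (normalShift E h τ x) (normalShift E h t x) (normalShift E h τ x₀)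
      have h8 : dist (normalShift E h t x) (normalShift E h τ x₀) =
          dist (G q) (normalShift E h τ x₀) := by rw [hxq]
      rw [abs_sub_comm] at h6
      linarith
    simp only [lt_min_iff] at hdx
    rw [dist_eq_norm] at hdx
    obtain ⟨hu, hux⟩ := hc.exists_eq_graphMap hE.isOpen hx hdx.2.1 hdx.2.2
    set u := frameProj ι x₀ x
    have hun : ‖u‖ ≤ ‖x - x₀‖ := by
      have h6 := hc.frame.norm_fst_le (ι.symm (x - x₀))
      rwa [ι.apply_symm_apply] at h6
    have hGq : G (u, t * h (graphMap ι x₀ γ u)) = G q := by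
      rw [← hxq, ← hux, hux, ← hux, hc.normalShift_graphMap hE h t hu]
    have hmem2 : (u, t * h (graphMap ι x₀ γ u)) ∈ Metric.ball ((0 : 𝔼[M]), τ * h x₀) ε₁ := by
      rw [← ball_prod_same]
      refine ⟨?_, ?_⟩
      · rw [mem_ball_zero_iff]
        exact hun.trans_lt hdx.1.1
      · refine hlim (t, u) ?_
        rw [← ball_prod_same]
        refine ⟨h2, ?_⟩
        rw [mem_ball_zero_iff]
        exact hun.trans_lt hdx.1.2
    -- Both coordinate pairs lie where `R` inverts the normal coordinates, so having the same image
    -- they coincide.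
    have h7 := hR _ hmem2
    rw [hGq, hR _ h3] at h7
    rw [h7]
  · intro hq
    have : G q = normalShift E h t (graphMap ι x₀ γ q.1) := by
      rw [hc.normalShift_graphMap hE h t h5, ← hq]
    rw [this]
    exact hP.normalShift_mem_frontier h4 (hc.graphMap_mem_frontier hE.isOpen h5)

/-- Locally, `Et t` is the subgraph `r < t h` in normal coordinates. -/
theorem eventually_normalMap_mem_iff (hP : IsPerturbationFamily E h Et C t₀)
    (hc : IsGraphChart E x₀ ι δ η γ) {τ : ℝ} (hτ : |τ| < t₀) {R : 𝔼[M + 1] → 𝔼[M] × ℝ}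
    (hR : ∀ᶠ q in 𝓝 ((0 : 𝔼[M]), τ * h x₀), R (normalMap ι x₀ γ q) = q) :
    ∀ᶠ w in 𝓝 (τ, ((0 : 𝔼[M]), τ * h x₀)), (normalMap ι x₀ γ w.2 ∈ Et w.1 ↔
      w.2.2 < w.1 * h (graphMap ι x₀ γ w.2.1)) := by
  have hE := hP.smooth
  have hx₀ := hc.mem_frontier hE.isOpen
  have hδ := hc.pos
  have hfr := hP.eventually_mem_frontier_iff hc hτ hR
  set G := normalMap ι x₀ γ
  set H : 𝔼[M] → ℝ := fun v => h (graphMap ι x₀ γ v) with hH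
  have hH0 : H 0 = h x₀ := by simp [H, hc.graphMap_zero]
  obtain ⟨ε₀, hε₀, hfr⟩ := Metric.eventually_nhds_iff_ball.1 hfr
  obtain ⟨ε₁, hε₁, hε₁0, hε₁δ⟩ : ∃ ε > 0, ε ≤ ε₀ ∧ ε ≤ δ :=
    ⟨min ε₀ δ, by positivity, min_le_left _ _, min_le_right _ _⟩
  have hlim : ∀ᶠ w in 𝓝 (τ, (0 : 𝔼[M])), |w.1 * H w.2 - τ * h x₀| < ε₁ / 2 := by
    have h1 := ((hP.continuousAt_height hc τ).sub_const (τ * h x₀)).abs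
    refine h1.eventually_lt_const ?_
    simpa [hc.graphMap_zero] using hε₁
  obtain ⟨ε₂', hε₂', hlim⟩ := Metric.eventually_nhds_iff_ball.1 hlim
  obtain ⟨ε₂, hε₂, hε₂1, hε₂2⟩ : ∃ ε > 0, ε ≤ ε₁ ∧ ε ≤ ε₂' :=
    ⟨min ε₁ ε₂', by positivity, min_le_left _ _, min_le_right _ _⟩
  set r₀ := τ * h x₀ with hr₀
  have e1 : ∀ᶠ w in 𝓝 (τ, ((0 : 𝔼[M]), r₀)), w.1 ∈ Metric.ball τ ε₂ :=
    continuousAt_fst.eventually (Metric.ball_mem_nhds τ hε₂)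
  have e2 : ∀ᶠ w in 𝓝 (τ, ((0 : 𝔼[M]), r₀)), w.2.1 ∈ Metric.ball 0 ε₂ :=
    (continuousAt_fst.comp continuousAt_snd).eventually (Metric.ball_mem_nhds (0 : 𝔼[M]) hε₂)
  have e3 : ∀ᶠ w in 𝓝 (τ, ((0 : 𝔼[M]), r₀)), w.2.2 ∈ Metric.ball r₀ ε₁ :=
    (continuousAt_snd.comp continuousAt_snd).eventually (Metric.ball_mem_nhds r₀ hε₁)
  have e4 : ∀ᶠ w in 𝓝 (τ, ((0 : 𝔼[M]), r₀)), |w.1| < t₀ :=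
    (show ContinuousAt (fun w : ℝ × (𝔼[M] × ℝ) => |w.1|) _ by fun_prop).eventually_lt_const hτ
  filter_upwards [e1, e2, e3, e4] with ⟨t, u, r⟩ h1 h2 h3 h4
  simp only at h1 h2 h3 h4 ⊢
  have hF := (hP.perturbation t h4).isSmoothOpenSet
  have hGc : ContinuousOn G (Metric.ball 0 ε₂ ×ˢ univ) := fun q hq =>
    (hc.contDiffAt_normalMap (q := q)
      (Metric.ball_subset_ball (hε₂1.trans hε₁δ) hq.1)).continuousAt.continuousWithinAt
  have hlimt : ∀ v ∈ Metric.ball (0 : 𝔼[M]) ε₂, |t * H v - r₀| < ε₁ / 2 := fun v hv => by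
    refine hlim (t, v) ?_
    rw [← ball_prod_same]
    exact ⟨Metric.ball_subset_ball hε₂2 h1, Metric.ball_subset_ball hε₂2 hv⟩
  have hfrt : ∀ v ∈ Metric.ball (0 : 𝔼[M]) ε₂, ∀ y, |y - r₀| < ε₁ →
      (G (v, y) ∈ frontier (Et t) ↔ y = t * H v) := fun v hv y hy => by
    refine hfr (t, v, y) ?_
    rw [← ball_prod_same, ← ball_prod_same]
    refine ⟨Metric.ball_subset_ball (hε₂1.trans hε₁0) h1,
      Metric.ball_subset_ball (hε₂1.trans hε₁0) hv, ?_⟩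
    exact hy.trans_le hε₁0
  -- points which can be joined off the graph lie on the same side
  have hjoin : ∀ S : Set (𝔼[M] × ℝ), IsPreconnected S →
      (∀ q ∈ S, q.1 ∈ Metric.ball 0 ε₂ ∧ |q.2 - r₀| < ε₁ ∧ q.2 ≠ t * H q.1) →
      ∀ q ∈ S, ∀ q' ∈ S, (G q ∈ Et t ↔ G q' ∈ Et t) := by
    intro S hS hSp q hq q' hq'
    refine IsPreconnected.mem_iff_of_disjoint_frontier (S := G '' S)
      (hS.image G (hGc.mono fun z hz => ⟨(hSp z hz).1, mem_univ _⟩)) hF.isOpen ?_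
      (mem_image_of_mem G hq) (mem_image_of_mem G hq')
    rintro _ ⟨z, hz, rfl⟩
    obtain ⟨hz1, hz2, hz3⟩ := hSp z hz
    exact fun hmem => hz3 ((hfrt z.1 hz1 z.2 hz2).1 hmem)
  have h0 : (0 : 𝔼[M]) ∈ Metric.ball 0 ε₂ := Metric.mem_ball_self hε₂
  have hvert : ∀ v ∈ Metric.ball (0 : 𝔼[M]) ε₂, ∀ I : Set ℝ, IsPreconnected I →
      (∀ y ∈ I, |y - r₀| < ε₁ ∧ y ≠ t * H v) → ∀ y ∈ I, ∀ y' ∈ I,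
      (G (v, y) ∈ Et t ↔ G (v, y') ∈ Et t) := by
    intro v hv I hI hIp y hy y' hy'
    refine hjoin ({v} ×ˢ I) (isPreconnected_singleton.prod hI) ?_ (v, y) ⟨rfl, hy⟩ (v, y')
      ⟨rfl, hy'⟩
    rintro ⟨z1, z2⟩ ⟨rfl, hz2⟩
    exact ⟨hv, hIp z2 hz2⟩
  -- The graph stays within `ε₁ / 2` of `r₀`. At greater heights a whole horizontal disc misses it,
  -- which links the fibre over `v` to the central fibre, where the orientation is known.
  have hhor : ∀ y : ℝ, |y - r₀| < ε₁ → ε₁ / 2 < |y - r₀| → ∀ v ∈ Metric.ball (0 : 𝔼[M]) ε₂,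
      (G (v, y) ∈ Et t ↔ G (0, y) ∈ Et t) := by
    intro y hy hy2 v hv
    refine hjoin (Metric.ball 0 ε₂ ×ˢ {y})
      ((convex_ball (0 : 𝔼[M]) ε₂).isPreconnected.prod isPreconnected_singleton) ?_
      (v, y) ⟨hv, rfl⟩ (0, y) ⟨h0, rfl⟩
    rintro ⟨z1, z2⟩ ⟨hz1, rfl⟩
    refine ⟨hz1, hy, fun heq => ?_⟩
    have := hlimt z1 hz1
    rw [← heq] at this
    linarith
  have hbelow : ∀ v ∈ Metric.ball (0 : 𝔼[M]) ε₂, ∀ y, |y - r₀| < ε₁ → y < t * H v → ∀ y',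
      |y' - r₀| < ε₁ → y' < t * H v → (G (v, y) ∈ Et t ↔ G (v, y') ∈ Et t) := by
    intro v hv y hy hyl y' hy' hyl'
    refine hvert v hv (Ioo (r₀ - ε₁) (t * H v)) isPreconnected_Ioo ?_ y ?_ y' ?_
    · intro z hz
      have := abs_lt.1 (hlimt v hv)
      exact ⟨abs_lt.2 ⟨by linarith [hz.1], by linarith [hz.2]⟩, hz.2.ne⟩
    · exact ⟨by linarith [(abs_lt.1 hy).1], hyl⟩
    · exact ⟨by linarith [(abs_lt.1 hy').1], hyl'⟩
  have habove : ∀ v ∈ Metric.ball (0 : 𝔼[M]) ε₂, ∀ y, |y - r₀| < ε₁ → t * H v < y → ∀ y',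
      |y' - r₀| < ε₁ → t * H v < y' → (G (v, y) ∈ Et t ↔ G (v, y') ∈ Et t) := by
    intro v hv y hy hyl y' hy' hyl'
    refine hvert v hv (Ioo (t * H v) (r₀ + ε₁)) isPreconnected_Ioo ?_ y ?_ y' ?_
    · intro z hz
      have := abs_lt.1 (hlimt v hv)
      exact ⟨abs_lt.2 ⟨by linarith [hz.1], by linarith [hz.2]⟩, hz.1.ne'⟩
    · exact ⟨hyl, by linarith [(abs_lt.1 hy).2]⟩
    · exact ⟨hyl', by linarith [(abs_lt.1 hy').2]⟩
  -- the orientation at the centre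
  have hy₀ : normalShift E h t x₀ = G (0, t * H 0) := by
    have := hc.normalShift_graphMap hE h t hc.mem_ball_zero
    rw [hc.graphMap_zero] at this
    rw [hH0]
    exact this
  have hG0 : ∀ s : ℝ, G (0, t * H 0) + s • graphNormal ι γ 0 = G (0, t * H 0 + s) := fun s => by
    simp only [G, normalMap, add_smul, add_assoc]
  have hside := hF.eventually_mem_of_inner_pos (hP.normalShift_mem_frontier h4 hx₀)
    ((hP.perturbation t h4).inner_normal_pos x₀ hx₀)
  have hnx : outerNormal E x₀ = graphNormal ι γ 0 := by
    have := hc.outerNormal_graphMap hE hc.mem_ball_zero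
    rwa [hc.graphMap_zero] at this
  rw [hy₀, hnx] at hside
  have hsmall : ∀ᶠ s in 𝓝[>] (0 : ℝ), s < ε₁ / 2 :=
    (eventually_lt_nhds (by positivity)).filter_mono nhdsWithin_le_nhds
  have hl0 := abs_lt.1 (hlimt 0 h0)
  have hin : ∀ y, |y - r₀| < ε₁ → y < t * H 0 → G (0, y) ∈ Et t := by
    obtain ⟨s, hs1, hs2, hs3⟩ := (hside.1.and (hsmall.and self_mem_nhdsWithin)).exists
    rw [smul_neg, ← neg_smul, hG0] at hs1
    have hs3 : 0 < s := hs3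
    intro y hy hyl
    exact (hbelow 0 h0 _ (abs_lt.2 ⟨by linarith, by linarith⟩) (by linarith) y hy hyl).1 hs1
  have hout : ∀ y, |y - r₀| < ε₁ → t * H 0 < y → G (0, y) ∉ Et t := by
    obtain ⟨s, hs1, hs2, hs3⟩ := (hside.2.and (hsmall.and self_mem_nhdsWithin)).exists
    rw [hG0] at hs1
    have hs3 : 0 < s := hs3
    intro y hy hyl hmem
    exact hs1 ((habove 0 h0 _ hy hyl _ (abs_lt.2 ⟨by linarith, by linarith⟩) (by linarith)).1 hmem)
  have hlu := abs_lt.1 (hlimt u h2)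
  have hr : |r - r₀| < ε₁ := h3
  rcases lt_trichotomy r (t * H u) with hlt | heq | hgt
  · refine iff_of_true ?_ hlt
    -- The height `3 / 4 * ε₁` is beyond the reach `ε₁ / 2` of the graph and still inside the box of
    -- size `ε₁`.
    have hlow : |r₀ - 3 / 4 * ε₁ - r₀| = 3 / 4 * ε₁ := by
      rw [show r₀ - 3 / 4 * ε₁ - r₀ = -(3 / 4 * ε₁) by ring, abs_neg, abs_of_pos (by positivity)]
    rw [hbelow u h2 r hr hlt (r₀ - 3 / 4 * ε₁) (by linarith) (by linarith),
      hhor _ (by linarith) (by linarith) u h2]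
    exact hin _ (by linarith) (by linarith)
  · refine iff_of_false ?_ heq.not_lt
    exact notMem_of_mem_frontier hF.isOpen ((hfrt u h2 r hr).2 heq)
  · refine iff_of_false ?_ hgt.not_gt
    have hup : |r₀ + 3 / 4 * ε₁ - r₀| = 3 / 4 * ε₁ := by
      rw [add_sub_cancel_left, abs_of_pos (by positivity)]
    rw [habove u h2 r hr hgt (r₀ + 3 / 4 * ε₁) (by linarith) (by linarith),
      hhor _ (by linarith) (by linarith) u h2]
    exact hout _ (by linarith) (by linarith)

/-- A local description of the sets `Et t` near a boundary point, through the inverse `R` of the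
normal coordinates. -/
theorem exists_local_description (hP : IsPerturbationFamily E h Et C t₀)
    (hc : IsGraphChart E x₀ ι δ η γ) {τ : ℝ} (hτ : |τ| < t₀) :
    ∃ R : 𝔼[M + 1] → 𝔼[M] × ℝ, ContDiffAt ℝ (4 : ℕ) R (normalShift E h τ x₀) ∧
      R (normalShift E h τ x₀) = (0, τ * h x₀) ∧
      (∀ᶠ q in 𝓝 ((0 : 𝔼[M]), τ * h x₀), R (normalMap ι x₀ γ q) = q) ∧
      ∀ᶠ w in 𝓝 (τ, normalShift E h τ x₀),
        (w.2 ∈ Et w.1 ↔ (R w.2).2 < w.1 * h (graphMap ι x₀ γ (R w.2).1)) ∧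
        (w.2 ∈ frontier (Et w.1) ↔ (R w.2).2 = w.1 * h (graphMap ι x₀ γ (R w.2).1)) := by
  have hE := hP.smooth
  set G := normalMap ι x₀ γ
  have hG0 : G (0, τ * h x₀) = normalShift E h τ x₀ := by
    have := hc.normalShift_graphMap hE h τ hc.mem_ball_zero
    rw [hc.graphMap_zero] at this
    exact this.symm
  have hGc : ContDiffAt ℝ (4 : ℕ) G (0, τ * h x₀) :=
    hc.contDiffAt_normalMap (q := (0, τ * h x₀)) hc.mem_ball_zero
  have hinj := hP.injective_fderiv_normalMap hc hτ hc.mem_ball_zero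
  rw [hc.graphMap_zero] at hinj
  -- Equal dimensions turn the injective differential into an invertible one, so the inverse
  -- function theorem applies.
  let L : (𝔼[M] × ℝ) ≃L[ℝ] 𝔼[M + 1] := (LinearMap.linearEquivOfInjective
    (fderiv ℝ G (0, τ * h x₀)).toLinearMap hinj (by simp)).toContinuousLinearEquiv
  have hL : (L : (𝔼[M] × ℝ) →L[ℝ] 𝔼[M + 1]) = fderiv ℝ G (0, τ * h x₀) := by
    refine ContinuousLinearMap.ext fun q => ?_
    rfl
  have hGs : HasStrictFDerivAt G (L : (𝔼[M] × ℝ) →L[ℝ] 𝔼[M + 1]) (0, τ * h x₀) := by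
    rw [hL]
    exact hGc.hasStrictFDerivAt (by simp)
  have hleft := hGs.eventually_left_inverse
  have hright := hGs.eventually_right_inverse
  have hsm : ContDiffAt ℝ (4 : ℕ) (hGs.localInverse G L (0, τ * h x₀)) (G (0, τ * h x₀)) :=
    hGc.to_localInverse hGs.hasFDerivAt (by simp)
  set R := hGs.localInverse G L (0, τ * h x₀)
  rw [hG0] at hright hsm
  have hR0 : R (normalShift E h τ x₀) = (0, τ * h x₀) := by
    rw [← hG0]
    exact hleft.self_of_nhds
  refine ⟨R, hsm, hR0, hleft, ?_⟩
  have hc2 : ContinuousAt (fun w : ℝ × 𝔼[M + 1] => (w.1, R w.2)) (τ, normalShift E h τ x₀) :=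
    continuousAt_fst.prodMk (ContinuousAt.comp (f := Prod.snd) (x := (τ, normalShift E h τ x₀))
      hsm.continuousAt continuousAt_snd)
  have e1 := hc2.eventually_of_eq (by rw [hR0]) (hP.eventually_normalMap_mem_iff hc hτ hleft)
  have e3 := hc2.eventually_of_eq (by rw [hR0]) (hP.eventually_mem_frontier_iff hc hτ hleft)
  have e2 : ∀ᶠ w in 𝓝 (τ, normalShift E h τ x₀), G (R w.2) = w.2 :=
    (show ContinuousAt (Prod.snd : ℝ × 𝔼[M + 1] → 𝔼[M + 1]) (τ, normalShift E h τ x₀) from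
      continuousAt_snd).eventually hright
  filter_upwards [e1, e2, e3] with w h1 h2 h3
  rw [show normalMap ι x₀ γ (R w.2) = w.2 from h2] at h1 h3
  exact ⟨h1, h3⟩

/-- If `z` stays off the moving boundary, it stays on the same side of it. -/
theorem mem_iff_of_notMem_frontier (hP : IsPerturbationFamily E h Et C t₀)
    (hne : (frontier E).Nonempty) {a : ℝ} (ha : a < t₀) {z : 𝔼[M + 1]}
    (hz : ∀ t, |t| ≤ a → z ∉ frontier (Et t)) {s t : ℝ} (hs : |s| ≤ a) (ht : |t| ≤ a) :
    z ∈ Et s ↔ z ∈ Et t := by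
  have hloc : ∀ τ, |τ| ≤ a → ∀ᶠ t in 𝓝[Icc (-a) a] τ, (z ∈ Et t ↔ z ∈ Et τ) := by
    intro τ hτ
    have hτ' : |τ| < t₀ := hτ.trans_lt ha
    have hFne : (frontier (Et τ)).Nonempty := by
      obtain ⟨x, hx⟩ := hne
      exact ⟨_, hP.normalShift_mem_frontier hτ' hx⟩
    -- The local description says nothing at `z` itself. A nearest boundary point, which exists
    -- because the boundary is nonempty, leads to a region where it applies.
    obtain ⟨y, hy, hyd⟩ := isClosed_frontier.exists_infDist_eq_dist hFne z
    have hyF := hy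
    rw [(hP.perturbation τ hτ').frontier_eq] at hy
    obtain ⟨x, hx, rfl⟩ := hy
    obtain ⟨ι, δ, η, γ, hc, -⟩ := hP.smooth.exists_isGraphChart hx
    obtain ⟨R, hRc, hR0, hRl, hdesc⟩ := hP.exists_local_description hc hτ'
    set y := normalShift E h τ x
    have hzy : z ≠ y := fun h0 => hz τ hτ (h0 ▸ hyF)
    have hdpos : 0 < dist z y := dist_pos.2 hzy
    -- a point of the segment from `z` to `y` close to `y`
    have hcont : Tendsto (fun s : ℝ => y + s • (z - y)) (𝓝[>] 0) (𝓝 y) := by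
      have hc : ContinuousAt (fun s : ℝ => y + s • (z - y)) 0 := by fun_prop
      have h5 := hc.tendsto
      simp only [zero_smul, add_zero] at h5
      exact h5.mono_left nhdsWithin_le_nhds
    have hd2 : ∀ᶠ w in 𝓝 y, ∀ᶠ w' in 𝓝 (τ, w),
        (w'.2 ∈ Et w'.1 ↔ (R w'.2).2 < w'.1 * h (graphMap ι x γ (R w'.2).1)) ∧
        (w'.2 ∈ frontier (Et w'.1) ↔ (R w'.2).2 = w'.1 * h (graphMap ι x γ (R w'.2).1)) := by
      have h1 := eventually_eventually_nhds.2 hdesc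
      have hc3 : ContinuousAt (fun w : 𝔼[M + 1] => (τ, w)) y := by fun_prop
      exact hc3.eventually h1
    obtain ⟨s, hs3, hs4, hs5⟩ := ((hcont.eventually hd2).and
      ((show ∀ᶠ s in 𝓝[>] (0 : ℝ), s < 1 from
        (eventually_lt_nhds one_pos).filter_mono nhdsWithin_le_nhds).and
        self_mem_nhdsWithin)).exists
    have hs5 : 0 < s := hs5
    set z₁ := y + s • (z - y) with hz₁
    -- By the triangle inequality the distance to the boundary drops along the segment no faster
    -- than the distance travelled, so it never falls below `s * dist z y`. For `t` near `τ` the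
    -- boundary moves by less than this and cannot meet the segment.
    have hd : s * dist z y ≤ Metric.infDist z₁ (frontier (Et τ)) ∧
        ∀ w ∈ segment ℝ z z₁, s * dist z y ≤ Metric.infDist w (frontier (Et τ)) := by
      have key : ∀ w ∈ segment ℝ z z₁, s * dist z y ≤ Metric.infDist w (frontier (Et τ)) := by
        intro w hw
        rw [segment_eq_image'] at hw
        obtain ⟨θ, hθ, rfl⟩ := hw
        have h1 : dist (z + θ • (z₁ - z)) z = θ * (1 - s) * dist z y := by
          have : z + θ • (z₁ - z) - z = (θ * (1 - s)) • (y - z) := by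
            rw [hz₁]
            module
          rw [dist_eq_norm, this, norm_smul, dist_comm z y, dist_eq_norm, Real.norm_eq_abs,
            abs_of_nonneg (mul_nonneg hθ.1 (by linarith))]
        have h2 := Metric.infDist_le_infDist_add_dist (s := frontier (Et τ)) (x := z)
          (y := z + θ • (z₁ - z))
        rw [hyd, dist_comm z (z + θ • (z₁ - z)), h1] at h2
        nlinarith [hθ.1, hθ.2, mul_nonneg (mul_nonneg (sub_nonneg.2 hθ.2)
          (show 0 ≤ 1 - s by linarith)) hdpos.le]
      exact ⟨key z₁ (right_mem_segment ℝ z z₁), key⟩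
    have hspos : 0 < s * dist z y := by positivity
    have hz₁F : z₁ ∉ frontier (Et τ) := fun hmem => by
      have := hd.1
      rw [Metric.infDist_zero_of_mem hmem] at this
      linarith
    -- the status of `z₁` is stable
    have hst : ∀ᶠ t in 𝓝 τ, (z₁ ∈ Et t ↔ z₁ ∈ Et τ) := by
      have hfun : ContinuousAt (fun t : ℝ => (t, z₁)) τ := by fun_prop
      have hdt := hfun.eventually hs3
      by_cases hlt : (R z₁).2 < τ * h (graphMap ι x γ (R z₁).1)
      · have h1 : ∀ᶠ t in 𝓝 τ, (R z₁).2 < t * h (graphMap ι x γ (R z₁).1) :=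
          (show ContinuousAt (fun t => t * h (graphMap ι x γ (R z₁).1)) τ by
            fun_prop).eventually_const_lt hlt
        filter_upwards [hdt, h1] with t ht1 ht2
        exact iff_of_true (ht1.1.2 ht2) (hdt.self_of_nhds.1.2 hlt)
      · have hne2 : τ * h (graphMap ι x γ (R z₁).1) ≠ (R z₁).2 := fun heq =>
          hz₁F (hdt.self_of_nhds.2.2 heq.symm)
        have hgt := lt_of_le_of_ne (not_lt.1 hlt) hne2
        have h1 : ∀ᶠ t in 𝓝 τ, t * h (graphMap ι x γ (R z₁).1) < (R z₁).2 :=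
          (show ContinuousAt (fun t => t * h (graphMap ι x γ (R z₁).1)) τ by
            fun_prop).eventually_lt_const hgt
        filter_upwards [hdt, h1] with t ht1 ht2
        exact iff_of_false (fun hm => (ht1.1.1 hm).not_gt ht2)
          (fun hm => hlt (hdt.self_of_nhds.1.1 hm))
    -- the segment from `z` to `z₁` stays off the boundary
    have hseg : ∀ᶠ t in 𝓝 τ, C * |t - τ| < s * dist z y ∧ |t| < t₀ := by
      refine Filter.Eventually.and ?_ ?_
      · refine (show ContinuousAt (fun t => C * |t - τ|) τ by fun_prop).eventually_lt_const ?_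
        simpa using hspos
      · exact (show ContinuousAt (fun t : ℝ => |t|) τ by fun_prop).eventually_lt_const hτ'
    have hsame : ∀ t, C * |t - τ| < s * dist z y → |t| < t₀ → (z ∈ Et t ↔ z₁ ∈ Et t) := by
      intro t ht1 ht2
      refine IsPreconnected.mem_iff_of_disjoint_frontier
        (convex_segment (𝕜 := ℝ) z z₁).isPreconnected
        (hP.perturbation t ht2).isSmoothOpenSet.isOpen ?_ (left_mem_segment ℝ z z₁)
        (right_mem_segment ℝ z z₁)
      intro w hw hwF
      rw [(hP.perturbation t ht2).frontier_eq] at hwF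
      obtain ⟨x', hx', rfl⟩ := hwF
      have h1 := hd.2 _ hw
      have h2 := Metric.infDist_le_dist_of_mem (x := normalShift E h t x')
        (hP.normalShift_mem_frontier hτ' hx')
      have h3 := hP.dist_normalShift_le t τ hx'
      linarith
    refine Filter.Eventually.filter_mono nhdsWithin_le_nhds ?_
    filter_upwards [hst, hseg] with t h1 h2
    rw [hsame t h2.1 h2.2, h1, ← hsame τ (by simpa using hspos) hτ']
  -- Local constancy in time is propagated along the connected interval `[-a, a]`.
  refine (isPreconnected_Icc (a := -a) (b := a)).induction₂ (fun s t => z ∈ Et s ↔ z ∈ Et t)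
    (fun τ hτ => ?_) (fun _ _ _ _ _ _ => Iff.trans) (fun _ _ _ _ => Iff.symm) (_root_.abs_le.1 hs)
    (_root_.abs_le.1 ht)
  filter_upwards [hloc τ (_root_.abs_le.2 hτ)] with t ht
  exact ht.symm

end IsPerturbationFamily

/-! ### The shape operator and the volume of tubes -/

namespace IsGraphChart

variable {M : ℕ} {E : Set 𝔼[M + 1]} {x₀ : 𝔼[M + 1]} {ι : (𝔼[M] × ℝ) ≃L[ℝ] 𝔼[M + 1]} {δ η : ℝ}
  {γ : 𝔼[M] → ℝ}

/-- Differentiate the orthogonality of the normal to the tangent vector `ι (b, Dγ b)` in the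
direction `a`. The right side is a multiple of the Hessian of `γ`, and its symmetry will make the
shape operator self-adjoint. -/
theorem inner_fderiv_graphNormal_tangent (hc : IsGraphChart E x₀ ι δ η γ) {v : 𝔼[M]}
    (hv : v ∈ Metric.ball 0 δ) (a b : 𝔼[M]) :
    inner ℝ (fderiv ℝ (graphNormal ι γ) v a) (ι (b, fderiv ℝ γ v b)) =
      -((areaElement γ v)⁻¹ * fderiv ℝ (fderiv ℝ γ) v a b) := by
  have h1 : HasFDerivAt (graphNormal ι γ) _ v :=
    ((hc.contDiffAt_graphNormal hv).differentiableAt (by simp)).hasFDerivAt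
  have h2 : HasFDerivAt (fderiv ℝ γ) (fderiv ℝ (fderiv ℝ γ) v) v :=
    (((hc.contDiffAt hv).fderiv_right (m := 1) (by norm_num)).differentiableAt
      (by simp)).hasFDerivAt
  have h3 : HasFDerivAt (fun v' => fderiv ℝ γ v' b)
      ((ContinuousLinearMap.apply ℝ ℝ b) ∘L fderiv ℝ (fderiv ℝ γ) v) v :=
    (ContinuousLinearMap.apply ℝ ℝ b).hasFDerivAt.comp v h2
  have h4 : HasFDerivAt (fun v' => ι (b, fderiv ℝ γ v' b)) ((ι : (𝔼[M] × ℝ) →L[ℝ] 𝔼[M + 1]) ∘L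
      ((0 : 𝔼[M] →L[ℝ] 𝔼[M]).prod ((ContinuousLinearMap.apply ℝ ℝ b) ∘L
        fderiv ℝ (fderiv ℝ γ) v))) v :=
    ι.hasFDerivAt.comp v ((hasFDerivAt_const b v).prodMk h3)
  have h5 := h1.inner ℝ h4
  have h6 : (fun v' => inner ℝ (graphNormal ι γ v') (ι (b, fderiv ℝ γ v' b))) =
      fun _ => (0 : ℝ) := by
    funext v'
    rw [hc.frame.inner_graphNormal]
    simp
  rw [h6] at h5
  have h7 := congrArg (fun l : 𝔼[M] →L[ℝ] ℝ => l a) (h5.unique (hasFDerivAt_const (0 : ℝ) v))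
  have h8 : inner ℝ (graphNormal ι γ v) (ι (0, fderiv ℝ (fderiv ℝ γ) v a b)) +
      inner ℝ (fderiv ℝ (graphNormal ι γ) v a) (ι (b, fderiv ℝ γ v b)) = 0 := by
    simpa [fderivInnerCLM_apply] using h7
  rw [hc.frame.inner_graphNormal] at h8
  have h9 : fderiv ℝ γ v 0 = 0 := _root_.map_zero _
  dsimp only at h8
  rw [h9, sub_zero] at h8
  linarith

theorem inner_fderiv_graphNormal_normal (hc : IsGraphChart E x₀ ι δ η γ) {v : 𝔼[M]}
    (hv : v ∈ Metric.ball 0 δ) (a : 𝔼[M]) :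
    inner ℝ (fderiv ℝ (graphNormal ι γ) v a) (graphNormal ι γ v) = 0 := by
  have h1 : HasFDerivAt (graphNormal ι γ) _ v :=
    ((hc.contDiffAt_graphNormal hv).differentiableAt (by simp)).hasFDerivAt
  have h5 := h1.inner ℝ h1
  have h6 : (fun v' => inner ℝ (graphNormal ι γ v') (graphNormal ι γ v')) = fun _ => (1 : ℝ) := by
    funext v'
    rw [real_inner_self_eq_norm_sq, hc.frame.norm_graphNormal, one_pow]
  rw [h6] at h5
  have h7 := congrArg (fun l : 𝔼[M] →L[ℝ] ℝ => l a) (h5.unique (hasFDerivAt_const (1 : ℝ) v))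
  have h8 : inner ℝ (graphNormal ι γ v) (fderiv ℝ (graphNormal ι γ) v a) +
      inner ℝ (fderiv ℝ (graphNormal ι γ) v a) (graphNormal ι γ v) = 0 := by
    simpa [fderivInnerCLM_apply] using h7
  rw [real_inner_comm] at h8
  linarith

end IsGraphChart

/-- If `1 + r S` is injective for all `|r| < r₁`, with `S` symmetric, its determinant is bounded. -/
theorem LinearMap.IsSymmetric.abs_det_one_add_smul_le {F : Type*} [NormedAddCommGroup F]
    [InnerProductSpace ℝ F] [FiniteDimensional ℝ F] {S : F →ₗ[ℝ] F} (hS : S.IsSymmetric) {r : ℝ}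
    (h : ∀ r', |r'| < |r| → Function.Injective ((LinearMap.id : F →ₗ[ℝ] F) + r' • S)) :
    |LinearMap.det ((LinearMap.id : F →ₗ[ℝ] F) + r • S)| ≤ 2 ^ Module.finrank ℝ F := by
  set T := (LinearMap.id : F →ₗ[ℝ] F) + r • S
  have hT : T.IsSymmetric := LinearMap.IsSymmetric.id.add (hS.smul (by simp))
  rw [hT.det_eq_prod_eigenvalues rfl]
  simp only [RCLike.ofReal_real_eq_id, id_eq]
  rw [Finset.abs_prod]
  have hle : ∀ i, |hT.eigenvalues rfl i| ≤ 2 := by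
    intro i
    set μ := hT.eigenvalues rfl i with hμ
    set u := hT.eigenvectorBasis rfl i with hu
    have hu0 : u ≠ 0 := by
      have := (hT.eigenvectorBasis rfl).orthonormal.ne_zero i
      exact this
    have hTu : u + r • S u = μ • u := hT.apply_eigenvectorBasis rfl i
    -- If `|μ| > 2` then `|μ - 1| > 1`, and with `r' = -r / (μ - 1)`, smaller in modulus than `r`,
    -- the map `1 + r' S` kills the eigenvector. This contradicts injectivity.
    by_contra! hμ2
    have hμ1 : 1 < |μ - 1| := by
      have := abs_sub_abs_le_abs_sub μ 1
      rw [abs_one] at this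
      linarith
    have hμ0 : μ - 1 ≠ 0 := by
      intro h0
      rw [h0, abs_zero] at hμ1
      linarith
    have hr : r ≠ 0 := by
      rintro rfl
      rw [zero_smul, add_zero] at hTu
      have : (μ - 1) • u = 0 := by rw [sub_smul, one_smul, ← hTu, sub_self]
      exact hu0 ((smul_eq_zero.1 this).resolve_left hμ0)
    have hSu : r • S u = (μ - 1) • u := by rw [sub_smul, one_smul, ← hTu, add_sub_cancel_left]
    have hinj := h (-(r / (μ - 1))) (by
      rw [abs_neg, abs_div, div_lt_iff₀ (by linarith)]
      nlinarith [abs_pos.2 hr])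
    refine hu0 (hinj ?_)
    rw [map_zero, LinearMap.add_apply, LinearMap.smul_apply, LinearMap.id_apply, neg_smul,
      div_eq_inv_mul, mul_smul, hSu, smul_smul, inv_mul_cancel₀ hμ0, one_smul, add_neg_cancel]
  calc ∏ i, |hT.eigenvalues rfl i| ≤ ∏ _i : Fin (Module.finrank ℝ F), (2 : ℝ) :=
        Finset.prod_le_prod (fun i _ => abs_nonneg _) fun i _ => hle i
    _ = 2 ^ Module.finrank ℝ F := by simp

/-- The image of the unit ball lies in the ball of radius `K`; comparing volumes bounds the
determinant. -/
theorem ContinuousLinearMap.abs_det_le_pow {F : Type*} [NormedAddCommGroup F] [NormedSpace ℝ F]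
    [FiniteDimensional ℝ F] [Nontrivial F] {L : F →L[ℝ] F} {K : ℝ} (hK : 0 < K)
    (h : ∀ x, ‖L x‖ ≤ K * ‖x‖) :
    |LinearMap.det (L : F →ₗ[ℝ] F)| ≤ K ^ Module.finrank ℝ F := by
  borelize F
  let μ : Measure F := Measure.addHaar
  have h1 := Measure.addHaar_image_continuousLinearMap μ L (Metric.ball 0 1)
  have h2 : μ (L '' Metric.ball 0 1) ≤ μ (Metric.ball 0 K) := by
    refine measure_mono ?_
    rintro _ ⟨x, hx, rfl⟩
    rw [mem_ball_zero_iff] at hx ⊢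
    exact (h x).trans_lt (by nlinarith)
  rw [h1, Measure.addHaar_ball μ 0 hK.le] at h2
  have h3 := (ENNReal.mul_le_mul_iff_left (Metric.measure_ball_pos μ 0 one_pos).ne'
    measure_ball_lt_top.ne).1 h2
  exact (ENNReal.ofReal_le_ofReal_iff (by positivity)).1 h3

/-! ### The Jacobian of the normal coordinates -/

namespace IsPerturbationFamily

variable {M : ℕ} {E : Set 𝔼[M + 1]} {h : 𝔼[M + 1] → ℝ} {Et : ℝ → Set 𝔼[M + 1]} {C t₀ : ℝ}
  {x₀ : 𝔼[M + 1]} {ι : (𝔼[M] × ℝ) ≃L[ℝ] 𝔼[M + 1]} {δ η : ℝ} {γ : 𝔼[M] → ℝ}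

/-- A uniform bound for the Jacobian of the normal coordinates in the region swept out by the
moving boundary. -/
theorem abs_det_fderiv_normalMap_le (hP : IsPerturbationFamily E h Et C t₀)
    (hc : IsGraphChart E x₀ ι δ η γ) {v : 𝔼[M]} (hv : v ∈ Metric.ball 0 δ)
    (hγ : ‖fderiv ℝ γ v‖ ≤ 1) {t r : ℝ} (ht : t < t₀)
    (hr : |r| ≤ t * |h (graphMap ι x₀ γ v)|) :
    |((ι.symm : 𝔼[M + 1] →L[ℝ] 𝔼[M] × ℝ) ∘L fderiv ℝ (normalMap ι x₀ γ) (v, r)).det| ≤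
      6 ^ (M + 1) := by
  set H := h (graphMap ι x₀ γ v) with hH
  set G := normalMap ι x₀ γ with hG
  set m := graphNormal ι γ v with hm
  have hinj0 : Function.Injective (fderiv ℝ G (v, 0)) := by
    have := hP.injective_fderiv_normalMap hc (t := 0) (by simpa using hP.pos) hv
    rwa [zero_mul] at this
  let T : (𝔼[M] × ℝ) ≃ₗ[ℝ] 𝔼[M + 1] := LinearMap.linearEquivOfInjective
    (fderiv ℝ G (v, 0)).toLinearMap hinj0 (by simp)
  have hT : ∀ b, T b = ι (b.1, fderiv ℝ γ v b.1) + b.2 • m := fun b => by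
    have h1 : T b = fderiv ℝ G (v, 0) b := rfl
    rw [h1, hc.fderiv_normalMap (q := (v, 0)) hv, zero_smul, add_zero]
  let B : (𝔼[M] × ℝ) →ₗ[ℝ] 𝔼[M + 1] :=
    (fderiv ℝ (graphNormal ι γ) v).toLinearMap ∘ₗ LinearMap.fst ℝ 𝔼[M] ℝ
  -- `S` is the differential of the normal, viewed as an endomorphism of the ambient space through
  -- `T` and extended by zero in the normal direction. With it, the differential of the normal
  -- coordinates at `(v, r)` factors as `(1 + r S) T`.
  let S : 𝔼[M + 1] →ₗ[ℝ] 𝔼[M + 1] := B ∘ₗ T.symm.toLinearMap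
  have hS : S.IsSymmetric := by
    intro x y
    obtain ⟨a, rfl⟩ := T.surjective x
    obtain ⟨b, rfl⟩ := T.surjective y
    have hST : ∀ a, S (T a) = fderiv ℝ (graphNormal ι γ) v a.1 := fun a => by simp [S, B]
    have key : ∀ a b : 𝔼[M] × ℝ, inner ℝ (S (T a)) (T b) =
        -((areaElement γ v)⁻¹ * fderiv ℝ (fderiv ℝ γ) v a.1 b.1) := fun a b => by
      rw [hST, hT, inner_add_right, inner_smul_right, hc.inner_fderiv_graphNormal_normal hv,
        mul_zero, add_zero, hc.inner_fderiv_graphNormal_tangent hv]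
    have hsymm : fderiv ℝ (fderiv ℝ γ) v a.1 b.1 = fderiv ℝ (fderiv ℝ γ) v b.1 a.1 :=
      ((hc.contDiffAt hv).isSymmSndFDerivAt (by
        rw [minSmoothness_of_isRCLikeNormedField]
        norm_cast)) a.1 b.1
    rw [key, real_inner_comm, key, hsymm]
  have hDG : ∀ r' b, fderiv ℝ G (v, r') b = ((LinearMap.id : 𝔼[M + 1] →ₗ[ℝ] 𝔼[M + 1]) + r' • S) (T b) := fun r' b => by
    rw [hc.fderiv_normalMap (q := (v, r')) hv]
    have : S (T b) = fderiv ℝ (graphNormal ι γ) v b.1 := by simp [S, B]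
    rw [LinearMap.add_apply, LinearMap.smul_apply, this, LinearMap.id_apply, hT]
    module
  -- Each such `r'` equals `τ * H` with `|τ| < t₀`, a value reached by the moving boundary, where
  -- the normal coordinates are nondegenerate. When `H = 0` also `r = 0` and there is nothing to
  -- prove.
  have hinj : ∀ r', |r'| < |r| → Function.Injective ((LinearMap.id : 𝔼[M + 1] →ₗ[ℝ] 𝔼[M + 1]) + r' • S) := by
    intro r' hr'
    have hH0 : 0 < |H| := by
      by_contra! h0
      have h1 : |H| = 0 := le_antisymm h0 (abs_nonneg _)
      rw [h1, mul_zero] at hr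
      linarith [abs_nonneg r']
    have hr'' : r' = r' / H * H := by
      rw [div_mul_cancel₀ _ (abs_pos.1 hH0)]
    have hlt : |r' / H| < t₀ := by
      rw [abs_div, div_lt_iff₀ hH0]
      nlinarith
    have h2 := hP.injective_fderiv_normalMap hc hlt hv
    rw [← hH, ← hr''] at h2
    intro x y hxy
    obtain ⟨a, rfl⟩ := T.surjective x
    obtain ⟨b, rfl⟩ := T.surjective y
    rw [← hDG, ← hDG] at hxy
    rw [h2 hxy]
  have hdet1 := hS.abs_det_one_add_smul_le hinj
  rw [finrank_euclideanSpace, Fintype.card_fin] at hdet1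
  let A : (𝔼[M] × ℝ) →L[ℝ] (𝔼[M] × ℝ) :=
    (ι.symm : 𝔼[M + 1] →L[ℝ] 𝔼[M] × ℝ) ∘L fderiv ℝ G (v, 0)
  -- The constant 3: slope at most one gives a factor 2 on tangent vectors, and the unit normal adds
  -- 1.
  have hA : |LinearMap.det (A : (𝔼[M] × ℝ) →ₗ[ℝ] (𝔼[M] × ℝ))| ≤ 3 ^ (M + 1) := by
    have h1 := ContinuousLinearMap.abs_det_le_pow (L := A) (K := 3) (by norm_num) fun b => by
      have h2 : ι (A b) = ι (b.1, fderiv ℝ γ v b.1) + b.2 • m := by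
        rw [← hT]
        exact ι.apply_symm_apply _
      have h3 : ‖A b‖ ≤ ‖ι (A b)‖ := by
        rw [Prod.norm_def, Real.norm_eq_abs]
        exact max_le (hc.frame.norm_fst_le _) (hc.frame.abs_snd_le _)
      have h4 : ‖ι (b.1, fderiv ℝ γ v b.1)‖ ≤ 2 * ‖b.1‖ := by
        have h5 := hc.frame.norm_le (b.1, fderiv ℝ γ v b.1)
        have h6 := (fderiv ℝ γ v).le_opNorm b.1
        rw [Real.norm_eq_abs] at h6
        have h7 : ‖fderiv ℝ γ v‖ * ‖b.1‖ ≤ 1 * ‖b.1‖ := by gcongr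
        simp only at h5
        linarith
      have h5 : ‖b.2 • m‖ = ‖b.2‖ := by
        rw [norm_smul, hc.frame.norm_graphNormal, mul_one]
      have h6 := norm_fst_le b
      have h7 := norm_snd_le b
      have h8 := norm_add_le (ι (b.1, fderiv ℝ γ v b.1)) (b.2 • m)
      rw [h2] at h3
      linarith
    simpa using h1
  have hfact : (((ι.symm : 𝔼[M + 1] →L[ℝ] 𝔼[M] × ℝ) ∘L fderiv ℝ G (v, r) :
      (𝔼[M] × ℝ) →L[ℝ] (𝔼[M] × ℝ)) : (𝔼[M] × ℝ) →ₗ[ℝ] (𝔼[M] × ℝ)) =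
      (ι.symm.toLinearEquiv.toLinearMap ∘ₗ ((LinearMap.id : 𝔼[M + 1] →ₗ[ℝ] 𝔼[M + 1]) + r • S) ∘ₗ
        ι.symm.toLinearEquiv.symm.toLinearMap) ∘ₗ (A : (𝔼[M] × ℝ) →ₗ[ℝ] (𝔼[M] × ℝ)) := by
    refine LinearMap.ext fun b => ?_
    change ι.symm (fderiv ℝ G (v, r) b) = ι.symm (((LinearMap.id : 𝔼[M + 1] →ₗ[ℝ] 𝔼[M + 1]) + r • S) (ι (A b)))
    have h2 : ι (A b) = T b := ι.apply_symm_apply _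
    rw [h2, hDG]
  have hdet : ((ι.symm : 𝔼[M + 1] →L[ℝ] 𝔼[M] × ℝ) ∘L fderiv ℝ G (v, r)).det =
      LinearMap.det ((LinearMap.id : 𝔼[M + 1] →ₗ[ℝ] 𝔼[M + 1]) + r • S) *
        LinearMap.det (A : (𝔼[M] × ℝ) →ₗ[ℝ] (𝔼[M] × ℝ)) := by
    rw [ContinuousLinearMap.det, hfact, LinearMap.det_comp, LinearMap.det_conj]
  rw [hdet, abs_mul, show (6 : ℝ) = 2 * 3 by norm_num, mul_pow]
  gcongr

end IsPerturbationFamily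

theorem IsGraphChart.mono {M : ℕ} {E : Set 𝔼[M + 1]} {x₀ : 𝔼[M + 1]}
    {ι : (𝔼[M] × ℝ) ≃L[ℝ] 𝔼[M + 1]} {δ δ' η : ℝ} {γ : 𝔼[M] → ℝ} (hc : IsGraphChart E x₀ ι δ η γ)
    (hδ' : 0 < δ') (hle : δ' ≤ δ) : IsGraphChart E x₀ ι δ' η γ where
  frame := hc.frame
  pos := hδ'
  contDiffOn := hc.contDiffOn.mono (Metric.ball_subset_ball hle)
  map_zero := hc.map_zero
  abs_lt v hv := hc.abs_lt v (Metric.ball_subset_ball hle hv)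
  mem_iff v hv := hc.mem_iff v (Metric.ball_subset_ball hle hv)

theorem IsSmoothOpenSet.exists_isGraphChart_fderiv_le {M : ℕ} {E : Set 𝔼[M + 1]}
    (hE : IsSmoothOpenSet E) {x₀ : 𝔼[M + 1]} (hx₀ : x₀ ∈ frontier E) :
    ∃ (ι : (𝔼[M] × ℝ) ≃L[ℝ] 𝔼[M + 1]) (δ η : ℝ) (γ : 𝔼[M] → ℝ), IsGraphChart E x₀ ι δ η γ ∧
      ι (0, 1) = outerNormal E x₀ ∧ ∀ v ∈ Metric.ball (0 : 𝔼[M]) δ, ‖fderiv ℝ γ v‖ ≤ 1 := by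
  obtain ⟨ι, δ, η, γ, hc, he⟩ := hE.exists_isGraphChart hx₀
  have h0 := hc.fderiv_zero hE he
  have hcont : ContinuousAt (fun v => ‖fderiv ℝ γ v‖) 0 :=
    ((hc.contDiffAt hc.mem_ball_zero).fderiv_right (m := 1) (by norm_num)).continuousAt.norm
  have hlt : ∀ᶠ v in 𝓝 (0 : 𝔼[M]), ‖fderiv ℝ γ v‖ < 1 :=
    hcont.eventually_lt_const (by simp [h0])
  obtain ⟨ε, hε, hb⟩ := Metric.eventually_nhds_iff_ball.1 hlt
  refine ⟨ι, min δ ε, η, γ, hc.mono (lt_min hc.pos hε) (min_le_left _ _), he, fun v hv => ?_⟩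
  exact (hb v (Metric.ball_subset_ball (min_le_right _ _) hv)).le

theorem ContinuousOn.measurableSet_inter_preimage {X Y : Type*} [TopologicalSpace X]
    [MeasurableSpace X] [BorelSpace X] [TopologicalSpace Y] [MeasurableSpace Y] [BorelSpace Y]
    {f : X → Y} {s : Set X} {A : Set Y} (hf : ContinuousOn f s) (hs : MeasurableSet s)
    (hA : MeasurableSet A) : MeasurableSet (s ∩ f ⁻¹' A) := by
  have h1 : MeasurableSet (s.domRestrict f ⁻¹' A) :=
    (continuousOn_iff_continuous_domRestrict.1 hf).measurable hA
  have h2 := hs.subtype_image h1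
  rwa [Set.domRestrict_eq, Set.preimage_comp, Subtype.image_preimage_coe] at h2

theorem one_add_norm_rpow_neg_le {X : Type*} [SeminormedAddCommGroup X] {β ρ : ℝ} (hβ : 0 ≤ β)
    (hρ : 0 ≤ ρ) {a b : X} (h : ‖a - b‖ ≤ ρ) :
    (1 + ‖a‖) ^ (-β) ≤ (1 + ρ) ^ β * (1 + ‖b‖) ^ (-β) := by
  have h1 : 1 + ‖b‖ ≤ (1 + ρ) * (1 + ‖a‖) := by
    have := norm_sub_norm_le b a
    rw [norm_sub_rev] at this
    nlinarith [norm_nonneg a, norm_nonneg b]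
  rw [Real.rpow_neg (by positivity), Real.rpow_neg (by positivity), ← div_eq_mul_inv,
    le_div_iff₀ (by positivity), inv_mul_le_iff₀ (by positivity),
    ← Real.mul_rpow (by positivity) (by positivity), mul_comm (1 + ‖a‖)]
  exact Real.rpow_le_rpow (by positivity) h1 hβ

/-! ### Weighted volume of the swept-out region -/

namespace IsPerturbationFamily

variable {M : ℕ} {E : Set 𝔼[M + 1]} {h : 𝔼[M + 1] → ℝ} {Et : ℝ → Set 𝔼[M + 1]} {C t₀ : ℝ}
  {x₀ : 𝔼[M + 1]} {ι : (𝔼[M] × ℝ) ≃L[ℝ] 𝔼[M + 1]} {δ η : ℝ} {γ : 𝔼[M] → ℝ}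

/-- The volume swept out by a small piece of the boundary. -/
theorem volume_tube_le_of_chart (hP : IsPerturbationFamily E h Et C t₀)
    (hc : IsGraphChart E x₀ ι δ η γ) (hγ : ∀ v ∈ Metric.ball (0 : 𝔼[M]) δ, ‖fderiv ℝ γ v‖ ≤ 1)
    {t : ℝ} (ht0 : 0 ≤ t) (ht : t < t₀) {A : Set 𝔼[M + 1]} (hA : MeasurableSet A)
    (hAc : A ⊆ graphMap ι x₀ γ '' Metric.ball 0 δ) :
    volume {z | ∃ x ∈ A, ∃ τ, |τ| ≤ t ∧ z = normalShift E h τ x} ≤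
      ENNReal.ofReal (6 ^ (M + 1) * (2 * C) * t) * μHE[M] A := by
  have hE := hP.smooth
  set ψ := graphMap ι x₀ γ with hψ
  set G := normalMap ι x₀ γ with hG
  set H : 𝔼[M] → ℝ := fun v => h (ψ v) with hH
  have hψc : ContinuousOn ψ (Metric.ball 0 δ) := fun v hv =>
    (hc.contDiffAt_graphMap hv).continuousAt.continuousWithinAt
  have hHc : ContinuousOn H (Metric.ball 0 δ) := fun v hv =>
    (hc.contDiffAt_comp_graphMap hE hP.contDiffOn hv).continuousAt.continuousWithinAt
  set B := Metric.ball 0 δ ∩ ψ ⁻¹' A with hB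
  have hBm : MeasurableSet B := hψc.measurableSet_inter_preimage measurableSet_ball hA
  have hAB : A = ψ '' B := by
    refine Subset.antisymm (fun x hx => ?_) ?_
    · obtain ⟨v, hv, rfl⟩ := hAc hx
      exact ⟨v, ⟨hv, hx⟩, rfl⟩
    · rintro _ ⟨v, hv, rfl⟩
      exact hv.2
  -- The parameter is the orthogonal projection of the graph point, and projections do not increase
  -- measure.
  have hvolB : volume B ≤ μHE[M] A := by
    have h1 := euclideanHausdorffMeasure_image_le_of_dist_le (d := M) (f := ψ) (g := fun v => v)
      (A := B) (K := 1) fun a _ b _ => by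
        rw [NNReal.coe_one, one_mul]
        exact hc.frame.dist_le_dist_graphMap x₀ γ a b
    rwa [image_id', ← hAB, ENNReal.coe_one, one_pow, one_mul,
      EuclideanSpace.euclideanHausdorffMeasure_eq_volume] at h1
  classical
  -- Extension by zero makes the height globally measurable; `H` is only known to be continuous on
  -- the ball.
  let H' : 𝔼[M] → ℝ := (Metric.ball 0 δ).indicator H
  have hH'm : Measurable H' := by
    have := hHc.measurable_piecewise (g := 0) continuousOn_const
      (measurableSet_ball (x := (0 : 𝔼[M])) (ε := δ))
    rwa [Set.piecewise_eq_indicator] at this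
  let S : Set (𝔼[M] × ℝ) := B ×ˢ univ ∩ {q | |q.2| ≤ t * |H' q.1|}
  have hSm : MeasurableSet S := (hBm.prod MeasurableSet.univ).inter
    (measurableSet_le (measurable_snd.abs) ((hH'm.comp measurable_fst).abs.const_mul t))
  have hSH : ∀ q ∈ S, q.1 ∈ Metric.ball 0 δ ∧ |q.2| ≤ t * |H q.1| := fun q hq => by
    have h1 : q.1 ∈ Metric.ball 0 δ := hq.1.1.1
    have h2 : |q.2| ≤ t * |H' q.1| := hq.2
    rw [show H' q.1 = H q.1 from indicator_of_mem h1 H] at h2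
    exact ⟨h1, h2⟩
  have hsub : {z | ∃ x ∈ A, ∃ τ, |τ| ≤ t ∧ z = normalShift E h τ x} ⊆ G '' S := by
    rintro _ ⟨x, hx, τ, hτ, rfl⟩
    rw [hAB] at hx
    obtain ⟨v, hv, rfl⟩ := hx
    refine ⟨(v, τ * H v), ⟨⟨hv, mem_univ _⟩, ?_⟩, (hc.normalShift_graphMap hE h τ hv.1).symm⟩
    change |τ * H v| ≤ t * |H' v|
    rw [show H' v = H v from indicator_of_mem hv.1 H, abs_mul]
    exact mul_le_mul_of_nonneg_right hτ (abs_nonneg _)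
  have hSsub : S ⊆ B ×ˢ Icc (-(t * C)) (t * C) := fun q hq => by
    refine ⟨hq.1.1, _root_.abs_le.1 ((hSH q hq).2.trans ?_)⟩
    exact mul_le_mul_of_nonneg_left
      (hP.abs_le _ (hc.graphMap_mem_frontier hE.isOpen (hSH q hq).1)) ht0
  let f : 𝔼[M] × ℝ → 𝔼[M] × ℝ := fun q => ι.symm (G q)
  have hf : ∀ q ∈ S, HasFDerivWithinAt f
      ((ι.symm : 𝔼[M + 1] →L[ℝ] 𝔼[M] × ℝ) ∘L fderiv ℝ G q) S q := fun q hq => by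
    have h1 : HasFDerivAt G (fderiv ℝ G q) q :=
      ((hc.contDiffAt_normalMap (hSH q hq).1).differentiableAt (by simp)).hasFDerivAt
    exact (ι.symm.hasFDerivAt.comp q h1).hasFDerivWithinAt
  have hfS : f '' S = ι ⁻¹' (G '' S) := by
    ext q
    constructor
    · rintro ⟨q', hq', rfl⟩
      exact ⟨q', hq', (ι.apply_symm_apply _).symm⟩
    · rintro ⟨q', hq', hqq⟩
      exact ⟨q', hq', by simp only [f]; rw [hqq, ι.symm_apply_apply]⟩
  have hvol : volume (G '' S) = volume (f '' S) := by
    rw [hfS]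
    exact (hc.frame.measurePreserving.measure_preimage_emb
      ι.toHomeomorph.measurableEmbedding (G '' S)).symm
  have hdet : ∀ q ∈ S, ENNReal.ofReal
      |((ι.symm : 𝔼[M + 1] →L[ℝ] 𝔼[M] × ℝ) ∘L fderiv ℝ G q).det| ≤ ENNReal.ofReal (6 ^ (M + 1)) :=
    fun q hq => ENNReal.ofReal_le_ofReal
      (hP.abs_det_fderiv_normalMap_le hc (hSH q hq).1 (hγ _ (hSH q hq).1) ht (hSH q hq).2)
  have hC := hP.nonneg
  have : (volume : Measure (𝔼[M] × ℝ)).IsAddHaarMeasure :=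
    inferInstanceAs ((volume : Measure 𝔼[M]).prod (volume : Measure ℝ)).IsAddHaarMeasure
  -- The change of variables inequality needs no injectivity: overlaps of the tube only decrease the
  -- volume of the image.
  calc volume {z | ∃ x ∈ A, ∃ τ, |τ| ≤ t ∧ z = normalShift E h τ x}
      ≤ volume (G '' S) := measure_mono hsub
    _ = volume (f '' S) := hvol
    _ ≤ ∫⁻ q in S, ENNReal.ofReal
          |((ι.symm : 𝔼[M + 1] →L[ℝ] 𝔼[M] × ℝ) ∘L fderiv ℝ G q).det| :=
        addHaar_image_le_lintegral_abs_det_fderiv volume hSm hf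
    _ ≤ ∫⁻ _ in S, ENNReal.ofReal (6 ^ (M + 1)) := setLIntegral_mono measurable_const hdet
    _ = ENNReal.ofReal (6 ^ (M + 1)) * volume S := by rw [lintegral_const, Measure.restrict_apply_univ]
    _ ≤ ENNReal.ofReal (6 ^ (M + 1)) * volume (B ×ˢ Icc (-(t * C)) (t * C)) := by gcongr
    _ = ENNReal.ofReal (6 ^ (M + 1)) * (volume B * ENNReal.ofReal (2 * C * t)) := by
        rw [Measure.volume_eq_prod, Measure.prod_prod, Real.volume_Icc]
        congr 3
        ring
    _ ≤ ENNReal.ofReal (6 ^ (M + 1)) * (μHE[M] A * ENNReal.ofReal (2 * C * t)) := by gcongr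
    _ = ENNReal.ofReal (6 ^ (M + 1) * (2 * C) * t) * μHE[M] A := by
        rw [mul_assoc (6 ^ (M + 1) : ℝ),
          ENNReal.ofReal_mul (p := 6 ^ (M + 1)) (by positivity), mul_comm (μHE[M] A)]
        exact (mul_assoc _ _ _).symm

/-- The weighted volume swept out by the moving boundary. -/
theorem exists_lintegral_tube_le (hP : IsPerturbationFamily E h Et C t₀) {β : ℝ} (hβ : 0 ≤ β) :
    ∃ K : ℝ, 0 ≤ K ∧ ∀ t, 0 ≤ t → t < t₀ → ∀ A ⊆ frontier E, MeasurableSet A →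
      ∫⁻ z in {z | ∃ x ∈ A, ∃ τ, |τ| ≤ t ∧ z = normalShift E h τ x},
        ENNReal.ofReal ((1 + ‖z‖) ^ (-β)) ≤
      ENNReal.ofReal (K * t) * ∫⁻ x in A, ENNReal.ofReal ((1 + ‖x‖) ^ (-β)) ∂μHE[M] := by
  have hC := hP.nonneg
  have ht₀ := hP.pos
  set c := (1 + (1 + t₀ * C)) ^ β with hcdef
  have hc0 : 0 < c := by positivity
  -- One factor `c` replaces the weight on the tube by its value at the centre of the small patch,
  -- the other replaces that value by the weight on the patch.
  refine ⟨c * c * (6 ^ (M + 1) * (2 * C)), by positivity, fun t ht0 ht A hA hAm => ?_⟩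
  set w : 𝔼[M + 1] → ENNReal := fun z => ENNReal.ofReal ((1 + ‖z‖) ^ (-β)) with hw
  have hwm : Measurable w := by fun_prop
  set K := ENNReal.ofReal (c * c * (6 ^ (M + 1) * (2 * C)) * t)
  rw [← lintegral_const_mul _ hwm, ← withDensity_apply _ hAm]
  have hcomp : ∀ a b : 𝔼[M + 1], ‖a - b‖ ≤ 1 + t₀ * C → w a ≤ ENNReal.ofReal c * w b :=
    fun a b hab => by
      rw [hw]
      simp only
      rw [← ENNReal.ofReal_mul hc0.le]
      exact ENNReal.ofReal_le_ofReal (one_add_norm_rpow_neg_le hβ (by positivity) hab)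
  refine le_measure_of_locally_le (s := frontier E)
    (m := fun A => ∫⁻ z in {z | ∃ x ∈ A, ∃ τ, |τ| ≤ t ∧ z = normalShift E h τ x}, w z)
    (by simp) (fun B => ?_) (fun x hx => ?_) hA hAm
  · refine le_trans (lintegral_mono_set ?_) (lintegral_iUnion_le _ _)
    rintro z ⟨x, hx, τ, hτ⟩
    obtain ⟨n, hn⟩ := mem_iUnion.1 hx
    exact mem_iUnion.2 ⟨n, x, hn, τ, hτ⟩
  · obtain ⟨ι, δ, η, γ, hc, _, hγ⟩ := hP.smooth.exists_isGraphChart_fderiv_le hx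
    have hδ := hc.pos
    have hη : 0 < η := (abs_nonneg _).trans_lt (hc.abs_lt 0 hc.mem_ball_zero)
    refine ⟨Metric.ball x (min 1 (min δ η)), Metric.ball_mem_nhds x (by positivity),
      fun A hAU hAs hAm => ?_⟩
    have hnear : ∀ a ∈ A, ‖a - x‖ < 1 ∧ ‖a - x‖ < δ ∧ ‖a - x‖ < η := fun a ha => by
      have := hAU ha
      rw [Metric.mem_ball, dist_eq_norm, lt_min_iff, lt_min_iff] at this
      exact this
    have hAc : A ⊆ graphMap ι x γ '' Metric.ball 0 δ := fun a ha => by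
      obtain ⟨hu, hux⟩ := hc.exists_eq_graphMap hP.smooth.isOpen (hAs ha) (hnear a ha).2.1
        (hnear a ha).2.2
      exact ⟨_, hu, hux⟩
    set T := {z | ∃ x ∈ A, ∃ τ, |τ| ≤ t ∧ z = normalShift E h τ x}
    have hT : ∀ z ∈ T, w z ≤ ENNReal.ofReal c * w x := by
      rintro _ ⟨a, ha, τ, hτ, rfl⟩
      refine hcomp _ _ ?_
      have h1 := hP.dist_normalShift_le τ 0 (hAs ha)
      have h2 : normalShift E h 0 a = a := by simp [normalShift]
      rw [h2, sub_zero, dist_eq_norm] at h1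
      have h3 := norm_sub_le_norm_sub_add_norm_sub (normalShift E h τ a) a x
      have h4 := (hnear a ha).1
      nlinarith
    have hA' : ∀ a ∈ A, w x ≤ ENNReal.ofReal c * w a := fun a ha => by
      refine hcomp _ _ ?_
      rw [norm_sub_rev]
      nlinarith [(hnear a ha).1]
    rw [withDensity_apply _ hAm]
    calc ∫⁻ z in T, w z ≤ ∫⁻ _ in T, ENNReal.ofReal c * w x := setLIntegral_mono measurable_const hT
      _ = ENNReal.ofReal c * w x * volume T := by
          rw [lintegral_const, Measure.restrict_apply_univ]
      _ ≤ ENNReal.ofReal c * w x * (ENNReal.ofReal (6 ^ (M + 1) * (2 * C) * t) * μHE[M] A) := by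
          gcongr
          exact hP.volume_tube_le_of_chart hc hγ ht0 ht hAm hAc
      _ = ENNReal.ofReal c * ENNReal.ofReal (6 ^ (M + 1) * (2 * C) * t) *
            ∫⁻ _ in A, w x ∂μHE[M] := by
          rw [lintegral_const, Measure.restrict_apply_univ]
          ring
      _ ≤ ENNReal.ofReal c * ENNReal.ofReal (6 ^ (M + 1) * (2 * C) * t) *
            ∫⁻ a in A, ENNReal.ofReal c * w a ∂μHE[M] := by
          gcongr 1
          exact setLIntegral_mono (hwm.const_mul _) hA'
      _ = ∫⁻ a in A, K * w a ∂μHE[M] := by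
          rw [lintegral_const_mul _ hwm, lintegral_const_mul _ hwm, ← mul_assoc]
          congr 1
          rw [← ENNReal.ofReal_mul hc0.le, ← ENNReal.ofReal_mul (by positivity)]
          congr 1
          ring

/-- The sets `Et t` and `Et 0` differ only in the region swept out by the boundary. -/
theorem symmDiff_subset (hP : IsPerturbationFamily E h Et C t₀) (hne : (frontier E).Nonempty)
    {t : ℝ} (ht : |t| < t₀) {z : 𝔼[M + 1]} (hz : ¬(z ∈ Et t ↔ z ∈ Et 0)) :
    ∃ x ∈ frontier E, ∃ τ, |τ| ≤ |t| ∧ z = normalShift E h τ x := by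
  by_contra! hcon
  refine hz (hP.mem_iff_of_notMem_frontier hne ht (fun τ hτ hzF => ?_) le_rfl (by simp))
  rw [(hP.perturbation τ (hτ.trans_lt ht)).frontier_eq] at hzF
  obtain ⟨x, hx, rfl⟩ := hzF
  exact hcon x hx τ hτ rfl

end IsPerturbationFamily

/-! ### The moving boundary as a graph -/

namespace IsPerturbationFamily

variable {M : ℕ} {E : Set 𝔼[M + 1]} {h : 𝔼[M + 1] → ℝ} {Et : ℝ → Set 𝔼[M + 1]} {C t₀ : ℝ}
  {x₀ : 𝔼[M + 1]} {ι : (𝔼[M] × ℝ) ≃L[ℝ] 𝔼[M + 1]} {δ η : ℝ} {γ : 𝔼[M] → ℝ}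

/-- The differential of the second normal coordinate is the scalar product with the normal. -/
theorem snd_fderiv_leftInverse (hP : IsPerturbationFamily E h Et C t₀)
    (hc : IsGraphChart E x₀ ι δ η γ) {v : 𝔼[M]} (hv : v ∈ Metric.ball 0 δ)
    {R : 𝔼[M + 1] → 𝔼[M] × ℝ} (hRd : DifferentiableAt ℝ R (graphMap ι x₀ γ v))
    (hR : ∀ᶠ q in 𝓝 (v, (0 : ℝ)), R (normalMap ι x₀ γ q) = q) (b : 𝔼[M + 1]) :
    (fderiv ℝ R (graphMap ι x₀ γ v) b).2 = inner ℝ (graphNormal ι γ v) b := by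
  set G := normalMap ι x₀ γ
  have hG0 : G (v, 0) = graphMap ι x₀ γ v := by simp [G, normalMap]
  have hinj : Function.Injective (fderiv ℝ G (v, 0)) := by
    have := hP.injective_fderiv_normalMap hc (t := 0) (by simpa using hP.pos) hv
    rwa [zero_mul] at this
  let T : (𝔼[M] × ℝ) ≃ₗ[ℝ] 𝔼[M + 1] := LinearMap.linearEquivOfInjective
    (fderiv ℝ G (v, 0)).toLinearMap hinj (by simp)
  -- At `r = 0` the differential of the normal coordinates adds `q.2` times the unit normal to a
  -- tangent vector, so `q.2` is the normal component of its value; the differential of `R` returns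
  -- `q`.
  obtain ⟨q, rfl⟩ := T.surjective b
  have hTq : T q = fderiv ℝ G (v, 0) q := rfl
  have hGd : HasFDerivAt G (fderiv ℝ G (v, 0)) (v, 0) :=
    ((hc.contDiffAt_normalMap (q := (v, 0)) hv).differentiableAt (by simp)).hasFDerivAt
  have hRd' : HasFDerivAt R (fderiv ℝ R (graphMap ι x₀ γ v)) (G (v, 0)) := by
    rw [hG0]
    exact hRd.hasFDerivAt
  have hcomp : HasFDerivAt (fun q => R (G q)) _ (v, (0 : ℝ)) :=
    HasFDerivAt.comp (g := R) (f := G) (v, (0 : ℝ)) hRd' hGd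
  have hid : HasFDerivAt (fun q => R (G q)) (ContinuousLinearMap.id ℝ (𝔼[M] × ℝ)) (v, (0 : ℝ)) :=
    (hasFDerivAt_id (v, (0 : ℝ))).congr_of_eventuallyEq hR
  have h1 : fderiv ℝ R (graphMap ι x₀ γ v) (fderiv ℝ G (v, 0) q) = q :=
    congrArg (fun l : (𝔼[M] × ℝ) →L[ℝ] (𝔼[M] × ℝ) => l q) (hcomp.unique hid)
  rw [hTq, h1, hc.fderiv_normalMap (q := (v, 0)) hv, zero_smul, add_zero, inner_add_right,
    hc.frame.inner_graphNormal, inner_smul_right, real_inner_self_eq_norm_sq,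
    hc.frame.norm_graphNormal]
  simp

/-- Near a boundary point, the sets `Et t - t d` are the subgraphs of smoothly varying functions. -/
theorem exists_moving_graph (hP : IsPerturbationFamily E h Et C t₀)
    (hc : IsGraphChart E x₀ ι δ η γ) (d : 𝔼[M + 1]) :
    ∃ Γ : ℝ × 𝔼[M] → ℝ, ContDiffAt ℝ (4 : ℕ) Γ (0, 0) ∧ (∀ᶠ v in 𝓝 (0 : 𝔼[M]), Γ (0, v) = γ v) ∧
      (∀ᶠ v in 𝓝 (0 : 𝔼[M]), HasDerivAt (fun t => Γ (t, v)) (areaElement γ v *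
        (h (graphMap ι x₀ γ v) - inner ℝ (graphNormal ι γ v) d)) 0) ∧
      (∀ᶠ w in 𝓝 (((0 : ℝ), (0 : 𝔼[M])), (0 : ℝ)),
        (x₀ + ι (w.1.2, w.2) + w.1.1 • d ∈ Et w.1.1 ↔ w.2 < Γ w.1)) ∧
      (d = h x₀ • outerNormal E x₀ → ∀ᶠ t in 𝓝 (0 : ℝ), Γ (t, 0) = 0) := by
  have hE := hP.smooth
  obtain ⟨R, hRc, hR0, hRG, hloc⟩ := hP.exists_local_description hc (τ := 0) (by simpa using hP.pos)
  have hn0 : normalShift E h 0 x₀ = x₀ := by simp [normalShift]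
  rw [hn0] at hRc hR0 hloc
  rw [zero_mul] at hR0 hRG
  set H : 𝔼[M] → ℝ := fun v => h (graphMap ι x₀ γ v) with hHdef
  have hHc : ContDiffAt ℝ (4 : ℕ) H 0 :=
    (hc.contDiffAt_comp_graphMap hE hP.contDiffOn hc.mem_ball_zero).of_le (by norm_cast)
  let Z : (ℝ × 𝔼[M]) × ℝ → 𝔼[M + 1] := fun w => x₀ + ι (w.1.2, w.2) + w.1.1 • d
  have hι0 : ι ((0 : 𝔼[M]), (0 : ℝ)) = 0 := map_zero ι
  have hZ0 : Z ((0, 0), 0) = x₀ := by simp [Z, hι0]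
  have hZc : ContDiff ℝ (4 : ℕ) Z := by
    refine (contDiff_const.add (ι.contDiff.comp ?_)).add ?_
    · exact (contDiff_snd.comp contDiff_fst).prodMk contDiff_snd
    · exact (contDiff_fst.comp contDiff_fst).smul contDiff_const
  -- In normal coordinates at the point `Z w`, this is its height minus the height of `∂(Et t)`; it
  -- is negative exactly when `Z w` lies in `Et t`.
  let Θ : (ℝ × 𝔼[M]) × ℝ → ℝ := fun w => (R (Z w)).2 - w.1.1 * H (R (Z w)).1
  have hRZ : ContDiffAt ℝ (4 : ℕ) (fun w => R (Z w)) ((0, 0), 0) :=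
    ContDiffAt.comp (g := R) (f := Z) ((0, 0), 0) (by rwa [hZ0]) hZc.contDiffAt
  have hΘc : ContDiffAt ℝ (4 : ℕ) Θ ((0, 0), 0) := by
    refine (contDiffAt_snd.comp ((0, 0), 0) hRZ).sub ?_
    refine ((contDiff_fst.comp contDiff_fst).contDiffAt).mul ?_
    refine ContDiffAt.comp (g := H) (f := fun w => (R (Z w)).1) ((0, 0), 0) ?_
      (contDiffAt_fst.comp ((0, 0), 0) hRZ)
    rwa [hZ0, hR0]
  have hΘ0 : Θ ((0, 0), 0) = 0 := by simp [Θ, hZ0, hR0]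
  have hψ0 : graphMap ι x₀ γ 0 = x₀ := hc.graphMap_zero
  -- facts valid for all base points near `0`
  have hnear : ∀ᶠ v in 𝓝 (0 : 𝔼[M]), v ∈ Metric.ball 0 δ ∧
      DifferentiableAt ℝ R (graphMap ι x₀ γ v) ∧
      ∀ᶠ q in 𝓝 (v, (0 : ℝ)), R (normalMap ι x₀ γ q) = q := by
    have hball : ∀ᶠ v in 𝓝 (0 : 𝔼[M]), v ∈ Metric.ball 0 δ :=
      Metric.isOpen_ball.mem_nhds hc.mem_ball_zero
    refine hball.and (.and ?_ ?_)
    · have h1 : ∀ᶠ x in 𝓝 x₀, ContDiffAt ℝ (4 : ℕ) R x := hRc.eventually (by simp)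
      have h2 : ContinuousAt (graphMap ι x₀ γ) 0 :=
        (hc.contDiffAt_graphMap hc.mem_ball_zero).continuousAt
      filter_upwards [h2.eventually_of_eq hψ0 h1] with v hv
      exact hv.differentiableAt (by simp)
    · have h1 := eventually_eventually_nhds.2 hRG
      exact (show ContinuousAt (fun v : 𝔼[M] => (v, (0 : ℝ))) 0 by fun_prop).eventually h1
  have hsnd : ∀ᶠ v in 𝓝 (0 : 𝔼[M]), ∀ b, (fderiv ℝ R (graphMap ι x₀ γ v) b).2 =
      inner ℝ (graphNormal ι γ v) b := by
    filter_upwards [hnear] with v hv b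
    exact hP.snd_fderiv_leftInverse hc hv.1 hv.2.1 hv.2.2 b
  -- The vertical derivative is the scalar product of the vertical vector with the normal, that is,
  -- the inverse of the area element.
  have hpos : 0 < fderiv ℝ Θ ((0, 0), 0) (0, 1) := by
    have h1 : HasDerivAt (fun y : ℝ => Θ ((0, 0), y)) (fderiv ℝ Θ ((0, 0), 0) (0, 1)) 0 := by
      have h2 : HasDerivAt (fun y : ℝ => (((0 : ℝ), (0 : 𝔼[M])), y)) (0, 1) 0 :=
        (hasDerivAt_const (0 : ℝ) ((0 : ℝ), (0 : 𝔼[M]))).prodMk (hasDerivAt_id (0 : ℝ))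
      exact (hΘc.differentiableAt (by simp)).hasFDerivAt.comp_hasDerivAt (0 : ℝ) h2
    have h3 : HasDerivAt (fun y : ℝ => Θ ((0, 0), y)) (areaElement γ 0)⁻¹ 0 := by
      have h4 : HasDerivAt (fun y : ℝ => Z ((0, 0), y)) (ι (0, 1)) 0 := by
        have h5 : HasDerivAt (fun y : ℝ => ((0 : 𝔼[M]), y)) (0, 1) 0 :=
          (hasDerivAt_const (0 : ℝ) (0 : 𝔼[M])).prodMk (hasDerivAt_id (0 : ℝ))
        have h6 := (ι.hasFDerivAt.comp_hasDerivAt (0 : ℝ) h5).const_add x₀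
        simpa [Z] using h6
      have h7 : HasFDerivAt R (fderiv ℝ R x₀) (Z ((0, 0), 0)) := by
        rw [hZ0]
        exact (hRc.differentiableAt (by simp)).hasFDerivAt
      have h8 := h7.comp_hasDerivAt (0 : ℝ) h4
      have h9 : HasDerivAt (fun y : ℝ => (R (Z ((0, 0), y))).2) (fderiv ℝ R x₀ (ι (0, 1))).2 0 :=
        (ContinuousLinearMap.snd ℝ 𝔼[M] ℝ).hasFDerivAt.comp_hasDerivAt (0 : ℝ) h8
      have h10 := hsnd.self_of_nhds (ι (0, 1))
      rw [hψ0, hc.frame.inner_graphNormal] at h10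
      rw [h10] at h9
      simpa [Θ, show fderiv ℝ γ 0 (0 : 𝔼[M]) = 0 from map_zero _] using h9
    rw [h1.unique h3]
    exact inv_pos.2 (areaElement_pos γ 0)
  obtain ⟨Γ, hΓc, hΓ0, hΓΘ, hiff⟩ := exists_implicit_sublevel (by norm_num) hΘc hΘ0 hpos
  -- the function at time zero
  have hinit : ∀ᶠ v in 𝓝 (0 : 𝔼[M]), Γ (0, v) = γ v := by
    have hcv : ContinuousAt (fun v : 𝔼[M] => (((0 : ℝ), v), γ v)) 0 := by
      have := hc.continuousAt hc.mem_ball_zero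
      fun_prop
    filter_upwards [hcv.eventually_of_eq (by rw [hc.map_zero]) hiff, hnear] with v h1 h2
    refine (h1.2.1 ?_).symm
    have h3 : Z ((0, v), γ v) = normalMap ι x₀ γ (v, 0) := by simp [Z, normalMap, graphMap]
    have h4 : R (Z ((0, v), γ v)) = (v, 0) := by rw [h3, h2.2.2.self_of_nhds]
    simp [Θ, h4]
  refine ⟨Γ, hΓc, hinit, ?_, ?_, ?_⟩
  · have hΓd : ∀ᶠ v in 𝓝 (0 : 𝔼[M]), DifferentiableAt ℝ Γ (0, v) ∧
        ∀ᶠ q in 𝓝 ((0 : ℝ), v), Θ (q, Γ q) = 0 := by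
      have hcv : ContinuousAt (fun v : 𝔼[M] => ((0 : ℝ), v)) 0 := by fun_prop
      filter_upwards [hcv.eventually (hΓc.eventually (by simp)),
        hcv.eventually (eventually_eventually_nhds.2 hΓΘ)] with v h1 h2
      exact ⟨h1.differentiableAt (by simp), h2⟩
    have hHd : ∀ᶠ v in 𝓝 (0 : 𝔼[M]), DifferentiableAt ℝ H v := by
      filter_upwards [hHc.eventually (by simp)] with v h1
      exact h1.differentiableAt (by simp)
    filter_upwards [hΓd, hinit, hnear, hsnd, hHd] with v h1 h2 h3 h4 h5
    have hct : HasDerivAt (fun t : ℝ => (t, v)) (1, 0) 0 :=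
      (hasDerivAt_id (0 : ℝ)).prodMk (hasDerivAt_const (0 : ℝ) v)
    set Γ' := fderiv ℝ Γ (0, v) (1, 0)
    have hΓt : HasDerivAt (fun t => Γ (t, v)) Γ' 0 := h1.1.hasFDerivAt.comp_hasDerivAt (0 : ℝ) hct
    have hz : HasDerivAt (fun t : ℝ => Z ((t, v), Γ (t, v))) (ι (0, Γ') + d) 0 := by
      have h6 : HasDerivAt (fun t : ℝ => (v, Γ (t, v))) (0, Γ') 0 :=
        (hasDerivAt_const (0 : ℝ) v).prodMk hΓt
      have h7 := (ι.hasFDerivAt.comp_hasDerivAt (0 : ℝ) h6).const_add x₀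
      have h8 : HasDerivAt (fun t : ℝ => x₀ + ι (v, Γ (t, v)) + t • d)
          (ι (0, Γ') + (1 : ℝ) • d) 0 := h7.add ((hasDerivAt_id (0 : ℝ)).smul_const d)
      rwa [one_smul] at h8
    have hz0 : Z ((0, v), Γ (0, v)) = graphMap ι x₀ γ v := by simp [Z, h2, graphMap]
    have hRzv : R (graphMap ι x₀ γ v) = (v, 0) := by
      have := h3.2.2.self_of_nhds
      rwa [show normalMap ι x₀ γ (v, 0) = graphMap ι x₀ γ v by simp [normalMap]] at this
    have h7 : HasFDerivAt R (fderiv ℝ R (graphMap ι x₀ γ v)) (Z ((0, v), Γ (0, v))) := by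
      rw [hz0]
      exact h3.2.1.hasFDerivAt
    have h8 := h7.comp_hasDerivAt (0 : ℝ) hz
    have h9 : HasDerivAt (fun t : ℝ => (R (Z ((t, v), Γ (t, v)))).2)
        (inner ℝ (graphNormal ι γ v) (ι (0, Γ') + d)) 0 := by
      rw [← h4]
      exact (ContinuousLinearMap.snd ℝ 𝔼[M] ℝ).hasFDerivAt.comp_hasDerivAt (0 : ℝ) h8
    have h10 : HasDerivAt (fun t : ℝ => (R (Z ((t, v), Γ (t, v)))).1)
        (fderiv ℝ R (graphMap ι x₀ γ v) (ι (0, Γ') + d)).1 0 :=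
      (ContinuousLinearMap.fst ℝ 𝔼[M] ℝ).hasFDerivAt.comp_hasDerivAt (0 : ℝ) h8
    have h11 : HasFDerivAt H (fderiv ℝ H v) (R (Z ((0, v), Γ (0, v)))).1 := by
      rw [hz0, hRzv]
      exact h5.hasFDerivAt
    have h12 := h11.comp_hasDerivAt (0 : ℝ) h10
    have h13 := h9.sub ((hasDerivAt_id (0 : ℝ)).mul h12)
    -- The identity `Θ ((t, v), Γ (t, v)) = 0` is differentiated at `t = 0`. The unknown velocity
    -- enters with coefficient `1 / areaElement γ v`, which produces the area element in the result.
    have h14 : HasDerivAt (fun t : ℝ => Θ ((t, v), Γ (t, v))) 0 0 := by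
      refine (hasDerivAt_const (0 : ℝ) (0 : ℝ)).congr_of_eventuallyEq ?_
      exact hct.continuousAt.eventually h1.2
    have h15 := h13.unique h14
    simp only [id_eq, zero_mul, add_zero, one_mul, Function.comp_apply, hz0, hRzv] at h15
    rw [inner_add_right, hc.frame.inner_graphNormal] at h15
    have hJ := areaElement_pos γ v
    have h16 : fderiv ℝ γ v (0 : 𝔼[M]) = 0 := map_zero _
    dsimp only at h15
    rw [h16, sub_zero] at h15
    have h17 : Γ' = areaElement γ v * (H v - inner ℝ (graphNormal ι γ v) d) := by
      field_simp at h15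
      linarith
    rw [← h17]
    exact hΓt
  · have hcw : ContinuousAt (fun w : (ℝ × 𝔼[M]) × ℝ => (w.1.1, Z w)) ((0, 0), 0) :=
      (continuousAt_fst.comp continuousAt_fst).prodMk hZc.continuous.continuousAt
    filter_upwards [hcw.eventually_of_eq (by rw [hZ0]) hloc, hiff] with w h1 h2
    rw [← h2.1]
    refine h1.1.trans ?_
    change _ ↔ (R (Z w)).2 - w.1.1 * H (R (Z w)).1 < 0
    rw [sub_neg]
  · intro hd
    -- With this `d`, undoing the translation sends the origin of the chart to `normalShift E h t
    -- x₀`, a point of `∂(Et t)`.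
    have hcv : ContinuousAt (fun t : ℝ => ((t, (0 : 𝔼[M])), (0 : ℝ))) 0 := by fun_prop
    have hcq : ContinuousAt (fun t : ℝ => ((0 : 𝔼[M]), t * h x₀)) 0 := by fun_prop
    filter_upwards [hcv.eventually hiff, hcq.eventually_of_eq (by simp) hRG] with t h1 h2
    refine (h1.2.1 ?_).symm
    have hG : normalMap ι x₀ γ (0, t * h x₀) = normalShift E h t x₀ := by
      have := hc.normalShift_graphMap hE h t hc.mem_ball_zero
      rw [hψ0] at this
      exact this.symm
    have h3 : Z ((t, 0), 0) = normalMap ι x₀ γ (0, t * h x₀) := by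
      rw [hG]
      simp only [Z, hι0, add_zero, normalShift]
      rw [hd, smul_smul]
    have h4 : R (Z ((t, 0), 0)) = (0, t * h x₀) := by rw [h3, h2]
    simp [Θ, h4, H, hψ0]

end IsPerturbationFamily

/-- Estimates for a function of class `C²` which vanishes on the line `v = 0`. -/
theorem ContDiffAt.exists_odd_bounds {V : Type*} [NormedAddCommGroup V] [NormedSpace ℝ V]
    {g : ℝ × V → ℝ} (hg : ContDiffAt ℝ 2 g (0, 0)) (h0 : ∀ᶠ t in 𝓝 (0 : ℝ), g (t, 0) = 0) :
    ∃ K : ℝ, 0 ≤ K ∧ ∃ ε > 0, ∀ t v, |t| < ε → ‖v‖ < ε →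
      |g (t, v)| ≤ K * ‖v‖ ∧ |g (t, v) + g (t, -v)| ≤ K * ‖v‖ ^ 2 := by
  obtain ⟨K₁, U₁, hU₁, hL₁⟩ := (hg.of_le (show (1 : WithTop ℕ∞) ≤ 2 by
    norm_num)).exists_lipschitzOnWith
  obtain ⟨K₂, U₂, hU₂, hL₂⟩ := (hg.fderiv_right (m := 1) (by norm_num)).exists_lipschitzOnWith
  have hd : ∀ᶠ w in 𝓝 ((0 : ℝ), (0 : V)), DifferentiableAt ℝ g w := by
    filter_upwards [hg.eventually (by simp)] with w hw
    exact hw.differentiableAt (by simp)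
  have h0' : ∀ᶠ w in 𝓝 ((0 : ℝ), (0 : V)), g (w.1, 0) = 0 :=
    (show ContinuousAt (Prod.fst : ℝ × V → ℝ) (0, 0) from continuousAt_fst).eventually h0
  obtain ⟨ε, hε, hball⟩ := Metric.eventually_nhds_iff_ball.1
    (((eventually_mem_set.2 hU₁).and (eventually_mem_set.2 hU₂)).and (hd.and h0'))
  refine ⟨max K₁ (2 * K₂), by positivity, ε, hε, fun t v ht hv => ?_⟩
  have hmem : ∀ u : V, ‖u‖ < ε → (t, u) ∈ Metric.ball ((0 : ℝ), (0 : V)) ε := fun u hu => by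
    rw [← ball_prod_same]
    exact ⟨by simpa using ht, by simpa using hu⟩
  have hz := (hball _ (hmem 0 (by simpa using hε))).2.2
  have hdist : ∀ u u' : V, Dist.dist (t, u) (t, u') = ‖u - u'‖ := fun u u' => by
    rw [Prod.dist_eq, dist_self, dist_eq_norm]
    exact max_eq_right (norm_nonneg _)
  constructor
  · have h1 := hL₁.dist_le_mul _ (hball _ (hmem v hv)).1.1 _
      (hball _ (hmem 0 (by simpa using hε))).1.1
    rw [hdist, hz, Real.dist_eq, sub_zero, sub_zero] at h1
    exact h1.trans (mul_le_mul_of_nonneg_right (le_max_left _ _) (norm_nonneg _))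
  -- The gradient of `u ↦ g (t, u) + g (t, -u)` is the difference of the gradients of `g` at `u` and
  -- `-u`, hence of size `‖u‖` by the Lipschitz bound; the mean value inequality gives the square.
  · have hpair : ∀ u : V, HasFDerivAt (fun u : V => (t, u)) (ContinuousLinearMap.inr ℝ ℝ V) u :=
      fun u => hasFDerivAt_prodMk_right t u
    have hφ : ∀ u ∈ Metric.closedBall (0 : V) ‖v‖, HasFDerivWithinAt
        (fun u => g (t, u) + g (t, -u)) (fderiv ℝ g (t, u) ∘L ContinuousLinearMap.inr ℝ ℝ V +
          (fderiv ℝ g (t, -u) ∘L ContinuousLinearMap.inr ℝ ℝ V) ∘L (-ContinuousLinearMap.id ℝ V))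
        (Metric.closedBall (0 : V) ‖v‖) u := by
      intro u hu
      rw [mem_closedBall_zero_iff] at hu
      have h1 := (hball _ (hmem u (hu.trans_lt hv))).2.1.hasFDerivAt.comp u (hpair u)
      have h2 : HasFDerivAt (fun u => g (t, u)) (fderiv ℝ g (t, -u) ∘L
          ContinuousLinearMap.inr ℝ ℝ V) (-u) :=
        (hball _ (hmem (-u) (by rw [norm_neg]; exact hu.trans_lt hv))).2.1.hasFDerivAt.comp (-u)
          (hpair (-u))
      have h3 := h2.comp u (hasFDerivAt_id u).neg
      exact (h1.add h3).hasFDerivWithinAt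
    have hbd : ∀ u ∈ Metric.closedBall (0 : V) ‖v‖,
        ‖fderiv ℝ g (t, u) ∘L ContinuousLinearMap.inr ℝ ℝ V +
          (fderiv ℝ g (t, -u) ∘L ContinuousLinearMap.inr ℝ ℝ V) ∘L
            (-ContinuousLinearMap.id ℝ V)‖ ≤ 2 * K₂ * ‖v‖ := by
      intro u hu
      rw [mem_closedBall_zero_iff] at hu
      have h1 := hL₂.dist_le_mul _ (hball _ (hmem u (hu.trans_lt hv))).1.2 _
        (hball _ (hmem (-u) (by rw [norm_neg]; exact hu.trans_lt hv))).1.2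
      rw [hdist, dist_eq_norm, sub_neg_eq_add, ← two_smul ℝ, norm_smul, Real.norm_ofNat] at h1
      refine ContinuousLinearMap.opNorm_le_bound _ (by positivity) fun b => ?_
      have h2 : (fderiv ℝ g (t, u) ∘L ContinuousLinearMap.inr ℝ ℝ V +
          (fderiv ℝ g (t, -u) ∘L ContinuousLinearMap.inr ℝ ℝ V) ∘L
            (-ContinuousLinearMap.id ℝ V)) b = (fderiv ℝ g (t, u) - fderiv ℝ g (t, -u)) (0, b) := by
        simp [← sub_eq_add_neg]
      rw [h2]
      refine (ContinuousLinearMap.le_opNorm _ _).trans ?_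
      have h3 : ‖((0 : ℝ), b)‖ = ‖b‖ := by simp
      rw [h3]
      refine mul_le_mul_of_nonneg_right (h1.trans ?_) (norm_nonneg _)
      nlinarith [K₂.coe_nonneg]
    have h4 := (convex_closedBall (0 : V) ‖v‖).norm_image_sub_le_of_norm_hasFDerivWithin_le hφ hbd
      (Metric.mem_closedBall_self (norm_nonneg v)) (y := v) (by simp)
    simp only [neg_zero, hz, add_zero, sub_zero, Real.norm_eq_abs] at h4
    refine h4.trans ?_
    rw [sq, ← mul_assoc]
    gcongr
    exact le_max_right _ _

/-! ### The first variation of integrals of test functions -/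

/-- The set `Et t`, translated by `-t d`. -/
def translatedSet {M : ℕ} (Et : ℝ → Set 𝔼[M + 1]) (d : 𝔼[M + 1]) (t : ℝ) : Set 𝔼[M + 1] :=
  {x | x + t • d ∈ Et t}

/-- The normal velocity of the boundaries of the sets `Et t - t d` at time zero. -/
noncomputable def relativeVelocity {M : ℕ} (E : Set 𝔼[M + 1]) (h : 𝔼[M + 1] → ℝ) (d x : 𝔼[M + 1]) :
    ℝ :=
  h x - inner ℝ (outerNormal E x) d

/-- In the cylinder `‖v‖ < ε`, `|y| < ε`, the sets `Et t - t d`, `|t| < ε`, are the subgraphs of the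
functions `Γ (t, ·)`. -/
structure IsMovingChart {M : ℕ} (E : Set 𝔼[M + 1]) (h : 𝔼[M + 1] → ℝ) (Et : ℝ → Set 𝔼[M + 1])
    (d x₀ : 𝔼[M + 1]) (ι : (𝔼[M] × ℝ) ≃L[ℝ] 𝔼[M + 1]) (γ : 𝔼[M] → ℝ) (ε : ℝ)
    (Γ : ℝ × 𝔼[M] → ℝ) : Prop where
  chart : ∃ η, ε ≤ η ∧ IsGraphChart E x₀ ι ε η γ
  pos : 0 < ε
  contDiffAt : ∀ t v, |t| < ε → ‖v‖ < ε → ContDiffAt ℝ (4 : ℕ) Γ (t, v)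
  apply_zero : ∀ v, ‖v‖ < ε → Γ (0, v) = γ v
  hasDerivAt : ∀ v, ‖v‖ < ε → HasDerivAt (fun t => Γ (t, v))
    (areaElement γ v * relativeVelocity E h d (graphMap ι x₀ γ v)) 0
  mem_iff : ∀ t v y, |t| < ε → ‖v‖ < ε → |y| < ε →
    (x₀ + ι (v, y) ∈ translatedSet Et d t ↔ y < Γ (t, v))

theorem IsMovingChart.mono {M : ℕ} {E : Set 𝔼[M + 1]} {h : 𝔼[M + 1] → ℝ} {Et : ℝ → Set 𝔼[M + 1]}
    {d x₀ : 𝔼[M + 1]} {ι : (𝔼[M] × ℝ) ≃L[ℝ] 𝔼[M + 1]} {γ : 𝔼[M] → ℝ} {ε ε' : ℝ}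
    {Γ : ℝ × 𝔼[M] → ℝ} (hc : IsMovingChart E h Et d x₀ ι γ ε Γ) (hε' : 0 < ε') (hle : ε' ≤ ε) :
    IsMovingChart E h Et d x₀ ι γ ε' Γ where
  chart := by
    obtain ⟨η, hη, hch⟩ := hc.chart
    exact ⟨η, hle.trans hη, hch.mono hε' hle⟩
  pos := hε'
  contDiffAt t v ht hv := hc.contDiffAt t v (ht.trans_le hle) (hv.trans_le hle)
  apply_zero v hv := hc.apply_zero v (hv.trans_le hle)
  hasDerivAt v hv := hc.hasDerivAt v (hv.trans_le hle)
  mem_iff t v y ht hv hy := hc.mem_iff t v y (ht.trans_le hle) (hv.trans_le hle) (hy.trans_le hle)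

namespace IsPerturbationFamily

variable {M : ℕ} {E : Set 𝔼[M + 1]} {h : 𝔼[M + 1] → ℝ} {Et : ℝ → Set 𝔼[M + 1]} {C t₀ : ℝ}
  {x₀ d : 𝔼[M + 1]}

theorem exists_isMovingChart (hP : IsPerturbationFamily E h Et C t₀) (hx₀ : x₀ ∈ frontier E)
    (d : 𝔼[M + 1]) :
    ∃ ι γ ε Γ, IsMovingChart E h Et d x₀ ι γ ε Γ ∧ ι (0, 1) = outerNormal E x₀ ∧
      (∀ v ∈ Metric.ball (0 : 𝔼[M]) ε, ‖fderiv ℝ γ v‖ ≤ 1) ∧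
      (d = h x₀ • outerNormal E x₀ → ∀ᶠ t in 𝓝 (0 : ℝ), Γ (t, 0) = 0) := by
  obtain ⟨ι, δ, η, γ, hc, he, hγ⟩ := hP.smooth.exists_isGraphChart_fderiv_le hx₀
  obtain ⟨Γ, h1, h2, h3, h4, h5⟩ := hP.exists_moving_graph hc d
  have hη : 0 < η := (abs_nonneg _).trans_lt (hc.abs_lt 0 hc.mem_ball_zero)
  have hδ := hc.pos
  obtain ⟨ε₁, hε₁, hb₁⟩ := Metric.eventually_nhds_iff_ball.1 (h1.eventually (by simp))
  obtain ⟨ε₂, hε₂, hb₂⟩ := Metric.eventually_nhds_iff_ball.1 (h2.and h3)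
  obtain ⟨ε₄, hε₄, hb₄⟩ := Metric.eventually_nhds_iff_ball.1 h4
  obtain ⟨ε, hε, hle⟩ : ∃ ε > 0, ε ≤ ε₁ ∧ ε ≤ ε₂ ∧ ε ≤ ε₄ ∧ ε ≤ δ ∧ ε ≤ η :=
    ⟨min ε₁ (min ε₂ (min ε₄ (min δ η))), by positivity, by simp⟩
  obtain ⟨le1, le2, le4, leδ, leη⟩ := hle
  have hc' := hc.mono hε leδ
  refine ⟨ι, γ, ε, Γ, ⟨⟨η, leη, hc'⟩, hε, fun t v ht hv => ?_, fun v hv => ?_,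
    fun v hv => ?_, fun t v y ht hv hy => ?_⟩, he,
    fun v hv => hγ v (Metric.ball_subset_ball leδ hv), h5⟩
  · refine hb₁ (t, v) ?_
    rw [← ball_prod_same]
    exact ⟨by simpa using ht.trans_le le1, by simpa using hv.trans_le le1⟩
  · exact (hb₂ v (by simpa using hv.trans_le le2)).1
  · rw [relativeVelocity, hc'.outerNormal_graphMap hP.smooth (by simpa using hv)]
    exact (hb₂ v (by simpa using hv.trans_le le2)).2
  · refine hb₄ ((t, v), y) ?_
    rw [← ball_prod_same, ← ball_prod_same]
    exact ⟨⟨by simpa using ht.trans_le le4, by simpa using hv.trans_le le4⟩,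
      by simpa using hy.trans_le le4⟩

theorem isOpen_translatedSet (hP : IsPerturbationFamily E h Et C t₀) (d : 𝔼[M + 1]) {t : ℝ}
    (ht : |t| < t₀) : IsOpen (translatedSet Et d t) :=
  (hP.perturbation t ht).isSmoothOpenSet.isOpen.preimage
    (show Continuous fun x : 𝔼[M + 1] => x + t • d by fun_prop)

/-- Off the boundary, the sets `Et t - t d` are locally constant in `t`. -/
theorem exists_mem_translatedSet_iff (hP : IsPerturbationFamily E h Et C t₀)
    (hne : (frontier E).Nonempty) (hx₀ : x₀ ∉ frontier E) (d : 𝔼[M + 1]) :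
    ∃ U, IsOpen U ∧ x₀ ∈ U ∧ Disjoint U (frontier E) ∧ ∀ᶠ t in 𝓝 (0 : ℝ), ∀ x ∈ U,
      (x ∈ translatedSet Et d t ↔ x ∈ translatedSet Et d 0) := by
  have hcl : x₀ ∉ closure (frontier E) := by rwa [isClosed_frontier.closure_eq]
  have hpos := (Metric.infDist_pos_iff_notMem_closure hne).1 hcl
  set r := Metric.infDist x₀ (frontier E) / 2 with hr
  have hr0 : 0 < r := by positivity
  have hfar : ∀ x ∈ Metric.ball x₀ r, ∀ y ∈ frontier E, r < dist x y := fun x hx y hy => by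
    have h1 := Metric.infDist_le_dist_of_mem (x := x₀) hy
    have h2 := dist_triangle x₀ x y
    rw [Metric.mem_ball, dist_comm] at hx
    linarith
  refine ⟨Metric.ball x₀ (r / 2), Metric.isOpen_ball, Metric.mem_ball_self (by positivity),
    Set.disjoint_left.2 fun x hx hxF => ?_, ?_⟩
  · have := hfar x (Metric.ball_subset_ball (by linarith) hx) x hxF
    rw [dist_self] at this
    linarith
  have e1 : ∀ᶠ t in 𝓝 (0 : ℝ), C * |t| < r :=
    (show ContinuousAt (fun t : ℝ => C * |t|) 0 by fun_prop).eventually_lt_const (by simpa)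
  have e2 : ∀ᶠ t in 𝓝 (0 : ℝ), ‖t • d‖ < r / 2 :=
    (show ContinuousAt (fun t : ℝ => ‖t • d‖) 0 by fun_prop).eventually_lt_const (by simpa)
  have e3 : ∀ᶠ t in 𝓝 (0 : ℝ), |t| < t₀ :=
    (show ContinuousAt (fun t : ℝ => |t|) 0 by fun_prop).eventually_lt_const (by simpa using hP.pos)
  filter_upwards [e1, e2, e3] with t h1 h2 h3 x hx
  have hoff : ∀ z ∈ Metric.ball x₀ r, ∀ τ, |τ| ≤ |t| → z ∉ frontier (Et τ) := by
    intro z hz τ hτ hzF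
    rw [(hP.perturbation τ (hτ.trans_lt h3)).frontier_eq] at hzF
    obtain ⟨y, hy, rfl⟩ := hzF
    have h4 := hfar _ hz y hy
    have h5 := hP.dist_normalShift_le τ 0 hy
    rw [show normalShift E h 0 y = y by simp [normalShift], sub_zero] at h5
    have := mul_le_mul_of_nonneg_left hτ hP.nonneg
    linarith
  have hx' : x ∈ Metric.ball x₀ r := Metric.ball_subset_ball (by linarith) hx
  have hxt : x + t • d ∈ Metric.ball x₀ r := by
    rw [Metric.mem_ball] at hx ⊢
    have h4 := dist_triangle (x + t • d) x x₀
    rw [dist_eq_norm (x + t • d) x, add_sub_cancel_left] at h4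
    linarith
  have h6 : x + t • d ∈ Et t ↔ x + t • d ∈ Et 0 :=
    hP.mem_iff_of_notMem_frontier hne h3 (hoff _ hxt) le_rfl (by simp)
  have h7 : x + t • d ∈ Et 0 ↔ x ∈ Et 0 :=
    (convex_ball x₀ r).isPreconnected.mem_iff_of_disjoint_frontier
      (hP.perturbation 0 (by simpa using hP.pos)).isSmoothOpenSet.isOpen
      (fun z hz => hoff z hz 0 (by simp)) hxt hx'
  have h8 : x ∈ translatedSet Et d 0 ↔ x ∈ Et 0 := by simp [translatedSet]
  rw [h8, ← h7, ← h6]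
  rfl

end IsPerturbationFamily

theorem hasDerivAt_integral_Iio_comp {g : ℝ → ℝ} (hg : Continuous g) (hgi : Integrable g) {b : ℝ → ℝ}
    {b' t : ℝ} (hb : HasDerivAt b b' t) :
    HasDerivAt (fun t => ∫ y in Iio (b t), g y) (g (b t) * b') t := by
  have h1 : (fun t => ∫ y in Iio (b t), g y) =
      fun t => (∫ y in Iic 0, g y) + ∫ y in (0 : ℝ)..b t, g y := by
    funext t
    rw [← integral_Iic_eq_integral_Iio, ← intervalIntegral.integral_Iic_sub_Iic hgi.integrableOn
      hgi.integrableOn]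
    ring
  rw [h1]
  exact ((hg.integral_hasStrictDerivAt 0 (b t)).hasDerivAt.comp t hb).const_add _

theorem IsFrame.measurePreserving_add {M : ℕ} {ι : (𝔼[M] × ℝ) ≃L[ℝ] 𝔼[M + 1]} (hι : IsFrame ι)
    (x₀ : 𝔼[M + 1]) : MeasurePreserving (fun q => x₀ + ι q) volume volume :=
  (measurePreserving_add_left volume x₀).comp hι.measurePreserving

theorem measurableEmbedding_add_frame {M : ℕ} (ι : (𝔼[M] × ℝ) ≃L[ℝ] 𝔼[M + 1])
    (x₀ : 𝔼[M + 1]) : MeasurableEmbedding (fun q => x₀ + ι q) :=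
  (MeasurableEquiv.addLeft x₀).measurableEmbedding.comp ι.toHomeomorph.measurableEmbedding

/-! ### First variation inside one chart -/

namespace IsMovingChart

variable {M : ℕ} {E : Set 𝔼[M + 1]} {h : 𝔼[M + 1] → ℝ} {Et : ℝ → Set 𝔼[M + 1]} {C t₀ : ℝ}
  {x₀ d : 𝔼[M + 1]} {ι : (𝔼[M] × ℝ) ≃L[ℝ] 𝔼[M + 1]} {γ : 𝔼[M] → ℝ} {ε : ℝ}
  {Γ : ℝ × 𝔼[M] → ℝ}

theorem frame (hc : IsMovingChart E h Et d x₀ ι γ ε Γ) : IsFrame ι := by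
  obtain ⟨η, _, hch⟩ := hc.chart
  exact hch.frame

theorem hasDerivAt_fderiv (hc : IsMovingChart E h Et d x₀ ι γ ε Γ) {t : ℝ} {v : 𝔼[M]}
    (ht : |t| < ε) (hv : ‖v‖ < ε) :
    HasDerivAt (fun t => Γ (t, v)) (fderiv ℝ Γ (t, v) (1, 0)) t := by
  have hct : HasDerivAt (fun t : ℝ => (t, v)) (1, 0) t :=
    (hasDerivAt_id t).prodMk (hasDerivAt_const t v)
  exact ((hc.contDiffAt t v ht hv).differentiableAt (by simp)).hasFDerivAt.comp_hasDerivAt t hct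

theorem contDiffAt_fderiv (hc : IsMovingChart E h Et d x₀ ι γ ε Γ) {t : ℝ} {v : 𝔼[M]}
    (ht : |t| < ε) (hv : ‖v‖ < ε) :
    ContDiffAt ℝ 2 (fun w => fderiv ℝ Γ w (1, 0)) (t, v) :=
  ((hc.contDiffAt t v ht hv).fderiv_right (m := 2) (by norm_cast)).clm_apply contDiffAt_const

theorem fderiv_zero (hc : IsMovingChart E h Et d x₀ ι γ ε Γ) {v : 𝔼[M]} (hv : ‖v‖ < ε) :
    fderiv ℝ Γ (0, v) (1, 0) = areaElement γ v * relativeVelocity E h d (graphMap ι x₀ γ v) :=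
  (hc.hasDerivAt_fderiv (by simpa using hc.pos) hv).unique (hc.hasDerivAt v hv)

theorem exists_abs_fderiv_le (hc : IsMovingChart E h Et d x₀ ι γ ε Γ) :
    ∃ B, ∃ ε' > 0, ε' ≤ ε ∧ ∀ t v, |t| < ε' → ‖v‖ < ε' → |fderiv ℝ Γ (t, v) (1, 0)| ≤ B := by
  have h1 : ContinuousAt (fun w : ℝ × 𝔼[M] => |fderiv ℝ Γ w (1, 0)|) (0, 0) :=
    (hc.contDiffAt_fderiv (by simpa using hc.pos) (by simpa using hc.pos)).continuousAt.abs
  have h2 := h1.eventually_lt_const (lt_add_one _)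
  obtain ⟨ε₁, hε₁, hb⟩ := Metric.eventually_nhds_iff_ball.1 h2
  refine ⟨_, min ε₁ ε, lt_min hε₁ hc.pos, min_le_right _ _, fun t v ht hv => (hb (t, v) ?_).le⟩
  rw [← ball_prod_same]
  exact ⟨by simpa using ht.trans_le (min_le_left _ _), by simpa using hv.trans_le (min_le_left _ _)⟩

/-- The first variation of the integral of a test function supported in the domain of a chart. -/
theorem hasDerivAt_integral (hc : IsMovingChart E h Et d x₀ ι γ ε Γ)
    (hP : IsPerturbationFamily E h Et C t₀) {B : ℝ}
    (hB : ∀ t v, |t| < ε → ‖v‖ < ε → |fderiv ℝ Γ (t, v) (1, 0)| ≤ B)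
    {f : 𝔼[M + 1] → ℝ} (hf : Continuous f) (hfc : HasCompactSupport f)
    (hfs : ∀ x, f x ≠ 0 → ‖(ι.symm (x - x₀)).1‖ < ε ∧ |(ι.symm (x - x₀)).2| < ε) :
    IntegrableOn (fun x => f x * relativeVelocity E h d x) (frontier E) μHE[M] ∧
      HasDerivAt (fun t => ∫ x in translatedSet Et d t, f x)
        (∫ x in frontier E, f x * relativeVelocity E h d x ∂μHE[M]) 0 := by
  have hε := hc.pos
  have hι := hc.frame
  obtain ⟨η, hη, hch⟩ := hc.chart
  have hE := hP.smooth
  let g : 𝔼[M] → ℝ → ℝ := fun v y => f (x₀ + ι (v, y))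
  have hgc : Continuous fun q : 𝔼[M] × ℝ => g q.1 q.2 := by
    exact hf.comp (continuous_const.add ι.continuous)
  have hg0 : ∀ v y, g v y ≠ 0 → ‖v‖ < ε ∧ |y| < ε := fun v y hne => by
    have := hfs _ hne
    rwa [add_sub_cancel_left, ι.symm_apply_apply] at this
  have hgcv : ∀ v, Continuous (g v) := fun v => hgc.comp (Continuous.prodMk_right v)
  have hgi : ∀ v, Integrable (g v) := fun v => by
    refine (hgcv v).integrable_of_hasCompactSupport
      (HasCompactSupport.intro (isCompact_Icc (a := -ε) (b := ε)) fun y hy => ?_)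
    by_contra hne
    exact hy (_root_.abs_le.1 (hg0 v y hne).2.le)
  obtain ⟨A, hA⟩ := hfc.exists_bound_of_continuous hf
  have hA0 : 0 ≤ A := (norm_nonneg _).trans (hA 0)
  have hB0 : 0 ≤ B := (abs_nonneg _).trans (hB 0 0 (by simpa) (by simpa))
  have hfi : Integrable f := hf.integrable_of_hasCompactSupport hfc
  -- By Fubini in the frame, the integral over the moving set is the integral in `v` of `F t v`, and
  -- for small `t` the latter is an integral over the half-line below `Γ (t, v)`, differentiable in
  -- `t`.
  let F : ℝ → 𝔼[M] → ℝ := fun t v =>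
    ∫ y, (translatedSet Et d t).indicator f (x₀ + ι (v, y))
  let F' : ℝ → 𝔼[M] → ℝ := fun t v =>
    (Metric.ball 0 ε).indicator (fun v => g v (Γ (t, v)) * fderiv ℝ Γ (t, v) (1, 0)) v
  have ht₀ := hP.pos
  have hmeas : ∀ᶠ t in 𝓝 (0 : ℝ), MeasurableSet (translatedSet Et d t) := by
    filter_upwards [(show ContinuousAt (fun t : ℝ => |t|) 0 by
      fun_prop).eventually_lt_const (show |(0 : ℝ)| < t₀ by simpa)] with t ht
    exact (hP.isOpen_translatedSet d ht).measurableSet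
  have hprod : ∀ t, MeasurableSet (translatedSet Et d t) →
      Integrable (fun q : 𝔼[M] × ℝ => (translatedSet Et d t).indicator f (x₀ + ι q))
        (volume.prod volume) := fun t ht =>
    ((hι.measurePreserving_add x₀).integrable_comp_emb (measurableEmbedding_add_frame ι x₀)).2
      (hfi.indicator ht)
  have hFi : ∀ᶠ t in 𝓝 (0 : ℝ), Integrable (F t) := by
    filter_upwards [hmeas] with t ht
    exact (hprod t ht).integral_prod_left
  have hFeq : ∀ᶠ t in 𝓝 (0 : ℝ), ∫ x in translatedSet Et d t, f x = ∫ v, F t v := by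
    filter_upwards [hmeas] with t ht
    rw [← integral_indicator ht, ← (hι.measurePreserving_add x₀).integral_comp
      (measurableEmbedding_add_frame ι x₀)]
    exact integral_prod _ (hprod t ht)
  have hFin : ∀ t v, |t| < ε → ‖v‖ < ε → F t v = ∫ y in Iio (Γ (t, v)), g v y := by
    intro t v ht hv
    rw [← integral_indicator measurableSet_Iio]
    refine integral_congr_ae (Eventually.of_forall fun y => ?_)
    by_cases hy : g v y = 0
    · have hy' : f (x₀ + ι (v, y)) = 0 := hy
      simp [indicator_apply, hy, hy']
    · have h1 := hc.mem_iff t v y ht hv (hg0 v y hy).2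
      by_cases h2 : y < Γ (t, v)
      · simp only [indicator_of_mem (h1.2 h2), indicator_of_mem (mem_Iio.2 h2), g]
      · simp only [indicator_of_notMem (mt h1.1 h2), indicator_of_notMem (notMem_Iio.2 (not_lt.1 h2))]
  have hFout : ∀ t v, ε ≤ ‖v‖ → F t v = 0 := by
    intro t v hv
    have : ∀ y, (translatedSet Et d t).indicator f (x₀ + ι (v, y)) = 0 := fun y => by
      by_contra hne
      exact hv.not_gt (hg0 v y fun h0 => hne (by
        exact indicator_apply_eq_zero.2 fun _ => h0)).1
    simp only [F, this, integral_zero]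
  have hball : ∀ t : ℝ, t ∈ Metric.ball (0 : ℝ) ε ↔ |t| < ε := fun t => by simp
  have hderiv : ∀ v, ∀ t ∈ Metric.ball (0 : ℝ) ε, HasDerivAt (fun t => F t v) (F' t v) t := by
    intro v t ht
    by_cases hv : ‖v‖ < ε
    · have h1 : F' t v = g v (Γ (t, v)) * fderiv ℝ Γ (t, v) (1, 0) :=
        indicator_of_mem (by simpa using hv) _
      rw [h1]
      refine (hasDerivAt_integral_Iio_comp (hgcv v) (hgi v)
        (hc.hasDerivAt_fderiv ((hball t).1 ht) hv)).congr_of_eventuallyEq ?_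
      filter_upwards [Metric.isOpen_ball.mem_nhds ht] with t' ht'
      exact hFin t' v ((hball t').1 ht') hv
    · have h1 : F' t v = 0 := indicator_of_notMem (by simpa using hv) _
      rw [h1]
      refine (hasDerivAt_const t (0 : ℝ)).congr_of_eventuallyEq (Eventually.of_forall fun t' => ?_)
      exact hFout t' v (not_lt.1 hv)
  have hcont0 : ContinuousOn (fun v => g v (Γ (0, v)) * fderiv ℝ Γ (0, v) (1, 0))
      (Metric.ball 0 ε) := by
    intro v hv
    have hv' : ‖v‖ < ε := by simpa using hv
    have hcv : ContinuousAt (fun v : 𝔼[M] => ((0 : ℝ), v)) v := by fun_prop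
    have h1 : ContinuousAt (fun v => Γ (0, v)) v :=
      ContinuousAt.comp (g := Γ) (f := fun v : 𝔼[M] => ((0 : ℝ), v))
        (hc.contDiffAt 0 v (by simpa) hv').continuousAt hcv
    have h2 : ContinuousAt (fun v => fderiv ℝ Γ (0, v) (1, 0)) v :=
      ContinuousAt.comp (g := fun w => fderiv ℝ Γ w (1, 0)) (f := fun v : 𝔼[M] => ((0 : ℝ), v))
        (hc.contDiffAt_fderiv (by simpa) hv').continuousAt hcv
    have h3 : ContinuousAt (fun v => g v (Γ (0, v))) v :=
      ContinuousAt.comp (g := fun q : 𝔼[M] × ℝ => g q.1 q.2) (f := fun v => (v, Γ (0, v)))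
        hgc.continuousAt (continuousAt_id.prodMk h1)
    exact (h3.mul h2).continuousWithinAt
  have hmeas0 : AEStronglyMeasurable (F' 0) :=
    (aestronglyMeasurable_indicator_iff measurableSet_ball).2
      (hcont0.aestronglyMeasurable measurableSet_ball)
  have hbound : ∀ v, ∀ t ∈ Metric.ball (0 : ℝ) ε,
      ‖F' t v‖ ≤ (Metric.ball 0 ε).indicator (fun _ => A * B) v := by
    intro v t ht
    by_cases hv : v ∈ Metric.ball 0 ε
    · simp only [F', indicator_of_mem hv, norm_mul, Real.norm_eq_abs]
      exact mul_le_mul (hA _) (hB t v ((hball t).1 ht) (by simpa using hv)) (abs_nonneg _) hA0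
    · simp only [F', indicator_of_notMem hv, norm_zero, le_refl]
  have hbi : Integrable ((Metric.ball (0 : 𝔼[M]) ε).indicator fun _ => A * B) :=
    (integrable_indicator_iff measurableSet_ball).2
      (integrableOn_const measure_ball_lt_top.ne)
  obtain ⟨hF'i, hFd⟩ := hasDerivAt_integral_of_dominated_loc_of_deriv_le
    (Metric.ball_mem_nhds (0 : ℝ) hε) (hFi.mono fun t ht => ht.aestronglyMeasurable)
    hFi.self_of_nhds hmeas0 (Eventually.of_forall hbound) hbi (Eventually.of_forall hderiv)
  set ψ := graphMap ι x₀ γ with hψ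
  -- The area element contained in the time derivative of `Γ` is exactly the density of surface
  -- measure.
  have hF'0 : ∀ v ∈ Metric.ball (0 : 𝔼[M]) ε, areaElement γ v *
      (f (ψ v) * relativeVelocity E h d (ψ v)) = g v (Γ (0, v)) * fderiv ℝ Γ (0, v) (1, 0) := by
    intro v hv
    have hv' : ‖v‖ < ε := by simpa using hv
    rw [hc.fderiv_zero hv', hc.apply_zero v hv']
    simp only [g, hψ, graphMap]
    ring
  have hsm : AEStronglyMeasurable (fun v => f (ψ v) * relativeVelocity E h d (ψ v))
      (volume.restrict (Metric.ball (0 : 𝔼[M]) ε)) := by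
    have hJ := continuousOn_areaElement Metric.isOpen_ball (hch.contDiffOn.of_le
      (show (1 : WithTop ℕ∞) ≤ 5 by norm_cast))
    refine ContinuousOn.aestronglyMeasurable ?_ measurableSet_ball
    refine ((hJ.inv₀ fun v _ => (areaElement_pos γ v).ne').mul hcont0).congr fun v hv => ?_
    simp only [Pi.mul_apply, Pi.inv_apply]
    rw [← hF'0 v hv, inv_mul_cancel_left₀ (areaElement_pos γ v).ne']
  have hgraph := hι.integral_graph x₀ Metric.isOpen_ball (hch.contDiffOn.of_le
    (show (1 : WithTop ℕ∞) ≤ 5 by norm_cast)) (f := fun x => f x * relativeVelocity E h d x) hsm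
    fun v _ => rfl
  have hsubset : ψ '' Metric.ball 0 ε ⊆ frontier E := by
    rintro _ ⟨v, hv, rfl⟩
    exact hch.graphMap_mem_frontier hE.isOpen hv
  have hzero : ∀ x ∈ frontier E \ ψ '' Metric.ball 0 ε, f x * relativeVelocity E h d x = 0 := by
    intro x hx
    have : f x = 0 := by
      by_contra hne
      have h1 := hfs x hne
      set q := ι.symm (x - x₀) with hq
      have hx' : x = x₀ + ι (q.1, q.2) := by
        rw [Prod.mk.eta, hq, ι.apply_symm_apply, add_sub_cancel]
      have h2 : q.1 ∈ Metric.ball (0 : 𝔼[M]) ε := by simpa using h1.1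
      refine hx.2 ⟨q.1, h2, ?_⟩
      have h3 := hx.1
      rw [hx'] at h3
      rw [hx', (hch.mem_frontier_iff hE.isOpen h2 (h1.2.trans_le hη)).1 h3]
      rfl
    rw [this, zero_mul]
  have hF'on : IntegrableOn (fun v => areaElement γ v *
      (f (ψ v) * relativeVelocity E h d (ψ v))) (Metric.ball (0 : 𝔼[M]) ε) :=
    ((integrable_indicator_iff measurableSet_ball).1 hF'i).congr_fun
      (fun v hv => (hF'0 v hv).symm) measurableSet_ball
  have hψm : MeasurableSet (ψ '' Metric.ball 0 ε) :=
    measurableSet_graphMap_image x₀ measurableSet_ball hch.contDiffOn.continuousOn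
  have hfrm : MeasurableSet (frontier E) := isClosed_frontier.measurableSet
  constructor
  · exact (hgraph.1.2 hF'on).of_forall_sdiff_eq_zero hfrm hzero
  · have h1 : ∫ x in frontier E, f x * relativeVelocity E h d x ∂μHE[M] = ∫ v, F' 0 v := by
      rw [setIntegral_eq_of_subset_of_forall_sdiff_eq_zero hfrm hsubset hzero, hgraph.2,
        integral_indicator measurableSet_ball]
      exact setIntegral_congr_fun measurableSet_ball hF'0
    rw [h1]
    exact hFd.congr_of_eventuallyEq hFeq

end IsMovingChart

/-! ### Globalization by a partition of unity -/

namespace IsPerturbationFamily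

variable {M : ℕ} {E : Set 𝔼[M + 1]} {h : 𝔼[M + 1] → ℝ} {Et : ℝ → Set 𝔼[M + 1]} {C t₀ : ℝ}
  {x₀ d : 𝔼[M + 1]}

/-- Near a boundary point a moving chart applies. Elsewhere the sets do not change for small times,
and both the derivative and the surface integral vanish. -/
theorem exists_isOpen_hasDerivAt_integral (hP : IsPerturbationFamily E h Et C t₀)
    (hne : (frontier E).Nonempty) (d x₀ : 𝔼[M + 1]) :
    ∃ U, IsOpen U ∧ x₀ ∈ U ∧ ∀ f : 𝔼[M + 1] → ℝ, Continuous f → HasCompactSupport f →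
      Function.support f ⊆ U →
      IntegrableOn (fun x => f x * relativeVelocity E h d x) (frontier E) μHE[M] ∧
      HasDerivAt (fun t => ∫ x in translatedSet Et d t, f x)
        (∫ x in frontier E, f x * relativeVelocity E h d x ∂μHE[M]) 0 := by
  by_cases hx₀ : x₀ ∈ frontier E
  · obtain ⟨ι, γ, ε, Γ, hc, -⟩ := hP.exists_isMovingChart hx₀ d
    obtain ⟨B, ε', hε', hle, hB⟩ := hc.exists_abs_fderiv_le
    have hc' := hc.mono hε' hle
    refine ⟨{x | ‖(ι.symm (x - x₀)).1‖ < ε' ∧ |(ι.symm (x - x₀)).2| < ε'}, ?_, by simpa, ?_⟩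
    · have h1 : Continuous fun x => ι.symm (x - x₀) :=
        ι.symm.continuous.comp (continuous_id.sub continuous_const)
      exact (isOpen_lt h1.fst.norm continuous_const).inter (isOpen_lt h1.snd.abs continuous_const)
    · intro f hf hfc hfs
      exact hc'.hasDerivAt_integral hP hB hf hfc fun x hx => hfs hx
  · obtain ⟨U, hU, hxU, hdisj, hev⟩ := hP.exists_mem_translatedSet_iff hne hx₀ d
    refine ⟨U, hU, hxU, fun f hf hfc hfs => ?_⟩
    have h0 : ∀ x ∈ frontier E, f x * relativeVelocity E h d x = 0 := fun x hx => by
      have : f x = 0 := by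
        by_contra hne
        exact Set.disjoint_left.1 hdisj (hfs hne) hx
      rw [this, zero_mul]
    have hfrm : MeasurableSet (frontier E) := isClosed_frontier.measurableSet
    refine ⟨integrableOn_zero.congr_fun (fun x hx => (h0 x hx).symm) hfrm, ?_⟩
    rw [setIntegral_congr_fun hfrm h0, integral_zero]
    refine (hasDerivAt_const (0 : ℝ) (∫ x in translatedSet Et d 0, f x)).congr_of_eventuallyEq ?_
    have ht₀ := hP.pos
    filter_upwards [hev, (show ContinuousAt (fun t : ℝ => |t|) 0 by
      fun_prop).eventually_lt_const (show |(0 : ℝ)| < t₀ by simpa)] with t ht ht'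
    rw [← integral_indicator (hP.isOpen_translatedSet d ht').measurableSet,
      ← integral_indicator (hP.isOpen_translatedSet d (by simpa)).measurableSet]
    refine integral_congr_ae (Eventually.of_forall fun x => ?_)
    classical
    by_cases hx : f x = 0
    · simp [indicator_apply, hx]
    · simp only [indicator_apply, ht x (hfs hx)]

/-- The first variation of the integral of a test function. -/
theorem hasDerivAt_integral (hP : IsPerturbationFamily E h Et C t₀)
    (hne : (frontier E).Nonempty) (d : 𝔼[M + 1]) {f : 𝔼[M + 1] → ℝ} (hf : Continuous f)
    (hfc : HasCompactSupport f) :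
    IntegrableOn (fun x => f x * relativeVelocity E h d x) (frontier E) μHE[M] ∧
      HasDerivAt (fun t => ∫ x in translatedSet Et d t, f x)
        (∫ x in frontier E, f x * relativeVelocity E h d x ∂μHE[M]) 0 := by
  choose U hU hxU hloc using hP.exists_isOpen_hasDerivAt_integral hne d
  obtain ⟨s, hs⟩ := hfc.isCompact.elim_finite_subcover U hU
    fun x _ => mem_iUnion.2 ⟨x, hxU x⟩
  let e := s.equivFin
  have hcov : tsupport f ⊆ ⋃ i : Fin s.card, U (e.symm i) := by
    intro x hx
    obtain ⟨y, hy, hxy⟩ := mem_iUnion₂.1 (hs hx)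
    exact mem_iUnion.2 ⟨e ⟨y, hy⟩, by rwa [e.symm_apply_apply]⟩
  obtain ⟨ρ, hρs, hρ1, -, hρc⟩ := exists_continuous_sum_one_of_isOpen_isCompact
    (fun i => hU (e.symm i)) hfc.isCompact hcov
  have hsum : ∀ x, f x = ∑ i, ρ i x * f x := fun x => by
    by_cases hx : f x = 0
    · simp [hx]
    · have h1 : (∑ i, ⇑(ρ i)) x = 1 := hρ1 (subset_tsupport f hx)
      rw [← Finset.sum_mul, ← Finset.sum_apply x Finset.univ fun i => ⇑(ρ i), h1, one_mul]
  have hpiece := fun i => hloc (e.symm i) (fun x => ρ i x * f x) ((ρ i).continuous.mul hf)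
    (hfc.mul_left) (fun x hx => hρs i (subset_tsupport _ fun h0 => hx (by simp [h0])))
  have hpi : ∀ i, Integrable fun x => ρ i x * f x := fun i =>
    ((ρ i).continuous.mul hf).integrable_of_hasCompactSupport hfc.mul_left
  have h1 : ∀ x, f x * relativeVelocity E h d x =
      ∑ i, ρ i x * f x * relativeVelocity E h d x := fun x => by
    rw [← Finset.sum_mul, ← hsum]
  constructor
  · simp only [h1]
    exact integrable_finsetSum _ fun i _ => (hpiece i).1
  · have h2 : ∫ x in frontier E, f x * relativeVelocity E h d x ∂μHE[M] =
        ∑ i, ∫ x in frontier E, ρ i x * f x * relativeVelocity E h d x ∂μHE[M] := by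
      simp only [h1]
      exact integral_finsetSum _ fun i _ => (hpiece i).1
    have h3 : (fun t => ∫ x in translatedSet Et d t, f x) =
        fun t => ∑ i, ∫ x in translatedSet Et d t, ρ i x * f x := by
      funext t
      rw [← integral_finsetSum _ fun i _ => (hpi i).integrableOn]
      simp only [← hsum]
    rw [h2, h3]
    exact HasDerivAt.fun_sum fun i _ => (hpiece i).2

end IsPerturbationFamily

/-! ### The first variation of integrals of slowly decaying functions -/

/-- An `ε / 3` argument. Only the increments from time zero need be close, with error proportional
to `|t|`, and this is the form in which the tails are controlled. -/
theorem hasDerivAt_zero_of_approx {I : ℝ → ℝ} {D : ℝ}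
    (h : ∀ ε > 0, ∃ (J : ℝ → ℝ) (D' : ℝ), HasDerivAt J D' 0 ∧ |D' - D| ≤ ε ∧
      ∀ᶠ t in 𝓝 (0 : ℝ), |(I t - I 0) - (J t - J 0)| ≤ ε * |t|) : HasDerivAt I D 0 := by
  rw [hasDerivAt_iff_isLittleO, Asymptotics.isLittleO_iff]
  intro ε hε
  obtain ⟨J, D', hJ, hD, hev⟩ := h (ε / 3) (by positivity)
  rw [hasDerivAt_iff_isLittleO, Asymptotics.isLittleO_iff] at hJ
  filter_upwards [hev, hJ (show 0 < ε / 3 by positivity)] with t h1 h2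
  simp only [sub_zero, smul_eq_mul, Real.norm_eq_abs] at h2 ⊢
  have h3 : I t - I 0 - t * D = ((I t - I 0) - (J t - J 0)) + (J t - J 0 - t * D') +
      t * (D' - D) := by ring
  rw [h3]
  refine (abs_add_three _ _ _).trans ?_
  rw [abs_mul t]
  nlinarith [mul_le_mul_of_nonneg_left hD (abs_nonneg t)]

theorem tendsto_setIntegral_norm_ge {X : Type*} [NormedAddCommGroup X] [MeasurableSpace X]
    [OpensMeasurableSpace X] {μ : Measure X} {w : X → ℝ} (hw : Integrable w μ) (b : ℝ) :
    Tendsto (fun n : ℕ => ∫ x in {x | (n : ℝ) - b ≤ ‖x‖}, w x ∂μ) atTop (𝓝 0) := by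
  have hm : ∀ n : ℕ, MeasurableSet {x : X | (n : ℝ) - b ≤ ‖x‖} := fun n =>
    (isClosed_le continuous_const continuous_norm).measurableSet
  have h1 := tendsto_setIntegral_of_antitone (f := w) (μ := μ) hm (fun m n hmn x hx => by
    have : (m : ℝ) ≤ n := by exact_mod_cast hmn
    simp only [mem_ofPred_eq] at hx ⊢
    linarith) ⟨0, hw.integrableOn⟩
  have h2 : ⋂ n : ℕ, {x : X | (n : ℝ) - b ≤ ‖x‖} = ∅ := by
    refine eq_empty_of_forall_notMem fun x hx => ?_
    obtain ⟨n, hn⟩ := exists_nat_gt (‖x‖ + b)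
    have := mem_iInter.1 hx n
    simp only [mem_ofPred_eq] at this
    linarith
  rwa [h2, setIntegral_empty] at h1

theorem abs_setIntegral_sub_le {X : Type*} [MeasurableSpace X] {μ : Measure X} {A B : Set X}
    (hA : MeasurableSet A) (hB : MeasurableSet B) {u : X → ℝ} (hu : Integrable u μ) :
    |∫ x in A, u x ∂μ - ∫ x in B, u x ∂μ| ≤ ∫ x in {x | ¬(x ∈ A ↔ x ∈ B)}, |u x| ∂μ := by
  have hS : MeasurableSet {x | ¬(x ∈ A ↔ x ∈ B)} := by
    have : {x | ¬(x ∈ A ↔ x ∈ B)} = (A \ B) ∪ (B \ A) := by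
      ext x
      simp only [mem_ofPred_eq, mem_union, Set.mem_sdiff]
      tauto
    rw [this]
    exact (hA.diff hB).union (hB.diff hA)
  rw [← integral_indicator hA, ← integral_indicator hB, ← integral_indicator hS,
    ← integral_sub (hu.indicator hA) (hu.indicator hB)]
  refine abs_integral_le_integral_abs.trans (integral_mono_of_nonneg
    (Eventually.of_forall fun x => abs_nonneg _) (hu.abs.indicator hS)
    (Eventually.of_forall fun x => ?_))
  by_cases h1 : x ∈ A <;> by_cases h2 : x ∈ B <;> simp [h1, h2]

theorem abs_clamp_sub_le (a b : ℝ) : |max 0 (min 1 a) - max 0 (min 1 b)| ≤ |a - b| :=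
  (abs_max_sub_max_le_abs _ _ 0 |>.trans' (by rw [max_comm 0, max_comm 0])).trans
    ((abs_min_sub_min_le_max 1 a 1 b).trans (by simp))

namespace IsPerturbationFamily

variable {M : ℕ} {E : Set 𝔼[M + 1]} {h : 𝔼[M + 1] → ℝ} {Et : ℝ → Set 𝔼[M + 1]} {C t₀ : ℝ}
  {x₀ d : 𝔼[M + 1]} {β : ℝ}

/-- The two sets differ only where the boundary sweeps. A swept point of norm at least `ρ` comes
from a boundary point of norm at least `ρ - C * t₀`, so the weighted tube estimate applies to that
part of the boundary only. -/
theorem exists_integral_symmDiff_le (hP : IsPerturbationFamily E h Et C t₀)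
    (hne : (frontier E).Nonempty) (hβ : 0 ≤ β)
    (hw : IntegrableOn (fun x => (1 + ‖x‖) ^ (-β)) (frontier E) μHE[M]) :
    ∃ K : ℝ, 0 ≤ K ∧ ∀ t, |t| < t₀ → ∀ ρ,
      ∫ x in {x | ¬(x ∈ Et t ↔ x ∈ Et 0)} ∩ {x | ρ ≤ ‖x‖}, (1 + ‖x‖) ^ (-β) ≤
      K * |t| * ∫ x in {x | ρ - C * t₀ ≤ ‖x‖}, (1 + ‖x‖) ^ (-β) ∂μHE[M].restrict (frontier E) := by
  obtain ⟨K, hK, hle⟩ := hP.exists_lintegral_tube_le hβ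
  refine ⟨K, hK, fun t ht ρ => ?_⟩
  have hwpos : ∀ x : 𝔼[M + 1], 0 ≤ (1 + ‖x‖) ^ (-β) := fun x => by positivity
  have hwm : Measurable fun x : 𝔼[M + 1] => (1 + ‖x‖) ^ (-β) := by fun_prop
  have hm : MeasurableSet {x : 𝔼[M + 1] | ρ - C * t₀ ≤ ‖x‖} :=
    (isClosed_le continuous_const continuous_norm).measurableSet
  set A := {x | ρ - C * t₀ ≤ ‖x‖} ∩ frontier E with hA
  have h1 := hle |t| (abs_nonneg t) ht A inter_subset_right (hm.inter isClosed_frontier.measurableSet)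
  rw [Measure.restrict_restrict hm, ← hA]
  have hsub : {x | ¬(x ∈ Et t ↔ x ∈ Et 0)} ∩ {x | ρ ≤ ‖x‖} ⊆
      {z | ∃ x ∈ A, ∃ τ, |τ| ≤ |t| ∧ z = normalShift E h τ x} := by
    rintro z ⟨hz, hzρ⟩
    obtain ⟨x, hx, τ, hτ, rfl⟩ := hP.symmDiff_subset hne ht hz
    refine ⟨x, ⟨?_, hx⟩, τ, hτ, rfl⟩
    have h2 := hP.dist_normalShift_le τ 0 hx
    rw [show normalShift E h 0 x = x by simp [normalShift], sub_zero, dist_eq_norm] at h2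
    have h3 := norm_sub_norm_le (normalShift E h τ x) x
    have h4 : C * |τ| ≤ C * t₀ := mul_le_mul_of_nonneg_left (hτ.trans ht.le) hP.nonneg
    simp only [mem_ofPred_eq] at hzρ ⊢
    linarith
  have hwA : IntegrableOn (fun x => (1 + ‖x‖) ^ (-β)) A μHE[M] := hw.mono_set inter_subset_right
  rw [integral_eq_lintegral_of_nonneg_ae (Eventually.of_forall hwpos) hwm.aestronglyMeasurable]
  refine ENNReal.toReal_le_of_le_ofReal
    (mul_nonneg (by positivity) (setIntegral_nonneg_of_ae (Eventually.of_forall hwpos))) ?_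
  rw [ENNReal.ofReal_mul (by positivity),
    ofReal_integral_eq_lintegral_ofReal hwA (Eventually.of_forall hwpos)]
  exact (lintegral_mono_set hsub).trans h1

theorem isBounded_relativeVelocity (hP : IsPerturbationFamily E h Et C t₀) (d : 𝔼[M + 1])
    {x : 𝔼[M + 1]} (hx : x ∈ frontier E) : |relativeVelocity E h d x| ≤ C + ‖d‖ := by
  refine (abs_sub _ _).trans (add_le_add (hP.abs_le x hx) ?_)
  refine (abs_real_inner_le_norm _ _).trans ?_
  rw [hP.smooth.norm_outerNormal hx, one_mul]

end IsPerturbationFamily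

/-- In a chart the normal is the graph normal at the projected point, which depends continuously on
it. -/
theorem IsSmoothOpenSet.continuousOn_outerNormal {M : ℕ} {E : Set 𝔼[M + 1]}
    (hE : IsSmoothOpenSet E) : ContinuousOn (outerNormal E) (frontier E) := by
  intro x₀ hx₀
  obtain ⟨ι, δ, η, γ, hc, he⟩ := hE.exists_isGraphChart hx₀
  have hδ := hc.pos
  have hη : 0 < η := (abs_nonneg _).trans_lt (hc.abs_lt 0 hc.mem_ball_zero)
  have h1 : ContinuousAt (fun x => graphNormal ι γ (frameProj ι x₀ x)) x₀ := by
    refine ContinuousAt.comp (g := graphNormal ι γ) (f := frameProj ι x₀) ?_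
      (continuous_frameProj x₀).continuousAt
    have h2 : frameProj ι x₀ x₀ = 0 := by simp [frameProj]
    rw [h2]
    exact (hc.contDiffAt_graphNormal hc.mem_ball_zero).continuousAt
  refine h1.continuousWithinAt.congr_of_eventuallyEq_of_mem ?_ hx₀
  filter_upwards [self_mem_nhdsWithin, mem_nhdsWithin_of_mem_nhds
    (Metric.ball_mem_nhds x₀ (lt_min hδ hη))] with x hx hxb
  rw [Metric.mem_ball, dist_eq_norm, lt_min_iff] at hxb
  obtain ⟨hu, hux⟩ := hc.exists_eq_graphMap hE.isOpen hx hxb.1 hxb.2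
  have h3 := hc.outerNormal_graphMap hE hu
  rw [hux] at h3
  exact h3

/-! ### Removing the compact support by a cutoff at infinity -/

namespace IsPerturbationFamily

variable {M : ℕ} {E : Set 𝔼[M + 1]} {h : 𝔼[M + 1] → ℝ} {Et : ℝ → Set 𝔼[M + 1]} {C t₀ : ℝ}
  {d : 𝔼[M + 1]} {β : ℝ}

theorem continuousOn_relativeVelocity (hP : IsPerturbationFamily E h Et C t₀) (d : 𝔼[M + 1]) :
    ContinuousOn (relativeVelocity E h d) (frontier E) :=
  hP.contDiffOn.continuousOn.sub (hP.smooth.continuousOn_outerNormal.inner continuousOn_const)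

theorem integrableOn_mul_relativeVelocity (hP : IsPerturbationFamily E h Et C t₀) (d : 𝔼[M + 1])
    (hw : IntegrableOn (fun x => (1 + ‖x‖) ^ (-β)) (frontier E) μHE[M]) {f : 𝔼[M + 1] → ℝ}
    (hf : AEStronglyMeasurable f (μHE[M].restrict (frontier E))) {A : ℝ}
    (hfA : ∀ x, |f x| ≤ A * (1 + ‖x‖) ^ (-β)) :
    IntegrableOn (fun x => f x * relativeVelocity E h d x) (frontier E) μHE[M] := by
  have hfrm : MeasurableSet (frontier E) := isClosed_frontier.measurableSet
  have h1 := (hP.continuousOn_relativeVelocity d).aestronglyMeasurable (μ := μHE[M]) hfrm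
  refine (hw.const_mul (A * (C + ‖d‖))).mono' (hf.mul h1) ?_
  filter_upwards [ae_restrict_mem hfrm] with x hx
  rw [norm_mul, Real.norm_eq_abs, Real.norm_eq_abs]
  have h2 := hP.isBounded_relativeVelocity d hx
  calc |f x| * |relativeVelocity E h d x| ≤ (A * (1 + ‖x‖) ^ (-β)) * (C + ‖d‖) :=
        mul_le_mul (hfA x) h2 (abs_nonneg _) ((abs_nonneg _).trans (hfA x))
    _ = A * (C + ‖d‖) * (1 + ‖x‖) ^ (-β) := by ring

theorem integral_translatedSet (d : 𝔼[M + 1]) (t : ℝ) (u : 𝔼[M + 1] → ℝ) :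
    ∫ x in translatedSet Et d t, u x = ∫ x in Et t, u (x - t • d) := by
  have h1 := (measurePreserving_add_right volume (t • d)).setIntegral_preimage_emb
    (MeasurableEquiv.addRight (t • d)).measurableEmbedding (fun x => u (x - t • d)) (Et t)
  rw [← h1]
  simp only [add_sub_cancel_right]
  rfl

/-- The first variation of the integral of a function with integrable decay. -/
theorem hasDerivAt_integral_of_decay (hP : IsPerturbationFamily E h Et C t₀)
    (hne : (frontier E).Nonempty) (d : 𝔼[M + 1]) (hβ : (M : ℝ) + 1 < β)
    (hw : IntegrableOn (fun x => (1 + ‖x‖) ^ (-β)) (frontier E) μHE[M]) {f : 𝔼[M + 1] → ℝ}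
    (hf : Continuous f) {A : ℝ} (hfA : ∀ x, |f x| ≤ A * (1 + ‖x‖) ^ (-β))
    (hfL : ∀ x a, ‖a‖ ≤ 1 → |f (x - a) - f x| ≤ A * ‖a‖ * (1 + ‖x‖) ^ (-β)) :
    HasDerivAt (fun t => ∫ x in translatedSet Et d t, f x)
      (∫ x in frontier E, f x * relativeVelocity E h d x ∂μHE[M]) 0 := by
  have hM : (0 : ℝ) ≤ M := M.cast_nonneg
  have hβ0 : 0 ≤ β := by linarith
  have ht₀ := hP.pos
  have hC := hP.nonneg
  have hfrm : MeasurableSet (frontier E) := isClosed_frontier.measurableSet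
  set w : 𝔼[M + 1] → ℝ := fun x => (1 + ‖x‖) ^ (-β) with hwdef
  have hwpos : ∀ x, 0 < w x := fun x => by simp only [w]; positivity
  have hA0 : 0 ≤ A := by
    have := (abs_nonneg _).trans (hfA 0)
    exact nonneg_of_mul_nonneg_left this (hwpos 0)
  have hwi : Integrable w := integrable_one_add_norm (by simpa using hβ)
  have hfi : Integrable f := (hwi.const_mul A).mono' hf.aestronglyMeasurable
    (Eventually.of_forall hfA)
  obtain ⟨K, hK, hsymm⟩ := hP.exists_integral_symmDiff_le hne hβ0 hw
  -- A 1-Lipschitz cutoff, equal to 1 up to norm `R - 1` and to 0 from norm `R` on. Then `(1 - χ) f`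
  -- inherits the decay and difference bounds of `f`, with constants independent of `R`.
  let χ : ℝ → 𝔼[M + 1] → ℝ := fun R x => max 0 (min 1 (R - ‖x‖))
  have hχc : ∀ R, Continuous (χ R) := fun R => by simp only [χ]; fun_prop
  have hχ0 : ∀ R x, 0 ≤ χ R x := fun R x => le_max_left _ _
  have hχ1 : ∀ R x, χ R x ≤ 1 := fun R x => max_le zero_le_one (min_le_left _ _)
  have hχin : ∀ R x, ‖x‖ ≤ R - 1 → χ R x = 1 := fun R x hx => by
    simp only [χ]
    rw [min_eq_left (by linarith), max_eq_right zero_le_one]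
  have hχout : ∀ R x, R ≤ ‖x‖ → χ R x = 0 := fun R x hx => by
    simp only [χ]
    exact max_eq_left ((min_le_right _ _).trans (by linarith))
  have hχL : ∀ R x a, |χ R (x - a) - χ R x| ≤ ‖a‖ := fun R x a => by
    refine (abs_clamp_sub_le _ _).trans ?_
    rw [show R - ‖x - a‖ - (R - ‖x‖) = ‖x‖ - ‖x - a‖ by ring]
    refine (abs_norm_sub_norm_le _ _).trans ?_
    simp
  let g : ℝ → 𝔼[M + 1] → ℝ := fun R x => (1 - χ R x) * f x
  have hgc : ∀ R, Continuous (g R) := fun R => (continuous_const.sub (hχc R)).mul hf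
  have hgA : ∀ R x, |g R x| ≤ A * w x := fun R x => by
    simp only [g]
    rw [abs_mul, abs_of_nonneg (by linarith [hχ1 R x])]
    calc (1 - χ R x) * |f x| ≤ 1 * |f x| :=
          mul_le_mul_of_nonneg_right (by linarith [hχ0 R x]) (abs_nonneg _)
      _ ≤ A * w x := by rw [one_mul]; exact hfA x
  have hgi : ∀ R, Integrable (g R) := fun R => (hwi.const_mul A).mono'
    (hgc R).aestronglyMeasurable (Eventually.of_forall (hgA R))
  have hgin : ∀ R x, ‖x‖ ≤ R - 1 → g R x = 0 := fun R x hx => by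
    simp only [g, hχin R x hx, sub_self, zero_mul]
  have hgL : ∀ R x a, ‖a‖ ≤ 1 → |g R (x - a) - g R x| ≤ 2 * A * ‖a‖ * w x := fun R x a ha => by
    have h1 : g R (x - a) - g R x = (1 - χ R (x - a)) * (f (x - a) - f x) -
        (χ R (x - a) - χ R x) * f x := by simp only [g]; ring
    rw [h1]
    refine (abs_sub _ _).trans ?_
    rw [abs_mul, abs_mul, abs_of_nonneg (by linarith [hχ1 R (x - a)])]
    have h2 : (1 - χ R (x - a)) * |f (x - a) - f x| ≤ 1 * (A * ‖a‖ * w x) :=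
      mul_le_mul (by linarith [hχ0 R (x - a)]) (hfL x a ha) (abs_nonneg _) zero_le_one
    have h3 : |χ R (x - a) - χ R x| * |f x| ≤ ‖a‖ * (A * w x) :=
      mul_le_mul (hχL R x a) (hfA x) (abs_nonneg _) (norm_nonneg _)
    linarith
  set c := (1 + 1 : ℝ) ^ β with hcdef
  have hc0 : 0 ≤ c := by positivity
  -- the two tails
  let e₁ : ℕ → ℝ := fun n => ∫ x in {x | (n : ℝ) - (2 + C * t₀) ≤ ‖x‖}, w x
    ∂μHE[M].restrict (frontier E)
  let e₂ : ℕ → ℝ := fun n => ∫ x in {x | (n : ℝ) - 2 ≤ ‖x‖}, w x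
  have he₁ : Tendsto e₁ atTop (𝓝 0) := tendsto_setIntegral_norm_ge hw _
  have he₂ : Tendsto e₂ atTop (𝓝 0) := tendsto_setIntegral_norm_ge hwi _
  have hmrho : ∀ ρ : ℝ, MeasurableSet {x : 𝔼[M + 1] | ρ ≤ ‖x‖} := fun ρ =>
    (isClosed_le continuous_const continuous_norm).measurableSet
  have hopen : ∀ t, |t| < t₀ → MeasurableSet (Et t) := fun t ht =>
    (hP.perturbation t ht).isSmoothOpenSet.isOpen.measurableSet
  have hsmall : ∀ᶠ t in 𝓝 (0 : ℝ), |t| < t₀ ∧ ‖t • d‖ < 1 :=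
    ((show ContinuousAt (fun t : ℝ => |t|) 0 by fun_prop).eventually_lt_const (by simpa)).and
      ((show ContinuousAt (fun t : ℝ => ‖t • d‖) 0 by fun_prop).eventually_lt_const (by simp))
  have htail : ∀ n : ℕ, ∀ᶠ t in 𝓝 (0 : ℝ), |(∫ x in translatedSet Et d t, g n x) -
      ∫ x in translatedSet Et d 0, g n x| ≤ (A * c * K * e₁ n + 2 * A * ‖d‖ * e₂ n) * |t| := by
    intro n
    filter_upwards [hsmall] with t ht
    have h00 : |(0 : ℝ)| < t₀ := by simpa
    rw [integral_translatedSet, integral_translatedSet, zero_smul]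
    simp only [sub_zero]
    have hgti : Integrable fun x => g n (x - t • d) := (hgi n).comp_sub_right (t • d)
    -- The change of the set is separated from the translation of the integrand. The first is
    -- controlled by the swept volume, the second by the difference bound on `g n`; both are `|t|`
    -- times the tail of a convergent integral.
    have hsplit : (∫ x in Et t, g n (x - t • d)) - ∫ x in Et 0, g n x =
        ((∫ x in Et t, g n (x - t • d)) - ∫ x in Et 0, g n (x - t • d)) +
        ∫ x in Et 0, (g n (x - t • d) - g n x) := by
      rw [integral_sub hgti.integrableOn (hgi n).integrableOn]
      ring
    rw [hsplit]
    refine (abs_add_le _ _).trans ?_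
    rw [add_mul]
    refine add_le_add ?_ ?_
    · refine (abs_setIntegral_sub_le (hopen t ht.1) (hopen 0 h00) hgti).trans ?_
      have hzero : ∀ x, x ∉ {x : 𝔼[M + 1] | (n : ℝ) - 2 ≤ ‖x‖} → |g n (x - t • d)| = 0 := by
        intro x hx
        have hx' : ‖x‖ < n - 2 := not_le.1 hx
        rw [hgin, abs_zero]
        have := norm_sub_le x (t • d)
        linarith [ht.2]
      have hS : MeasurableSet {x | ¬(x ∈ Et t ↔ x ∈ Et 0)} := by
        have : {x | ¬(x ∈ Et t ↔ x ∈ Et 0)} = (Et t \ Et 0) ∪ (Et 0 \ Et t) := by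
          ext x
          simp only [mem_ofPred_eq, mem_union, Set.mem_sdiff]
          tauto
        rw [this]
        exact ((hopen t ht.1).diff (hopen 0 h00)).union ((hopen 0 h00).diff (hopen t ht.1))
      rw [setIntegral_eq_of_subset_of_forall_sdiff_eq_zero hS
        (inter_subset_left (t := {x : 𝔼[M + 1] | (n : ℝ) - 2 ≤ ‖x‖}))
        (fun x hx => hzero x fun hx2 => hx.2 ⟨hx.1, hx2⟩)]
      calc ∫ x in {x | ¬(x ∈ Et t ↔ x ∈ Et 0)} ∩ {x | (n : ℝ) - 2 ≤ ‖x‖}, |g n (x - t • d)|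
          ≤ ∫ x in {x | ¬(x ∈ Et t ↔ x ∈ Et 0)} ∩ {x | (n : ℝ) - 2 ≤ ‖x‖}, A * c * w x := by
            refine integral_mono hgti.abs.integrableOn (hwi.const_mul _).integrableOn fun x => ?_
            refine (hgA n _).trans ?_
            rw [mul_assoc]
            refine mul_le_mul_of_nonneg_left (one_add_norm_rpow_neg_le hβ0 zero_le_one ?_) hA0
            rw [sub_sub_cancel_left, norm_neg]
            exact ht.2.le
        _ = A * c * ∫ x in {x | ¬(x ∈ Et t ↔ x ∈ Et 0)} ∩ {x | (n : ℝ) - 2 ≤ ‖x‖}, w x :=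
            integral_const_mul _ _
        _ ≤ A * c * (K * |t| * e₁ n) := by
            refine mul_le_mul_of_nonneg_left ?_ (by positivity)
            have := hsymm t ht.1 ((n : ℝ) - 2)
            rw [sub_sub] at this
            exact this
        _ = A * c * K * e₁ n * |t| := by ring
    · have hbd : ∀ x, |g n (x - t • d) - g n x| ≤
          {x : 𝔼[M + 1] | (n : ℝ) - 2 ≤ ‖x‖}.indicator (fun x => 2 * A * ‖t • d‖ * w x) x := by
        intro x
        by_cases hx : x ∈ {x : 𝔼[M + 1] | (n : ℝ) - 2 ≤ ‖x‖}
        · rw [indicator_of_mem hx]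
          exact hgL n x _ ht.2.le
        · rw [indicator_of_notMem hx]
          have hx' : ‖x‖ < n - 2 := not_le.1 hx
          rw [hgin n x (by linarith), hgin n (x - t • d) (by
            have := norm_sub_le x (t • d)
            linarith [ht.2]), sub_zero, abs_zero]
      have hbi : Integrable ({x : 𝔼[M + 1] | (n : ℝ) - 2 ≤ ‖x‖}.indicator
          (fun x => 2 * A * ‖t • d‖ * w x)) := (hwi.const_mul _).indicator (hmrho _)
      calc |∫ x in Et 0, (g n (x - t • d) - g n x)|
          ≤ ∫ x in Et 0, |g n (x - t • d) - g n x| := abs_integral_le_integral_abs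
        _ ≤ ∫ x, |g n (x - t • d) - g n x| := setIntegral_le_integral
            (hgti.sub (hgi n)).abs (Eventually.of_forall fun x => abs_nonneg _)
        _ ≤ ∫ x, {x : 𝔼[M + 1] | (n : ℝ) - 2 ≤ ‖x‖}.indicator
            (fun x => 2 * A * ‖t • d‖ * w x) x := integral_mono (hgti.sub (hgi n)).abs hbi hbd
        _ = 2 * A * ‖t • d‖ * e₂ n := by
            rw [integral_indicator (hmrho _), integral_const_mul]
        _ = 2 * A * ‖d‖ * e₂ n * |t| := by
            rw [norm_smul, Real.norm_eq_abs]
            ring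
  have hfθ : IntegrableOn (fun x => f x * relativeVelocity E h d x) (frontier E) μHE[M] :=
    hP.integrableOn_mul_relativeVelocity d hw hf.aestronglyMeasurable hfA
  have hχf : ∀ n : ℕ, HasCompactSupport fun x => χ n x * f x := fun n => by
    refine HasCompactSupport.mul_right
      (HasCompactSupport.intro (isCompact_closedBall (0 : 𝔼[M + 1]) n) fun x hx => ?_)
    refine hχout n x ?_
    rw [mem_closedBall_zero_iff, not_le] at hx
    exact hx.le
  have hmain := fun n : ℕ => hP.hasDerivAt_integral hne d (f := fun x => χ n x * f x)
    ((hχc n).mul hf) (hχf n)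
  have hDdiff : ∀ n : ℕ, |∫ x in frontier E, χ n x * f x * relativeVelocity E h d x ∂μHE[M] -
      ∫ x in frontier E, f x * relativeVelocity E h d x ∂μHE[M]| ≤ A * (C + ‖d‖) * e₁ n := by
    intro n
    rw [← integral_sub (hmain n).1 hfθ]
    refine abs_integral_le_integral_abs.trans ?_
    have hm := hmrho ((n : ℝ) - (2 + C * t₀))
    have hbi : Integrable ({x : 𝔼[M + 1] | (n : ℝ) - (2 + C * t₀) ≤ ‖x‖}.indicator
        (fun x => A * (C + ‖d‖) * w x)) (μHE[M].restrict (frontier E)) :=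
      (hw.const_mul _).indicator hm
    calc _ ≤ ∫ x in frontier E, {x : 𝔼[M + 1] | (n : ℝ) - (2 + C * t₀) ≤ ‖x‖}.indicator
            (fun x => A * (C + ‖d‖) * w x) x ∂μHE[M] := by
          refine integral_mono_ae ((hmain n).1.sub hfθ).abs hbi ?_
          filter_upwards [ae_restrict_mem hfrm] with x hx
          have h1 : χ n x * f x * relativeVelocity E h d x - f x * relativeVelocity E h d x =
              -(g n x * relativeVelocity E h d x) := by simp only [g]; ring
          rw [h1, abs_neg, abs_mul]
          by_cases hxn : x ∈ {x : 𝔼[M + 1] | (n : ℝ) - (2 + C * t₀) ≤ ‖x‖}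
          · rw [indicator_of_mem hxn]
            calc |g n x| * |relativeVelocity E h d x| ≤ (A * w x) * (C + ‖d‖) :=
                  mul_le_mul (hgA n x) (hP.isBounded_relativeVelocity d hx) (abs_nonneg _)
                    ((abs_nonneg _).trans (hgA n x))
              _ = A * (C + ‖d‖) * w x := by ring
          · rw [indicator_of_notMem hxn]
            have hx' : ‖x‖ < n - (2 + C * t₀) := not_le.1 hxn
            rw [hgin n x (by nlinarith), abs_zero, zero_mul]
      _ = A * (C + ‖d‖) * e₁ n := by
          rw [integral_indicator hm, integral_const_mul]
  refine hasDerivAt_zero_of_approx fun ε hε => ?_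
  have hlim : Tendsto (fun n => (A * c * K * e₁ n + 2 * A * ‖d‖ * e₂ n)) atTop (𝓝 0) := by
    have := (he₁.const_mul (A * c * K)).add (he₂.const_mul (2 * A * ‖d‖))
    simpa using this
  have hlim' : Tendsto (fun n => A * (C + ‖d‖) * e₁ n) atTop (𝓝 0) := by
    simpa using he₁.const_mul (A * (C + ‖d‖))
  obtain ⟨n, hn1, hn2⟩ := ((hlim.eventually (gt_mem_nhds hε)).and
    (hlim'.eventually (gt_mem_nhds hε))).exists
  refine ⟨_, _, (hmain n).2, (hDdiff n).trans hn2.le, ?_⟩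
  filter_upwards [htail n] with t ht
  have hdec : ∀ t, ∫ x in translatedSet Et d t, f x =
      (∫ x in translatedSet Et d t, χ n x * f x) + ∫ x in translatedSet Et d t, g n x := fun t => by
    have h1 : Integrable fun x => χ n x * f x :=
      ((hχc n).mul hf).integrable_of_hasCompactSupport (hχf n)
    rw [← integral_add h1.integrableOn (hgi n).integrableOn]
    refine integral_congr_ae (Eventually.of_forall fun x => ?_)
    simp only [g]
    ring
  rw [hdec t, hdec 0]
  refine le_trans (le_of_eq ?_) (ht.trans (mul_le_mul_of_nonneg_right hn1.le (abs_nonneg t)))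
  congr 1
  ring

end IsPerturbationFamily

/-! ### The kernel -/

theorem abs_rpow_neg_sub_le {β ρ a b : ℝ} (hβ : 0 ≤ β) (hρ : 0 < ρ) (ha : ρ ≤ a) (hb : ρ ≤ b) :
    |a ^ (-β) - b ^ (-β)| ≤ β * ρ ^ (-β - 1) * |a - b| := by
  have h1 : ∀ x ∈ Ici ρ, HasDerivWithinAt (fun x : ℝ => x ^ (-β)) (-β * x ^ (-β - 1)) (Ici ρ) x :=
    fun x hx => (Real.hasDerivAt_rpow_const (Or.inl (hρ.trans_le hx).ne')).hasDerivWithinAt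
  have h2 : ∀ x ∈ Ici ρ, ‖-β * x ^ (-β - 1)‖ ≤ β * ρ ^ (-β - 1) := fun x hx => by
    have hx0 : 0 < x := hρ.trans_le hx
    rw [norm_mul, norm_neg, Real.norm_of_nonneg hβ, Real.norm_of_nonneg (by positivity)]
    exact mul_le_mul_of_nonneg_left
      (Real.rpow_le_rpow_of_nonpos hρ hx (by linarith)) hβ
  exact (convex_Ici ρ).norm_image_sub_le_of_norm_hasDerivWithin_le h1 h2 hb ha

/-- The regular part of the kernel `‖z‖ ^ (-β)`. -/
noncomputable def farKernel {X : Type*} [NormedAddCommGroup X] (β r : ℝ) (z : X) : ℝ :=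
  (max ‖z‖ r) ^ (-β)

/-- The singular part of the kernel `‖z‖ ^ (-β)`. -/
noncomputable def nearKernel {X : Type*} [NormedAddCommGroup X] (β r : ℝ) (z : X) : ℝ :=
  max 0 (‖z‖ ^ (-β) - r ^ (-β))

section Kernel

variable {X : Type*} [NormedAddCommGroup X] {β r : ℝ}

theorem nearKernel_add_farKernel (hβ : 0 ≤ β) (hr : 0 < r) {z : X} (hz : z ≠ 0) :
    nearKernel β r z + farKernel β r z = ‖z‖ ^ (-β) := by
  have hz' := norm_pos_iff.2 hz
  rcases le_total ‖z‖ r with h | h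
  · have := Real.rpow_le_rpow_of_nonpos hz' h (neg_nonpos.2 hβ)
    rw [nearKernel, farKernel, max_eq_right h, max_eq_right (by linarith)]
    ring
  · have := Real.rpow_le_rpow_of_nonpos hr h (neg_nonpos.2 hβ)
    rw [nearKernel, farKernel, max_eq_left h, max_eq_left (by linarith)]
    ring

theorem nearKernel_nonneg (β r : ℝ) (z : X) : 0 ≤ nearKernel β r z := le_max_left _ _

theorem nearKernel_le_norm_rpow (hr : 0 < r) (z : X) : nearKernel β r z ≤ ‖z‖ ^ (-β) := by
  have h1 : 0 ≤ r ^ (-β) := by positivity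
  exact max_le (by positivity) (by linarith)

theorem nearKernel_le (hβ : 0 ≤ β) (hr : 0 < r) {ρ : ℝ} (hρ : 0 < ρ) {z : X} (hz : ρ ≤ ‖z‖) :
    nearKernel β r z ≤ ρ ^ (-β) :=
  (nearKernel_le_norm_rpow hr z).trans (Real.rpow_le_rpow_of_nonpos hρ hz (neg_nonpos.2 hβ))

theorem nearKernel_eq_zero (hβ : 0 ≤ β) (hr : 0 < r) {z : X} (hz : r ≤ ‖z‖) :
    nearKernel β r z = 0 := by
  have := Real.rpow_le_rpow_of_nonpos hr hz (neg_nonpos.2 hβ)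
  exact max_eq_left (by linarith)

theorem nearKernel_neg (β r : ℝ) (z : X) : nearKernel β r (-z) = nearKernel β r z := by
  rw [nearKernel, nearKernel, norm_neg]

theorem abs_nearKernel_sub_le (hβ : 0 ≤ β) {ρ : ℝ} (hρ : 0 < ρ) {z z' : X} (hz : ρ ≤ ‖z‖)
    (hz' : ρ ≤ ‖z'‖) :
    |nearKernel β r z - nearKernel β r z'| ≤ β * ρ ^ (-β - 1) * |‖z‖ - ‖z'‖| := by
  refine le_trans ?_ (abs_rpow_neg_sub_le hβ hρ hz hz')
  rw [nearKernel, nearKernel, max_comm 0, max_comm 0]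
  refine (abs_max_sub_max_le_abs _ _ 0).trans (le_of_eq ?_)
  congr 1
  ring

theorem continuousAt_nearKernel (β r : ℝ) {z : X} (hz : z ≠ 0) :
    ContinuousAt (nearKernel β r) z := by
  have h1 : ContinuousAt (fun z : X => ‖z‖ ^ (-β)) z :=
    continuousAt_id.norm.rpow_const (Or.inl (norm_ne_zero_iff.2 hz))
  exact continuousAt_const.max (h1.sub continuousAt_const)

theorem measurable_nearKernel [MeasurableSpace X] [OpensMeasurableSpace X] (β r : ℝ) :
    Measurable (nearKernel β r : X → ℝ) := by
  unfold nearKernel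
  fun_prop

theorem continuous_farKernel (β : ℝ) (hr : 0 < r) : Continuous (farKernel β r : X → ℝ) := by
  unfold farKernel
  exact (continuous_norm.max continuous_const).rpow_const fun z =>
    Or.inl (hr.trans_le (le_max_right _ _)).ne'

theorem farKernel_nonneg (β : ℝ) (hr : 0 < r) (z : X) : 0 ≤ farKernel β r z := by
  unfold farKernel
  have := hr.trans_le (le_max_right ‖z‖ r)
  positivity

/-- Decay of the regular part of the kernel and of its differences. -/
theorem exists_farKernel_le (hβ : 0 ≤ β) (hr : 0 < r) (p : X) :
    ∃ A : ℝ, (∀ x, |farKernel β r (x - p)| ≤ A * (1 + ‖x‖) ^ (-β)) ∧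
      ∀ x a, ‖a‖ ≤ 1 → |farKernel β r (x - a - p) - farKernel β r (x - p)| ≤
        A * ‖a‖ * (1 + ‖x‖) ^ (-β) := by
  -- Chosen so that `max ‖x' - p‖ r ≥ (1 + ‖x‖) / L` for every `x'` within distance one of `x`,
  -- which covers the translated arguments too.
  set L := (2 + ‖p‖) / r + 1 with hL
  have hL1 : 1 ≤ L := by
    have : 0 ≤ (2 + ‖p‖) / r := by positivity
    linarith
  have hLm : ∀ x x' : X, ‖x - x'‖ ≤ 1 → (1 + ‖x‖) / L ≤ max ‖x' - p‖ r := by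
    intro x x' hxx
    rw [div_le_iff₀ (by linarith)]
    have h1 : ‖x‖ ≤ 1 + ‖p‖ + ‖x' - p‖ := by
      have h2 : x = (x - x') + (x' - p) + p := by abel
      have h3 := norm_add₃_le (a := x - x') (b := x' - p) (c := p)
      rw [← h2] at h3
      linarith
    have h4 := le_max_left ‖x' - p‖ r
    have h5 : (2 + ‖p‖) ≤ max ‖x' - p‖ r * ((2 + ‖p‖) / r) := by
      have h6 : (2 + ‖p‖) = r * ((2 + ‖p‖) / r) := by field_simp
      calc (2 + ‖p‖) = r * ((2 + ‖p‖) / r) := h6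
        _ ≤ _ := mul_le_mul_of_nonneg_right (le_max_right _ _) (by positivity)
    rw [hL, mul_add, mul_one]
    linarith
  -- One constant dominating both `L ^ β`, for the size, and `β * L ^ (β + 1)`, for the differences.
  refine ⟨(β + 1) * L ^ (β + 1), fun x => ?_, fun x a ha => ?_⟩
  · rw [abs_of_nonneg (farKernel_nonneg β hr _), farKernel]
    have h1 : (max ‖x - p‖ r) ^ (-β) ≤ ((1 + ‖x‖) / L) ^ (-β) :=
      Real.rpow_le_rpow_of_nonpos (by positivity) (hLm x x (by simp)) (by linarith)
    have h2 : ((1 + ‖x‖) / L) ^ (-β) = L ^ β * (1 + ‖x‖) ^ (-β) := by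
      rw [Real.div_rpow (by positivity) (by positivity), Real.rpow_neg (by positivity : 0 ≤ L),
        div_inv_eq_mul, mul_comm]
    rw [h2] at h1
    refine h1.trans (mul_le_mul_of_nonneg_right ?_ (by positivity))
    have h3 : L ^ β ≤ L ^ (β + 1) := Real.rpow_le_rpow_of_exponent_le hL1 (by linarith)
    have h4 : 0 ≤ L ^ (β + 1) := by positivity
    nlinarith
  · have h1 := abs_rpow_neg_sub_le hβ (show 0 < (1 + ‖x‖) / L by positivity)
      (hLm x (x - a) (by simpa using ha)) (hLm x x (by simp))
    have h2 : |max ‖x - a - p‖ r - max ‖x - p‖ r| ≤ ‖a‖ := by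
      refine (abs_max_sub_max_le_abs _ _ r).trans ((abs_norm_sub_norm_le _ _).trans ?_)
      rw [show x - a - p - (x - p) = -a by abel, norm_neg]
    have h3 : ((1 + ‖x‖) / L) ^ (-β - 1) ≤ L ^ (β + 1) * (1 + ‖x‖) ^ (-β) := by
      rw [show -β - 1 = -(β + 1) by ring, Real.div_rpow (by positivity) (by positivity),
        Real.rpow_neg (by positivity : 0 ≤ L), div_inv_eq_mul, mul_comm]
      refine mul_le_mul_of_nonneg_left ?_ (by positivity)
      exact Real.rpow_le_rpow_of_exponent_le (by linarith [norm_nonneg x]) (by linarith)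
    have h4 : 0 ≤ L ^ (β + 1) * (1 + ‖x‖) ^ (-β) := by positivity
    calc |farKernel β r (x - a - p) - farKernel β r (x - p)|
        ≤ β * ((1 + ‖x‖) / L) ^ (-β - 1) * |max ‖x - a - p‖ r - max ‖x - p‖ r| := h1
      _ ≤ β * (L ^ (β + 1) * (1 + ‖x‖) ^ (-β)) * ‖a‖ := by gcongr
      _ ≤ (β + 1) * (L ^ (β + 1) * (1 + ‖x‖) ^ (-β)) * ‖a‖ := by
          gcongr
          linarith
      _ = (β + 1) * L ^ (β + 1) * ‖a‖ * (1 + ‖x‖) ^ (-β) := by ring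

end Kernel

/-- Local integrability of powers of the norm. -/
theorem integrableOn_norm_rpow_neg {M : ℕ} {α r : ℝ} (hα : α < M) :
    IntegrableOn (fun v : 𝔼[M] => ‖v‖ ^ (-α)) (Metric.ball 0 r) := by
  have hm : Measurable fun v : 𝔼[M] => ‖v‖ ^ (-α) := by fun_prop
  -- For `M = 0` the space is a single point and only a finite value is needed.
  rcases Nat.eq_zero_or_pos M with rfl | hM
  · refine IntegrableOn.of_bound measure_ball_lt_top hm.aestronglyMeasurable (|(0 : ℝ) ^ (-α)|)
      (Eventually.of_forall fun v => ?_)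
    rw [Subsingleton.elim v 0, norm_zero, Real.norm_eq_abs]
  · have h1 : LocallyIntegrable (fun v : 𝔼[M] => ‖v‖ ^ (-α)) :=
      locallyIntegrable_of_norm_le_rpow (C := 1) (α := α) (by simpa using Nat.succ_le_of_lt hM) (by simpa using hα)
        (Eventually.of_forall fun v => by
          rw [Real.norm_of_nonneg (by positivity), one_mul]) hm.aestronglyMeasurable
    exact (h1.integrableOn_isCompact (isCompact_closedBall 0 r)).mono_set Metric.ball_subset_closedBall

/-! ### Charts centered at the base point -/

/-- A moving chart at `p`, for the translations which keep the base point fixed, with estimates. -/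
structure IsCenteredChart {M : ℕ} (E : Set 𝔼[M + 1]) (h : 𝔼[M + 1] → ℝ) (Et : ℝ → Set 𝔼[M + 1])
    (p : 𝔼[M + 1]) (ι : (𝔼[M] × ℝ) ≃L[ℝ] 𝔼[M + 1]) (γ : 𝔼[M] → ℝ) (ε : ℝ) (Γ : ℝ × 𝔼[M] → ℝ)
    (K : ℝ) : Prop where
  moving : IsMovingChart E h Et (h p • outerNormal E p) p ι γ ε Γ
  normal : ι (0, 1) = outerNormal E p
  nonneg : 0 ≤ K
  abs_le : ∀ t v, |t| < ε → ‖v‖ < ε → |Γ (t, v)| ≤ K * ‖v‖ ∧ |Γ (t, v) + Γ (t, -v)| ≤ K * ‖v‖ ^ 2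
  abs_fderiv_le : ∀ t v, |t| < ε → ‖v‖ < ε → |fderiv ℝ Γ (t, v) (1, 0)| ≤ K * ‖v‖ ∧
    |fderiv ℝ Γ (t, v) (1, 0) + fderiv ℝ Γ (t, -v) (1, 0)| ≤ K * ‖v‖ ^ 2
  norm_fderiv_le : ∀ v, ‖v‖ < ε → ‖fderiv ℝ γ v‖ ≤ K * ‖v‖
  abs_graph_le : ∀ v, ‖v‖ < ε → |γ v| ≤ K * ‖v‖ ^ 2

/-- Translating by `t h(p) ν(p)` gives `Γ(t, 0) = 0` for all small `t`. Hence `Γ` and its time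
derivative both vanish on `v = 0`, and `ContDiffAt.exists_odd_bounds` applies to each. The bounds on
`γ` come from its vanishing gradient at the origin. -/
theorem IsPerturbationFamily.exists_isCenteredChart {M : ℕ} {E : Set 𝔼[M + 1]} {h : 𝔼[M + 1] → ℝ}
    {Et : ℝ → Set 𝔼[M + 1]} {C t₀ : ℝ} (hP : IsPerturbationFamily E h Et C t₀) {p : 𝔼[M + 1]}
    (hp : p ∈ frontier E) : ∃ ι γ ε Γ K, IsCenteredChart E h Et p ι γ ε Γ K := by
  obtain ⟨ι, γ, ε₀, Γ, hc, he, -, hΓ0⟩ :=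
    hP.exists_isMovingChart hp (h p • outerNormal E p)
  have hε₀ := hc.pos
  have hΓ0 := hΓ0 rfl
  have hz : |(0 : ℝ)| < ε₀ := by simpa
  have hz' : ‖(0 : 𝔼[M])‖ < ε₀ := by simpa
  obtain ⟨K₁, hK₁, ε₁, hε₁, hb₁⟩ := ((hc.contDiffAt 0 0 hz hz').of_le
    (show (2 : WithTop ℕ∞) ≤ (4 : ℕ) by norm_cast)).exists_odd_bounds hΓ0
  have hΓ0' : ∀ᶠ t in 𝓝 (0 : ℝ), fderiv ℝ Γ (t, 0) (1, 0) = 0 := by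
    have h1 : ∀ᶠ t in 𝓝 (0 : ℝ), |t| < ε₀ :=
      (show ContinuousAt (fun t : ℝ => |t|) 0 by fun_prop).eventually_lt_const hz
    filter_upwards [eventually_eventually_nhds.2 hΓ0, h1] with t h2 h3
    exact (hc.hasDerivAt_fderiv h3 hz').unique
      ((hasDerivAt_const t (0 : ℝ)).congr_of_eventuallyEq h2)
  obtain ⟨K₂, hK₂, ε₂, hε₂, hb₂⟩ := (hc.contDiffAt_fderiv hz hz').exists_odd_bounds hΓ0'
  obtain ⟨η, hη, hch⟩ := hc.chart
  have hD0 := hch.fderiv_zero hP.smooth he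
  obtain ⟨K₃, U, hU, hL⟩ := ((hch.contDiffAt hch.mem_ball_zero).fderiv_right (m := 1)
    (by norm_num)).exists_lipschitzOnWith
  obtain ⟨ε₃, hε₃, hb₃⟩ := Metric.mem_nhds_iff.1 hU
  set ε := min ε₀ (min ε₁ (min ε₂ ε₃)) with hεdef
  have hε : 0 < ε := by positivity
  have le0 : ε ≤ ε₀ := min_le_left _ _
  have le1 : ε ≤ ε₁ := (min_le_right _ _).trans (min_le_left _ _)
  have le2 : ε ≤ ε₂ := (min_le_right _ _).trans ((min_le_right _ _).trans (min_le_left _ _))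
  have le3 : ε ≤ ε₃ := (min_le_right _ _).trans ((min_le_right _ _).trans (min_le_right _ _))
  set K := max K₁ (max K₂ K₃)
  have leK1 : K₁ ≤ K := le_max_left _ _
  have leK2 : K₂ ≤ K := (le_max_left _ _).trans (le_max_right _ _)
  have leK3 : K₃ ≤ K := (le_max_right _ _).trans (le_max_right _ _)
  have hfd : ∀ v, ‖v‖ < ε → ‖fderiv ℝ γ v‖ ≤ K * ‖v‖ := fun v hv => by
    have h1 := hL.dist_le_mul v (hb₃ (by simpa using hv.trans_le le3)) 0
      (hb₃ (Metric.mem_ball_self hε₃))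
    rw [hD0, dist_zero_right, dist_zero_right] at h1
    exact h1.trans (mul_le_mul_of_nonneg_right leK3 (norm_nonneg _))
  refine ⟨ι, γ, ε, Γ, K, hc.mono hε le0, he, hK₁.trans leK1, fun t v ht hv => ?_,
    fun t v ht hv => ?_, hfd, fun v hv => ?_⟩
  · obtain ⟨h1, h2⟩ := hb₁ t v (ht.trans_le le1) (hv.trans_le le1)
    exact ⟨h1.trans (by gcongr), h2.trans (by gcongr)⟩
  · obtain ⟨h1, h2⟩ := hb₂ t v (ht.trans_le le2) (hv.trans_le le2)
    exact ⟨h1.trans (by gcongr), h2.trans (by gcongr)⟩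
  · have h1 : ∀ u ∈ Metric.closedBall (0 : 𝔼[M]) ‖v‖, HasFDerivWithinAt γ (fderiv ℝ γ u)
        (Metric.closedBall (0 : 𝔼[M]) ‖v‖) u := fun u hu => by
      have hu' : u ∈ Metric.ball (0 : 𝔼[M]) ε₀ := by
        rw [mem_closedBall_zero_iff] at hu
        rw [mem_ball_zero_iff]
        linarith
      exact ((hch.contDiffAt hu').differentiableAt (by simp)).hasFDerivAt.hasFDerivWithinAt
    have h2 : ∀ u ∈ Metric.closedBall (0 : 𝔼[M]) ‖v‖, ‖fderiv ℝ γ u‖ ≤ K * ‖v‖ := fun u hu => by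
      rw [mem_closedBall_zero_iff] at hu
      exact (hfd u (hu.trans_lt hv)).trans
        (mul_le_mul_of_nonneg_left hu (hK₁.trans leK1))
    have h3 := (convex_closedBall (0 : 𝔼[M]) ‖v‖).norm_image_sub_le_of_norm_hasFDerivWithin_le h1 h2
      (Metric.mem_closedBall_self (norm_nonneg v)) (y := v) (by simp)
    rw [hch.map_zero, sub_zero, sub_zero, Real.norm_eq_abs] at h3
    rw [sq, ← mul_assoc]
    exact h3

/-- The function which is `1` on `F` and `-1` off `F`. -/
noncomputable def signFunction {X : Type*} (F : Set X) (x : X) : ℝ :=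
  F.indicator (fun _ => (1 : ℝ)) x - Fᶜ.indicator (fun _ => (1 : ℝ)) x

theorem signFunction_of_mem {X : Type*} {F : Set X} {x : X} (hx : x ∈ F) : signFunction F x = 1 := by
  simp [signFunction, hx]

theorem signFunction_of_notMem {X : Type*} {F : Set X} {x : X} (hx : x ∉ F) :
    signFunction F x = -1 := by
  simp [signFunction, hx]

theorem abs_signFunction {X : Type*} (F : Set X) (x : X) : |signFunction F x| = 1 := by
  by_cases hx : x ∈ F
  · rw [signFunction_of_mem hx, abs_one]
  · rw [signFunction_of_notMem hx, abs_neg, abs_one]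

theorem measurable_signFunction {X : Type*} [MeasurableSpace X] {F : Set X} (hF : MeasurableSet F) :
    Measurable (signFunction F) :=
  (measurable_const.indicator hF).sub (measurable_const.indicator hF.compl)

/-- The even part of the sign function of `F`, with respect to the point `p`. -/
noncomputable def evenSign {X : Type*} [AddCommGroup X] (F : Set X) (p z : X) : ℝ :=
  (signFunction F (p + z) + signFunction F (p - z)) / 2

theorem measurable_evenSign {M : ℕ} {F : Set 𝔼[M + 1]} (hF : MeasurableSet F) (p : 𝔼[M + 1]) :
    Measurable (evenSign F p) := by
  have h1 := (measurable_signFunction hF).comp (measurable_const_add p)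
  have h2 := (measurable_signFunction hF).comp (measurable_const_sub p)
  exact (h1.add h2).div_const 2

/-- An identity for `x > 0`. At `x = 0` only the inequality survives, since `0 ^ 0 = 1` when `β =
2`. -/
theorem sq_mul_rpow_neg_le {x : ℝ} (hx : 0 ≤ x) (β : ℝ) : x ^ 2 * x ^ (-β) ≤ x ^ (-(β - 2)) := by
  rcases hx.eq_or_lt with rfl | hx
  · simp only [ne_eq, OfNat.ofNat_ne_zero, not_false_eq_true, zero_pow, zero_mul]
    exact Real.rpow_nonneg le_rfl _
  · rw [← Real.rpow_natCast, ← Real.rpow_add hx]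
    exact le_of_eq (by congr 1; push_cast; ring)

/-- If an even weight is integrable against the even part of `F`, its principal value exists. -/
theorem tendsto_integral_signFunction_mul {M : ℕ} {F : Set 𝔼[M + 1]} (hF : MeasurableSet F)
    {p : 𝔼[M + 1]} {k : 𝔼[M + 1] → ℝ} (hk0 : k 0 = 0) (hkn : ∀ z, k (-z) = k z)
    (hki : ∀ ε > 0, IntegrableOn k {z | ε < ‖z‖}) (hS : Integrable fun z => evenSign F p z * k z) :
    Tendsto (fun ε : ℝ => ∫ z in {z | ε < ‖z‖}, signFunction F (p + z) * k z) (𝓝[>] 0)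
      (𝓝 (∫ z, evenSign F p z * k z)) := by
  have hm : ∀ ε : ℝ, MeasurableSet {z : 𝔼[M + 1] | ε < ‖z‖} := fun ε =>
    (isOpen_lt continuous_const continuous_norm).measurableSet
  have hi : ∀ ε > 0, IntegrableOn (fun z => signFunction F (p + z) * k z) {z | ε < ‖z‖} :=
    fun ε hε => (hki ε hε).bdd_mul (c := 1)
      ((measurable_signFunction hF).comp (measurable_const_add p)).aestronglyMeasurable
      (Eventually.of_forall fun z => by rw [Real.norm_eq_abs, abs_signFunction])
  have hi' : ∀ ε > 0, IntegrableOn (fun z => signFunction F (p - z) * k z) {z | ε < ‖z‖} :=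
    fun ε hε => (hki ε hε).bdd_mul (c := 1)
      ((measurable_signFunction hF).comp (measurable_const_sub p)).aestronglyMeasurable
      (Eventually.of_forall fun z => by rw [Real.norm_eq_abs, abs_signFunction])
  -- The reflection `z ↦ -z` preserves both the truncated domain and the weight, so the sign
  -- function may be replaced by its even part before the limit is taken.
  have hflip : ∀ ε : ℝ, ∫ z in {z | ε < ‖z‖}, signFunction F (p - z) * k z =
      ∫ z in {z | ε < ‖z‖}, signFunction F (p + z) * k z := fun ε => by
    have h1 := (Measure.measurePreserving_neg (volume : Measure 𝔼[M + 1])).setIntegral_preimage_emb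
      (MeasurableEquiv.neg 𝔼[M + 1]).measurableEmbedding
      (fun z => signFunction F (p + z) * k z) {z | ε < ‖z‖}
    rw [← h1]
    simp only [hkn, ← sub_eq_add_neg, preimage_ofPred_eq, norm_neg]
  have heq : ∀ᶠ ε in 𝓝[>] (0 : ℝ), ∫ z in {z | ε < ‖z‖}, evenSign F p z * k z =
      ∫ z in {z | ε < ‖z‖}, signFunction F (p + z) * k z := by
    filter_upwards [self_mem_nhdsWithin] with ε hε
    have h1 : ∀ z, evenSign F p z * k z = (signFunction F (p + z) * k z +
        signFunction F (p - z) * k z) / 2 := fun z => by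
      rw [evenSign]
      ring
    simp only [h1]
    rw [integral_div, integral_add (hi ε hε) (hi' ε hε), hflip]
    ring
  refine Tendsto.congr' heq ?_
  have h2 : ∀ ε : ℝ, ∫ z in {z | ε < ‖z‖}, evenSign F p z * k z =
      ∫ z, {z : 𝔼[M + 1] | ε < ‖z‖}.indicator (fun z => evenSign F p z * k z) z := fun ε =>
    (integral_indicator (hm ε)).symm
  simp only [h2]
  refine tendsto_integral_filter_of_dominated_convergence (fun z => ‖evenSign F p z * k z‖)
    (Eventually.of_forall fun ε => (hS.indicator (hm ε)).aestronglyMeasurable)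
    (Eventually.of_forall fun ε => Eventually.of_forall fun z => norm_indicator_le_norm_self _ _)
    hS.norm (Eventually.of_forall fun z => ?_)
  by_cases hz : z = 0
  · have : ∀ ε : ℝ, {z : 𝔼[M + 1] | ε < ‖z‖}.indicator (fun z => evenSign F p z * k z) z = 0 :=
      fun ε => by
        refine indicator_apply_eq_zero.2 fun _ => ?_
        rw [hz, hk0, mul_zero]
    rw [show evenSign F p z * k z = 0 by rw [hz, hk0, mul_zero]]
    simp only [this]
    exact tendsto_const_nhds
  · refine tendsto_const_nhds.congr' ?_
    have hz' := norm_pos_iff.2 hz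
    filter_upwards [nhdsWithin_le_nhds (gt_mem_nhds hz')] with ε hε
    exact (indicator_of_mem (show z ∈ {z : 𝔼[M + 1] | ε < ‖z‖} from hε)
      (fun z => evenSign F p z * k z)).symm

/-! ### The singular part of the nonlocal mean curvature -/

namespace IsCenteredChart

variable {M : ℕ} {E : Set 𝔼[M + 1]} {h : 𝔼[M + 1] → ℝ} {Et : ℝ → Set 𝔼[M + 1]} {C t₀ : ℝ}
  {p : 𝔼[M + 1]} {ι : (𝔼[M] × ℝ) ≃L[ℝ] 𝔼[M + 1]} {γ : 𝔼[M] → ℝ} {ε : ℝ}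
  {Γ : ℝ × 𝔼[M] → ℝ} {K β : ℝ}

theorem apply_zero (hc : IsCenteredChart E h Et p ι γ ε Γ K) {t : ℝ} (ht : |t| < ε) :
    Γ (t, 0) = 0 := by
  have := (hc.abs_le t 0 ht (by simpa using hc.moving.pos)).1
  rw [norm_zero, mul_zero] at this
  exact abs_nonpos_iff.1 this

/-- On the fibers of the chart, the even part of the sign function is a signed interval. -/
theorem evenSign_mul_nearKernel (hc : IsCenteredChart E h Et p ι γ ε Γ K) (hβ : 0 ≤ β) {t : ℝ}
    (ht : |t| < ε) {v : 𝔼[M]} (hv : ‖v‖ < ε) (y : ℝ) :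
    evenSign (translatedSet Et (h p • outerNormal E p) t) p (ι (v, y)) *
        nearKernel β ε (ι (v, y)) =
      (Ioo (-Γ (t, -v)) (Γ (t, v))).indicator (fun y => nearKernel β ε (ι (v, y))) y -
        (Icc (Γ (t, v)) (-Γ (t, -v))).indicator (fun y => nearKernel β ε (ι (v, y))) y := by
  classical
  have hε := hc.moving.pos
  by_cases hk : nearKernel β ε (ι (v, y)) = 0
  · simp [indicator_apply, hk]
  have hy : |y| < ε := by
    by_contra! hy
    exact hk (nearKernel_eq_zero hβ hε (hy.trans (hc.moving.frame.abs_snd_le (v, y))))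
  have h1 := hc.moving.mem_iff t v y ht hv hy
  have h2 := hc.moving.mem_iff t (-v) (-y) ht (by rwa [norm_neg]) (by rwa [abs_neg])
  -- The reflected point has coordinates `(-v, -y)`, so it lies in the set exactly when `y > -Γ (t,
  -- -v)`. The even sign is 1 where both conditions hold, -1 where both fail, and 0 otherwise.
  have h3 : p + ι (-v, -y) = p - ι (v, y) := by
    rw [show (-v, -y) = -(v, y) from rfl, map_neg, sub_eq_add_neg]
  rw [h3] at h2
  set F := translatedSet Et (h p • outerNormal E p) t
  have h4 : (-y < Γ (t, -v)) ↔ -Γ (t, -v) < y := neg_lt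
  rw [h4] at h2
  rw [evenSign]
  by_cases ha : y < Γ (t, v) <;> by_cases hb : -Γ (t, -v) < y
  · rw [signFunction_of_mem (h1.2 ha), signFunction_of_mem (h2.2 hb),
      indicator_of_mem (mem_Ioo.2 ⟨hb, ha⟩), indicator_of_notMem fun h => h.1.not_gt ha]
    ring
  · rw [signFunction_of_mem (h1.2 ha), signFunction_of_notMem (mt h2.1 hb),
      indicator_of_notMem fun h => hb h.1, indicator_of_notMem fun h => h.1.not_gt ha]
    ring
  · rw [signFunction_of_notMem (mt h1.1 ha), signFunction_of_mem (h2.2 hb),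
      indicator_of_notMem fun h => ha h.2, indicator_of_notMem fun h => h.2.not_gt hb]
    ring
  · rw [signFunction_of_notMem (mt h1.1 ha), signFunction_of_notMem (mt h2.1 hb),
      indicator_of_notMem fun h => ha h.2, indicator_of_mem (mem_Icc.2 ⟨not_lt.1 ha, not_lt.1 hb⟩)]
    ring

theorem nearKernel_eq_zero_of_le (hc : IsCenteredChart E h Et p ι γ ε Γ K) (hβ : 0 ≤ β) {v : 𝔼[M]}
    (hv : ε ≤ ‖v‖) (y : ℝ) : nearKernel β ε (ι (v, y)) = 0 :=
  nearKernel_eq_zero hβ hc.moving.pos (hv.trans (hc.moving.frame.norm_fst_le (v, y)))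

theorem continuous_nearKernel_fiber (hc : IsCenteredChart E h Et p ι γ ε Γ K) (β : ℝ) {v : 𝔼[M]}
    (hv : v ≠ 0) : Continuous fun y => nearKernel β ε (ι (v, y)) := by
  refine continuous_iff_continuousAt.2 fun y => ?_
  refine ContinuousAt.comp (g := nearKernel β ε) (f := fun y => ι (v, y))
    (continuousAt_nearKernel β ε fun h0 => hv ?_)
    (ι.continuous.comp (Continuous.prodMk_right v)).continuousAt
  have := hc.moving.frame.norm_fst_le (v, y)
  rw [h0, norm_zero] at this
  exact norm_le_zero_iff.1 this

theorem nearKernel_fiber_le (hc : IsCenteredChart E h Et p ι γ ε Γ K) (hβ : 0 ≤ β) {v : 𝔼[M]}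
    (hv : v ≠ 0) (y : ℝ) : nearKernel β ε (ι (v, y)) ≤ ‖v‖ ^ (-β) :=
  nearKernel_le hβ hc.moving.pos (norm_pos_iff.2 hv) (hc.moving.frame.norm_fst_le (v, y))

theorem nearKernel_zero (β r : ℝ) (hβ : 0 < β) (hr : 0 < r) : nearKernel β r (0 : 𝔼[M + 1]) = 0 := by
  -- For real powers `0 ^ (-β) = 0`, so the kernel takes the value 0, not infinity, at its
  -- singularity; on the fibre `v = 0` this is the value that enters.
  rw [nearKernel, norm_zero, Real.zero_rpow (by linarith)]
  exact max_eq_left (by have : 0 ≤ r ^ (-β) := by positivity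
                        linarith)

theorem abs_evenSign_mul_nearKernel_le (hc : IsCenteredChart E h Et p ι γ ε Γ K) (hβ : 0 < β) {t : ℝ}
    (ht : |t| < ε) {v : 𝔼[M]} (hv : ‖v‖ < ε) (y : ℝ) :
    |evenSign (translatedSet Et (h p • outerNormal E p) t) p (ι (v, y)) *
        nearKernel β ε (ι (v, y))| ≤
      (Ioo (-Γ (t, -v)) (Γ (t, v))).indicator (fun _ => ‖v‖ ^ (-β)) y +
        (Icc (Γ (t, v)) (-Γ (t, -v))).indicator (fun _ => ‖v‖ ^ (-β)) y := by
  have hε := hc.moving.pos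
  rw [hc.evenSign_mul_nearKernel hβ.le ht hv y]
  by_cases hv0 : v = 0
  · subst hv0
    rw [neg_zero, hc.apply_zero ht, neg_zero, Ioo_self, Icc_self]
    have h1 : ({0} : Set ℝ).indicator (fun y => nearKernel β ε (ι ((0 : 𝔼[M]), y))) y = 0 := by
      refine indicator_apply_eq_zero.2 fun hy => ?_
      rw [mem_singleton_iff.1 hy]
      have : ι ((0 : 𝔼[M]), (0 : ℝ)) = 0 := map_zero ι
      rw [this, nearKernel_zero β ε hβ hε]
    rw [h1]
    simp only [indicator_empty, sub_zero, abs_zero, zero_add]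
    exact indicator_nonneg (fun _ _ => by positivity) _
  · refine (abs_sub _ _).trans (add_le_add ?_ ?_)
    · rw [← Real.norm_eq_abs, norm_indicator_eq_indicator_norm]
      refine indicator_le_indicator ?_
      rw [Real.norm_of_nonneg (nearKernel_nonneg _ _ _)]
      exact hc.nearKernel_fiber_le hβ.le hv0 y
    · rw [← Real.norm_eq_abs, norm_indicator_eq_indicator_norm]
      refine indicator_le_indicator ?_
      rw [Real.norm_of_nonneg (nearKernel_nonneg _ _ _)]
      exact hc.nearKernel_fiber_le hβ.le hv0 y

/-- On the fibre over `v` the integrand is at most `‖v‖ ^ (-β)` and lives on an interval of length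
`|Γ (t, v) + Γ (t, -v)| ≤ K * ‖v‖ ^ 2`. The resulting `‖v‖ ^ (2 - β)` is locally integrable in
dimension `M` because `β < M + 2`, that is, `s < 1`. -/
theorem integrable_evenSign_mul_nearKernel (hc : IsCenteredChart E h Et p ι γ ε Γ K)
    (hP : IsPerturbationFamily E h Et C t₀) (hβ : 0 < β) (hβM : β < M + 2) {t : ℝ} (ht : |t| < ε)
    (ht' : |t| < t₀) :
    Integrable fun q : 𝔼[M] × ℝ => evenSign (translatedSet Et (h p • outerNormal E p) t) p (ι q) *
      nearKernel β ε (ι q) := by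
  have hε := hc.moving.pos
  have hK := hc.nonneg
  set F := translatedSet Et (h p • outerNormal E p) t
  have hF : MeasurableSet F := (hP.isOpen_translatedSet _ ht').measurableSet
  have hιm : Measurable ι := ι.continuous.measurable
  have hm : Measurable fun q : 𝔼[M] × ℝ => evenSign F p (ι q) * nearKernel β ε (ι q) :=
    ((measurable_evenSign hF p).comp hιm).mul ((measurable_nearKernel β ε).comp hιm)
  have hind : ∀ (a b c : ℝ), Integrable fun y => (Ioo a b).indicator (fun _ => c) y +
      (Icc b a).indicator (fun _ => c) y := fun a b c =>
    ((integrable_indicator_iff measurableSet_Ioo).2 (integrableOn_const (by simp))).add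
      ((integrable_indicator_iff measurableSet_Icc).2 (integrableOn_const (by simp)))
  have hout : ∀ v : 𝔼[M], ε ≤ ‖v‖ → ∀ y, evenSign F p (ι (v, y)) * nearKernel β ε (ι (v, y)) = 0 :=
    fun v hv y => by rw [hc.nearKernel_eq_zero_of_le hβ.le hv, mul_zero]
  refine (integrable_prod_iff hm.aestronglyMeasurable).2
    ⟨Eventually.of_forall fun v => ?_, ?_⟩
  · by_cases hv : ‖v‖ < ε
    · exact (hind _ _ _).mono' (hm.comp measurable_prodMk_left).aestronglyMeasurable
        (Eventually.of_forall (hc.abs_evenSign_mul_nearKernel_le hβ ht hv))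
    · simp only [hout v (not_lt.1 hv)]
      exact integrable_zero _ _ _
  · have hbi : Integrable ((Metric.ball (0 : 𝔼[M]) ε).indicator
        fun v => K * ‖v‖ ^ (-(β - 2))) :=
      (integrable_indicator_iff measurableSet_ball).2
        ((integrableOn_norm_rpow_neg (by linarith)).const_mul K)
    refine hbi.mono' hm.aestronglyMeasurable.norm.integral_prod_right'
      (Eventually.of_forall fun v => ?_)
    rw [Real.norm_of_nonneg (integral_nonneg fun y => norm_nonneg _)]
    by_cases hv : ‖v‖ < ε
    · rw [indicator_of_mem (by simpa using hv)]
      have hle : ∫ y, ‖evenSign F p (ι (v, y)) * nearKernel β ε (ι (v, y))‖ ≤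
          ∫ y, ((Ioo (-Γ (t, -v)) (Γ (t, v))).indicator (fun _ => ‖v‖ ^ (-β)) y +
            (Icc (Γ (t, v)) (-Γ (t, -v))).indicator (fun _ => ‖v‖ ^ (-β)) y) :=
        integral_mono_of_nonneg (Eventually.of_forall fun y => norm_nonneg _) (hind _ _ _)
          (Eventually.of_forall (hc.abs_evenSign_mul_nearKernel_le hβ ht hv))
      refine hle.trans ?_
      rw [integral_add ((integrable_indicator_iff measurableSet_Ioo).2 (integrableOn_const (by simp)))
        ((integrable_indicator_iff measurableSet_Icc).2 (integrableOn_const (by simp))),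
        integral_indicator measurableSet_Ioo, integral_indicator measurableSet_Icc,
        setIntegral_const, setIntegral_const, measureReal_def, measureReal_def, Real.volume_Ioo,
        Real.volume_Icc, smul_eq_mul, smul_eq_mul, ← add_mul]
      have h1 : (ENNReal.ofReal (Γ (t, v) - -Γ (t, -v))).toReal +
          (ENNReal.ofReal (-Γ (t, -v) - Γ (t, v))).toReal = |Γ (t, v) + Γ (t, -v)| := by
        rw [ENNReal.toReal_ofReal', ENNReal.toReal_ofReal',
          show -Γ (t, -v) - Γ (t, v) = -(Γ (t, v) - -Γ (t, -v)) by ring, max_zero_add_max_neg_zero_eq_abs_self,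
          sub_neg_eq_add]
      rw [h1]
      calc |Γ (t, v) + Γ (t, -v)| * ‖v‖ ^ (-β) ≤ K * ‖v‖ ^ 2 * ‖v‖ ^ (-β) :=
            mul_le_mul_of_nonneg_right (hc.abs_le t v ht hv).2 (by positivity)
        _ = K * (‖v‖ ^ 2 * ‖v‖ ^ (-β)) := by ring
        _ ≤ K * ‖v‖ ^ (-(β - 2)) :=
            mul_le_mul_of_nonneg_left (sq_mul_rpow_neg_le (norm_nonneg v) β) hK
    · simp only [hout v (not_lt.1 hv), norm_zero, integral_zero]
      exact indicator_nonneg (fun _ _ => by positivity) _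

end IsCenteredChart

/-! ### Differentiation along the fibres of the chart -/

namespace IsCenteredChart

variable {M : ℕ} {E : Set 𝔼[M + 1]} {h : 𝔼[M + 1] → ℝ} {Et : ℝ → Set 𝔼[M + 1]} {C t₀ : ℝ}
  {p : 𝔼[M + 1]} {ι : (𝔼[M] × ℝ) ≃L[ℝ] 𝔼[M + 1]} {γ : 𝔼[M] → ℝ} {ε : ℝ}
  {Γ : ℝ × 𝔼[M] → ℝ} {K β : ℝ}

theorem integral_fiber (hc : IsCenteredChart E h Et p ι γ ε Γ K) (hβ : 0 ≤ β) {t : ℝ} (ht : |t| < ε)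
    {v : 𝔼[M]} (hv : ‖v‖ < ε) (hv0 : v ≠ 0) :
    ∫ y, evenSign (translatedSet Et (h p • outerNormal E p) t) p (ι (v, y)) *
        nearKernel β ε (ι (v, y)) =
      ∫ y in (-Γ (t, -v))..(Γ (t, v)), nearKernel β ε (ι (v, y)) := by
  have hcont := hc.continuous_nearKernel_fiber β hv0
  simp only [hc.evenSign_mul_nearKernel hβ ht hv]
  rw [integral_sub, integral_indicator measurableSet_Ioo, integral_indicator measurableSet_Icc,
    intervalIntegral, integral_Ioc_eq_integral_Ioo, integral_Icc_eq_integral_Ioc]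
  · exact (integrable_indicator_iff measurableSet_Ioo).2
      (hcont.integrableOn_Icc.mono_set Ioo_subset_Icc_self)
  · exact (integrable_indicator_iff measurableSet_Icc).2 hcont.integrableOn_Icc

/-- The fundamental theorem of calculus at both endpoints. Evenness of the kernel rewrites the
contribution of the lower endpoint `-Γ (t, -v)` as the upper one at `-v`. -/
theorem hasDerivAt_fiber (hc : IsCenteredChart E h Et p ι γ ε Γ K) (hβ : 0 < β) {t : ℝ}
    (ht : |t| < ε) {v : 𝔼[M]} (hv : ‖v‖ < ε) :
    HasDerivAt (fun t => ∫ y, evenSign (translatedSet Et (h p • outerNormal E p) t) p (ι (v, y)) *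
        nearKernel β ε (ι (v, y)))
      (nearKernel β ε (ι (v, Γ (t, v))) * fderiv ℝ Γ (t, v) (1, 0) +
        nearKernel β ε (ι (-v, Γ (t, -v))) * fderiv ℝ Γ (t, -v) (1, 0)) t := by
  have hε := hc.moving.pos
  have hnear : ∀ᶠ t' in 𝓝 t, |t'| < ε :=
    (show ContinuousAt (fun t : ℝ => |t|) t by fun_prop).eventually_lt_const ht
  by_cases hv0 : v = 0
  · subst hv0
    have h1 : ι ((0 : 𝔼[M]), (0 : ℝ)) = 0 := map_zero ι
    rw [neg_zero, hc.apply_zero ht, h1, nearKernel_zero β ε hβ hε, zero_mul, zero_add]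
    refine (hasDerivAt_const t (0 : ℝ)).congr_of_eventuallyEq ?_
    filter_upwards [hnear] with t' ht'
    have h2 : ∀ y, evenSign (translatedSet Et (h p • outerNormal E p) t') p (ι ((0 : 𝔼[M]), y)) *
        nearKernel β ε (ι ((0 : 𝔼[M]), y)) = 0 := fun y => by
      rw [hc.evenSign_mul_nearKernel hβ.le ht' hv, neg_zero, hc.apply_zero ht', neg_zero, Ioo_self,
        Icc_self]
      have h3 : ({0} : Set ℝ).indicator (fun y => nearKernel β ε (ι ((0 : 𝔼[M]), y))) y = 0 := by
        refine indicator_apply_eq_zero.2 fun hy => ?_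
        rw [mem_singleton_iff.1 hy, h1, nearKernel_zero β ε hβ hε]
      rw [h3, indicator_empty, sub_zero]
    simp only [h2, integral_zero]
  · set κ : ℝ → ℝ := fun y => nearKernel β ε (ι (v, y)) with hκ
    have hcont : Continuous κ := hc.continuous_nearKernel_fiber β hv0
    have ha := hc.moving.hasDerivAt_fderiv ht hv
    have hb := (hc.moving.hasDerivAt_fderiv ht (v := -v) (by rwa [norm_neg])).fun_neg
    have h1 := (hcont.integral_hasStrictDerivAt 0 (Γ (t, v))).hasDerivAt.comp t ha
    have h2 := (hcont.integral_hasStrictDerivAt 0 (-Γ (t, -v))).hasDerivAt.comp t hb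
    have h3 : HasDerivAt (fun t => (∫ y in (0 : ℝ)..Γ (t, v), κ y) - ∫ y in (0 : ℝ)..-Γ (t, -v), κ y)
        (κ (Γ (t, v)) * fderiv ℝ Γ (t, v) (1, 0) -
          κ (-Γ (t, -v)) * -fderiv ℝ Γ (t, -v) (1, 0)) t := h1.sub h2
    have h4 : κ (-Γ (t, -v)) = nearKernel β ε (ι (-v, Γ (t, -v))) := by
      rw [← nearKernel_neg, ← map_neg]
      simp [κ]
    rw [h4, mul_neg, sub_neg_eq_add] at h3
    refine h3.congr_of_eventuallyEq ?_
    filter_upwards [hnear] with t' ht'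
    rw [hc.integral_fiber hβ.le ht' hv hv0]
    exact (intervalIntegral.integral_interval_sub_left (hcont.intervalIntegrable _ _)
      (hcont.intervalIntegrable _ _)).symm

/-- Each term alone is only `O(‖v‖ ^ (1 - β))`. One more order comes from cancellation: the two time
derivatives add up to `O(‖v‖ ^ 2)`, and the two kernel values differ by `O(‖v‖ ^ (-β - 1) * ‖v‖ ^
2)`, multiplied by a time derivative of size `O(‖v‖)`. -/
theorem abs_fiber_derivative_le (hc : IsCenteredChart E h Et p ι γ ε Γ K) (hβ : 0 < β) {t : ℝ}
    (ht : |t| < ε) {v : 𝔼[M]} (hv : ‖v‖ < ε) :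
    |nearKernel β ε (ι (v, Γ (t, v))) * fderiv ℝ Γ (t, v) (1, 0) +
        nearKernel β ε (ι (-v, Γ (t, -v))) * fderiv ℝ Γ (t, -v) (1, 0)| ≤
      (K + β * K ^ 2) * ‖v‖ ^ (-(β - 2)) := by
  have hε := hc.moving.pos
  have hK := hc.nonneg
  by_cases hv0 : v = 0
  · subst hv0
    have h1 : ι ((0 : 𝔼[M]), (0 : ℝ)) = 0 := map_zero ι
    rw [neg_zero, hc.apply_zero ht, h1, nearKernel_zero β ε hβ hε, zero_mul, zero_add, abs_zero]
    positivity
  have hvpos := norm_pos_iff.2 hv0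
  set a := Γ (t, v)
  set b := Γ (t, -v)
  set a' := fderiv ℝ Γ (t, v) (1, 0)
  set b' := fderiv ℝ Γ (t, -v) (1, 0)
  have hab := (hc.abs_le t v ht hv).2
  have hab' := (hc.abs_fderiv_le t v ht hv).2
  have hb' := (hc.abs_fderiv_le t (-v) ht (by rwa [norm_neg])).1
  rw [norm_neg] at hb'
  have hn : ‖ι (-v, b)‖ = ‖ι (v, -b)‖ := by
    rw [← norm_neg, ← map_neg]
    simp
  have h1 : |‖ι (-v, b)‖ - ‖ι (v, a)‖| ≤ K * ‖v‖ ^ 2 := by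
    rw [hn]
    refine (abs_norm_sub_norm_le _ _).trans ?_
    rw [← map_sub]
    refine (hc.moving.frame.norm_le _).trans ?_
    simp only [Prod.mk_sub_mk, sub_self, norm_zero, zero_add]
    rw [← abs_neg]
    refine le_trans (le_of_eq ?_) hab
    congr 1
    ring
  have h2 : |nearKernel β ε (ι (-v, b)) - nearKernel β ε (ι (v, a))| ≤
      β * ‖v‖ ^ (-β - 1) * (K * ‖v‖ ^ 2) :=
    (abs_nearKernel_sub_le hβ.le hvpos (by
      have := hc.moving.frame.norm_fst_le (-v, b)
      rwa [norm_neg] at this) (hc.moving.frame.norm_fst_le (v, a))).trans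
      (mul_le_mul_of_nonneg_left h1 (by positivity))
  have h3 : nearKernel β ε (ι (v, a)) ≤ ‖v‖ ^ (-β) := hc.nearKernel_fiber_le hβ.le hv0 a
  have h4 : ‖v‖ ^ (-β - 1) * ‖v‖ = ‖v‖ ^ (-β) := by
    rw [Real.rpow_sub_one hvpos.ne', div_mul_cancel₀ _ hvpos.ne']
  have h5 : nearKernel β ε (ι (v, a)) * a' + nearKernel β ε (ι (-v, b)) * b' =
      nearKernel β ε (ι (v, a)) * (a' + b') +
        (nearKernel β ε (ι (-v, b)) - nearKernel β ε (ι (v, a))) * b' := by ring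
  rw [h5]
  refine (abs_add_le _ _).trans ?_
  rw [abs_mul, abs_mul, abs_of_nonneg (nearKernel_nonneg _ _ _)]
  calc nearKernel β ε (ι (v, a)) * |a' + b'| +
        |nearKernel β ε (ι (-v, b)) - nearKernel β ε (ι (v, a))| * |b'|
      ≤ ‖v‖ ^ (-β) * (K * ‖v‖ ^ 2) + β * ‖v‖ ^ (-β - 1) * (K * ‖v‖ ^ 2) * (K * ‖v‖) := by
        gcongr
    _ = ‖v‖ ^ (-β) * (K * ‖v‖ ^ 2) + β * (‖v‖ ^ (-β - 1) * ‖v‖) * (K * ‖v‖ ^ 2) * K := by ring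
    _ = (K + β * K ^ 2) * (‖v‖ ^ 2 * ‖v‖ ^ (-β)) := by rw [h4]; ring
    _ ≤ (K + β * K ^ 2) * ‖v‖ ^ (-(β - 2)) :=
        mul_le_mul_of_nonneg_left (sq_mul_rpow_neg_le hvpos.le β) (by positivity)

theorem aestronglyMeasurable_nearKernel_graph (hc : IsCenteredChart E h Et p ι γ ε Γ K) (β : ℝ) :
    AEStronglyMeasurable (fun v => nearKernel β ε (ι (v, Γ (0, v))) * fderiv ℝ Γ (0, v) (1, 0))
      (volume.restrict (Metric.ball 0 ε)) := by
  have hε := hc.moving.pos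
  have hcv : ∀ v : 𝔼[M], ContinuousAt (fun v : 𝔼[M] => ((0 : ℝ), v)) v := fun v => by fun_prop
  have h1 : ContinuousOn (fun v => ι (v, Γ (0, v))) (Metric.ball 0 ε) := fun v hv => by
    have h2 : ContinuousAt (fun v => Γ (0, v)) v :=
      ContinuousAt.comp (g := Γ) (f := fun v : 𝔼[M] => ((0 : ℝ), v))
        (hc.moving.contDiffAt 0 v (by simpa) (by simpa using hv)).continuousAt (hcv v)
    exact (ContinuousAt.comp (g := ι) (f := fun v => (v, Γ (0, v))) ι.continuous.continuousAt
      (continuousAt_id.prodMk h2)).continuousWithinAt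
  have h3 : ContinuousOn (fun v => fderiv ℝ Γ (0, v) (1, 0)) (Metric.ball 0 ε) := fun v hv =>
    (ContinuousAt.comp (g := fun w => fderiv ℝ Γ w (1, 0)) (f := fun v : 𝔼[M] => ((0 : ℝ), v))
      (hc.moving.contDiffAt_fderiv (by simpa) (by simpa using hv)).continuousAt
      (hcv v)).continuousWithinAt
  exact (((measurable_nearKernel β ε).comp_aemeasurable
    (h1.aemeasurable measurableSet_ball)).aestronglyMeasurable).mul
    (h3.aestronglyMeasurable measurableSet_ball)

/-- The first variation of the singular part of the nonlocal mean curvature. -/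
theorem hasDerivAt_integral_evenSign (hc : IsCenteredChart E h Et p ι γ ε Γ K)
    (hP : IsPerturbationFamily E h Et C t₀) (hβ : 0 < β) (hβM : β < M + 2) :
    IntegrableOn (fun v => nearKernel β ε (ι (v, Γ (0, v))) * fderiv ℝ Γ (0, v) (1, 0) +
        nearKernel β ε (ι (-v, Γ (0, -v))) * fderiv ℝ Γ (0, -v) (1, 0)) (Metric.ball 0 ε) ∧
    HasDerivAt (fun t => ∫ z, evenSign (translatedSet Et (h p • outerNormal E p) t) p z *
        nearKernel β ε z)
      (∫ v in Metric.ball 0 ε, (nearKernel β ε (ι (v, Γ (0, v))) * fderiv ℝ Γ (0, v) (1, 0) +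
        nearKernel β ε (ι (-v, Γ (0, -v))) * fderiv ℝ Γ (0, -v) (1, 0))) 0 := by
  have hε := hc.moving.pos
  have hK := hc.nonneg
  have ht₀ := hP.pos
  set U : ℝ → 𝔼[M] → ℝ := fun t v =>
    nearKernel β ε (ι (v, Γ (t, v))) * fderiv ℝ Γ (t, v) (1, 0) with hU
  let F : ℝ → 𝔼[M] → ℝ := fun t v =>
    ∫ y, evenSign (translatedSet Et (h p • outerNormal E p) t) p (ι (v, y)) *
      nearKernel β ε (ι (v, y))
  let F' : ℝ → 𝔼[M] → ℝ := fun t => (Metric.ball 0 ε).indicator fun v => U t v + U t (-v)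
  have hsmall : ∀ᶠ t in 𝓝 (0 : ℝ), |t| < ε ∧ |t| < t₀ :=
    ((show ContinuousAt (fun t : ℝ => |t|) 0 by fun_prop).eventually_lt_const (by simpa)).and
      ((show ContinuousAt (fun t : ℝ => |t|) 0 by fun_prop).eventually_lt_const (by simpa))
  have hprod : ∀ t, |t| < ε ∧ |t| < t₀ → Integrable (fun q : 𝔼[M] × ℝ =>
      evenSign (translatedSet Et (h p • outerNormal E p) t) p (ι q) * nearKernel β ε (ι q))
      (volume.prod volume) := fun t ht =>
    hc.integrable_evenSign_mul_nearKernel hP hβ hβM ht.1 ht.2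
  have hFi : ∀ᶠ t in 𝓝 (0 : ℝ), Integrable (F t) := by
    filter_upwards [hsmall] with t ht
    exact (hprod t ht).integral_prod_left
  have hFeq : ∀ᶠ t in 𝓝 (0 : ℝ), ∫ z, evenSign (translatedSet Et (h p • outerNormal E p) t) p z *
      nearKernel β ε z = ∫ v, F t v := by
    filter_upwards [hsmall] with t ht
    rw [← hc.moving.frame.measurePreserving.integral_comp ι.toHomeomorph.measurableEmbedding]
    exact integral_prod _ (hprod t ht)
  have hball : ∀ t : ℝ, t ∈ Metric.ball (0 : ℝ) ε ↔ |t| < ε := fun t => by simp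
  have hderiv : ∀ v, ∀ t ∈ Metric.ball (0 : ℝ) ε, HasDerivAt (fun t => F t v) (F' t v) t := by
    intro v t ht
    by_cases hv : ‖v‖ < ε
    · have h1 : F' t v = U t v + U t (-v) := indicator_of_mem (by simpa using hv) _
      rw [h1]
      exact hc.hasDerivAt_fiber hβ ((hball t).1 ht) hv
    · have h1 : F' t v = 0 := indicator_of_notMem (by simpa using hv) _
      have h2 : ∀ t, F t v = 0 := fun t => by
        simp only [F, hc.nearKernel_eq_zero_of_le hβ.le (not_lt.1 hv), mul_zero, integral_zero]
      rw [h1]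
      simp only [h2]
      exact hasDerivAt_const t 0
  have hbound : ∀ v, ∀ t ∈ Metric.ball (0 : ℝ) ε, ‖F' t v‖ ≤ (Metric.ball 0 ε).indicator
      (fun v => (K + β * K ^ 2) * ‖v‖ ^ (-(β - 2))) v := by
    intro v t ht
    by_cases hv : v ∈ Metric.ball 0 ε
    · simp only [F', indicator_of_mem hv]
      exact hc.abs_fiber_derivative_le hβ ((hball t).1 ht) (by simpa using hv)
    · simp only [F', indicator_of_notMem hv, norm_zero, le_refl]
  have hbi : Integrable ((Metric.ball (0 : 𝔼[M]) ε).indicator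
      fun v => (K + β * K ^ 2) * ‖v‖ ^ (-(β - 2))) :=
    (integrable_indicator_iff measurableSet_ball).2
      ((integrableOn_norm_rpow_neg (by linarith)).const_mul _)
  have hUm : AEStronglyMeasurable (U 0) (volume.restrict (Metric.ball 0 ε)) :=
    hc.aestronglyMeasurable_nearKernel_graph β
  have hmp : MeasurePreserving (fun v : 𝔼[M] => -v) (volume.restrict (Metric.ball 0 ε))
      (volume.restrict (Metric.ball 0 ε)) := by
    have h1 := (Measure.measurePreserving_neg (volume : Measure 𝔼[M])).restrict_preimage
      (measurableSet_ball (x := (0 : 𝔼[M])) (ε := ε))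
    rwa [show (Neg.neg ⁻¹' Metric.ball (0 : 𝔼[M]) ε) = Metric.ball 0 ε by ext; simp] at h1
  have hmeas0 : AEStronglyMeasurable (F' 0) :=
    (aestronglyMeasurable_indicator_iff measurableSet_ball).2
      (hUm.add (hUm.comp_measurePreserving hmp))
  obtain ⟨hF'i, hFd⟩ := hasDerivAt_integral_of_dominated_loc_of_deriv_le
    (Metric.ball_mem_nhds (0 : ℝ) hε) (hFi.mono fun t ht => ht.aestronglyMeasurable)
    hFi.self_of_nhds hmeas0 (Eventually.of_forall hbound) hbi (Eventually.of_forall hderiv)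
  refine ⟨(integrable_indicator_iff measurableSet_ball).1 hF'i, ?_⟩
  rw [integral_indicator measurableSet_ball] at hFd
  exact hFd.congr_of_eventuallyEq hFeq

end IsCenteredChart

/-! ### Principal values on the boundary -/

/-- Dominated convergence. The point `p` is removed at every radius, so `f` must vanish there almost
everywhere; this is not automatic, as the surface measure charges points when `N = 1`. -/
theorem tendsto_setIntegral_norm_sub_gt {X : Type*} [NormedAddCommGroup X] [MeasurableSpace X]
    [OpensMeasurableSpace X] {μ : Measure X} {f : X → ℝ} (hf : Integrable f μ) {p : X}
    (hp : ∀ᵐ x ∂μ, x = p → f x = 0) :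
    Tendsto (fun r : ℝ => ∫ x in {x | r < ‖x - p‖}, f x ∂μ) (𝓝[>] 0) (𝓝 (∫ x, f x ∂μ)) := by
  have hm : ∀ r : ℝ, MeasurableSet {x : X | r < ‖x - p‖} := fun r =>
    (isOpen_lt continuous_const (continuous_id.sub continuous_const).norm).measurableSet
  simp_rw [← integral_indicator (hm _)]
  refine tendsto_integral_filter_of_dominated_convergence (fun x => ‖f x‖)
    (Eventually.of_forall fun r => hf.aestronglyMeasurable.indicator (hm r))
    (Eventually.of_forall fun r => Eventually.of_forall fun x => norm_indicator_le_norm_self _ _)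
    hf.norm ?_
  filter_upwards [hp] with x hx
  by_cases hxp : x = p
  · have h1 : ∀ r, ({x : X | r < ‖x - p‖}).indicator f x = 0 := fun r => by
      rw [indicator_apply_eq_zero]
      exact fun _ => hx hxp
    simp only [h1, hx hxp]
    exact tendsto_const_nhds
  · refine tendsto_const_nhds.congr' ?_
    filter_upwards [Ioo_mem_nhdsGT (norm_sub_pos_iff.2 hxp)] with r hr
    exact (indicator_of_mem (show x ∈ {x : X | r < ‖x - p‖} from hr.2) _).symm

/-- Bernoulli's inequality, `1 - (1 - c) ^ M ≤ M * c`, applied to the volumes of two balls. -/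
theorem volume_real_annulus_le {M : ℕ} {r ρ c : ℝ} (hr : 0 ≤ r) (hc : 0 ≤ c) (hc1 : c ≤ 1)
    (hρ : r * (1 - c) ≤ ρ) :
    volume.real {v : 𝔼[M] | ρ < ‖v‖ ∧ ‖v‖ ≤ r} ≤
      volume.real (Metric.ball (0 : 𝔼[M]) 1) * (r ^ M * (M * c)) := by
  have hc' : 0 ≤ 1 - c := by linarith
  have hsub : {v : 𝔼[M] | ρ < ‖v‖ ∧ ‖v‖ ≤ r} ⊆
      Metric.closedBall 0 r \ Metric.closedBall 0 (r * (1 - c)) := fun v hv => by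
    refine ⟨by simpa using hv.2, fun h => ?_⟩
    rw [mem_closedBall_zero_iff] at h
    linarith [hv.1]
  have hball : ∀ a : ℝ, 0 ≤ a → volume.real (Metric.closedBall (0 : 𝔼[M]) a) =
      a ^ M * volume.real (Metric.ball (0 : 𝔼[M]) 1) := fun a ha => by
    have := Measure.addHaar_real_closedBall (volume : Measure 𝔼[M]) 0 ha
    simpa using this
  have hbern : 1 - (1 - c) ^ M ≤ M * c := by
    have := one_add_mul_le_pow (show (-2 : ℝ) ≤ -c by linarith) M
    rw [← sub_eq_add_neg] at this
    linarith
  refine (measureReal_mono hsub (ne_top_of_le_ne_top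
    (measure_closedBall_lt_top (x := (0 : 𝔼[M])) (r := r)).ne (measure_mono sdiff_subset))).trans ?_
  rw [measureReal_sdiff (Metric.closedBall_subset_closedBall (by nlinarith))
    measurableSet_closedBall measure_closedBall_lt_top.ne, hball r hr, hball _ (mul_nonneg hr hc'),
    mul_pow]
  have h1 : 0 ≤ volume.real (Metric.ball (0 : 𝔼[M]) 1) := measureReal_nonneg
  calc r ^ M * volume.real (Metric.ball (0 : 𝔼[M]) 1) -
        r ^ M * (1 - c) ^ M * volume.real (Metric.ball (0 : 𝔼[M]) 1)
      = volume.real (Metric.ball (0 : 𝔼[M]) 1) * (r ^ M * (1 - (1 - c) ^ M)) := by ring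
    _ ≤ _ := by gcongr

theorem integrableOn_inter_norm_gt {M : ℕ} {U : 𝔼[M] → ℝ} {ε A β : ℝ} (hβ : 1 < β)
    (hUm : AEStronglyMeasurable U (volume.restrict (Metric.ball 0 ε)))
    (hUA : ∀ v, ‖v‖ < ε → |U v| ≤ A * ‖v‖ ^ (1 - β)) {ρ : ℝ} (hρ : 0 < ρ) :
    IntegrableOn U (Metric.ball 0 ε ∩ {v | ρ < ‖v‖}) := by
  have hm : MeasurableSet {v : 𝔼[M] | ρ < ‖v‖} :=
    (isOpen_lt continuous_const continuous_norm).measurableSet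
  refine IntegrableOn.of_bound ((measure_mono inter_subset_left).trans_lt measure_ball_lt_top)
    (hUm.mono_measure (Measure.restrict_mono inter_subset_left le_rfl)) (|A| * ρ ^ (1 - β)) ?_
  filter_upwards [ae_restrict_mem (measurableSet_ball.inter hm)] with v hv
  have h1 := hUA v (by simpa using hv.1)
  have h2 : ‖v‖ ^ (1 - β) ≤ ρ ^ (1 - β) :=
    Real.rpow_le_rpow_of_nonpos hρ (le_of_lt hv.2) (by linarith)
  rw [Real.norm_eq_abs]
  refine h1.trans ((mul_le_mul_of_nonneg_right (le_abs_self A) (by positivity)).trans ?_)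
  gcongr

/-- Principal values do not depend on quadratic perturbations of the removed balls. -/
theorem tendsto_integral_inter_gt {M : ℕ} {U n : 𝔼[M] → ℝ} {ε A K β : ℝ} (hε : 0 < ε)
    (hA : 0 ≤ A) (hK : 0 ≤ K) (hβ : 1 < β) (hβM : β < M + 2)
    (hUm : AEStronglyMeasurable U (volume.restrict (Metric.ball 0 ε)))
    (hUA : ∀ v, ‖v‖ < ε → |U v| ≤ A * ‖v‖ ^ (1 - β))
    (hUi : IntegrableOn (fun v => U v + U (-v)) (Metric.ball 0 ε))
    (hn : ∀ v, ‖v‖ < ε → ‖v‖ ≤ n v ∧ n v ≤ ‖v‖ * (1 + K * ‖v‖)) :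
    Tendsto (fun r : ℝ => ∫ v in Metric.ball 0 ε ∩ n ⁻¹' Ioi r, U v) (𝓝[>] 0)
      (𝓝 (2⁻¹ * ∫ v in Metric.ball 0 ε, (U v + U (-v)))) := by
  have hm : ∀ r : ℝ, MeasurableSet {v : 𝔼[M] | r < ‖v‖} := fun r =>
    (isOpen_lt continuous_const continuous_norm).measurableSet
  have hBm : ∀ r : ℝ, MeasurableSet (Metric.ball (0 : 𝔼[M]) ε ∩ {v | r < ‖v‖}) := fun r =>
    measurableSet_ball.inter (hm r)
  have hsub : ∀ r : ℝ, Metric.ball (0 : 𝔼[M]) ε ∩ {v | r < ‖v‖} ⊆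
      Metric.ball (0 : 𝔼[M]) ε ∩ n ⁻¹' Ioi r := fun r v hv =>
    ⟨hv.1, lt_of_lt_of_le hv.2 (hn v (by simpa using hv.1)).1⟩
  have hBi : ∀ r > 0, IntegrableOn U (Metric.ball 0 ε ∩ {v | r < ‖v‖}) := fun r hr =>
    integrableOn_inter_norm_gt hβ hUm hUA hr
  -- If `‖v‖ ≤ r < n v`, then `‖v‖ * (1 + K * r) > r`; this yields `‖v‖ > r * (1 - K * r)`, and also
  -- `‖v‖ > r / 2` since `K * r ≤ 1`.
  have hlow : ∀ r > 0, K * r ≤ 1 → ∀ v, ‖v‖ < ε → r < n v → r * (1 - K * r) < ‖v‖ ∧ r / 2 < ‖v‖ := by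
    intro r hr hKr v hv hrn
    by_cases hvr : r < ‖v‖
    · exact ⟨by nlinarith [mul_nonneg hK hr.le], by linarith⟩
    · push Not at hvr
      have h1 := hrn.trans_le (hn v hv).2
      have h2 : ‖v‖ * (1 + K * ‖v‖) ≤ ‖v‖ * (1 + K * r) := by gcongr
      have h3 : r < ‖v‖ * (1 + K * r) := h1.trans_le h2
      have h4 : 0 ≤ K * r := by positivity
      constructor
      · have : r * (1 - K * r) * (1 + K * r) ≤ r := by nlinarith [sq_nonneg (K * r)]
        exact lt_of_mul_lt_mul_right (this.trans_lt h3) (by linarith)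
      · nlinarith [norm_nonneg v]
  have hAi : ∀ r > 0, K * r ≤ 1 → IntegrableOn U (Metric.ball 0 ε ∩ n ⁻¹' Ioi r) :=
    fun r hr hKr => (hBi (r / 2) (by positivity)).mono_set fun v hv =>
      ⟨hv.1, (hlow r hr hKr v (by simpa using hv.1) hv.2).2⟩
  -- Over the symmetric truncation the integral of `U` is half that of `U v + U (-v)`, which is
  -- absolutely integrable.
  have hB : Tendsto (fun r : ℝ => ∫ v in Metric.ball 0 ε ∩ {v | r < ‖v‖}, U v) (𝓝[>] 0)
      (𝓝 (2⁻¹ * ∫ v in Metric.ball 0 ε, (U v + U (-v)))) := by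
    have h1 := (tendsto_setIntegral_norm_sub_gt hUi (p := 0) ?_).const_mul 2⁻¹
    · refine h1.congr' ?_
      filter_upwards [self_mem_nhdsWithin] with r hr
      simp only [sub_zero]
      rw [Measure.restrict_restrict (hm r), inter_comm]
      have hneg : MeasurePreserving (fun v : 𝔼[M] => -v)
          (volume.restrict (Metric.ball 0 ε ∩ {v | r < ‖v‖}))
          (volume.restrict (Metric.ball 0 ε ∩ {v | r < ‖v‖})) := by
        have h1 := (Measure.measurePreserving_neg (volume : Measure 𝔼[M])).restrict_preimage (hBm r)
        rwa [show (Neg.neg ⁻¹' (Metric.ball (0 : 𝔼[M]) ε ∩ {v | r < ‖v‖})) =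
          Metric.ball 0 ε ∩ {v | r < ‖v‖} by ext; simp] at h1
      have h2 := hneg.integral_comp (MeasurableEquiv.neg 𝔼[M]).measurableEmbedding U
      have h3 : IntegrableOn (fun v => U (-v)) (Metric.ball 0 ε ∩ {v | r < ‖v‖}) :=
        hneg.integrable_comp_of_integrable (hBi r hr)
      rw [integral_add (hBi r hr) h3, h2]
      ring
    · refine (ae_restrict_mem measurableSet_ball).mono fun v _ hv => ?_
      -- Since `0 ^ (1 - β) = 0`, the bound at the origin says `U 0 = 0`.
      have h1 := hUA 0 (by simpa using hε)
      rw [norm_zero, Real.zero_rpow (by linarith), mul_zero] at h1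
      simp [hv, abs_nonpos_iff.1 h1]
  set vol := volume.real (Metric.ball (0 : 𝔼[M]) 1)
  -- The two truncations differ on a shell of radius `r` and width `K * r ^ 2`, of volume `O(r ^ (M
  -- + 1))`, where `U` is `O(r ^ (1 - β))`. The product tends to zero because `β < M + 2`.
  have hdiff : ∀ r > 0, K * r ≤ 1 →
      |(∫ v in Metric.ball 0 ε ∩ n ⁻¹' Ioi r, U v) -
        ∫ v in Metric.ball 0 ε ∩ {v | r < ‖v‖}, U v| ≤
      A * 2⁻¹ ^ (1 - β) * (vol * (M * K)) * r ^ (M + 2 - β) := by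
    intro r hr hKr
    rw [← setIntegral_sdiff (hBm r) (hAi r hr hKr) (hsub r), ← Real.norm_eq_abs]
    have hS : (Metric.ball (0 : 𝔼[M]) ε ∩ n ⁻¹' Ioi r) \ (Metric.ball 0 ε ∩ {v | r < ‖v‖}) ⊆
        {v : 𝔼[M] | r * (1 - K * r) < ‖v‖ ∧ ‖v‖ ≤ r} := fun v hv =>
      ⟨(hlow r hr hKr v (by simpa using hv.1.1) hv.1.2).1,
        not_lt.1 fun hvr => hv.2 ⟨hv.1.1, hvr⟩⟩
    have hfin : volume {v : 𝔼[M] | r * (1 - K * r) < ‖v‖ ∧ ‖v‖ ≤ r} ≠ ⊤ :=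
      ne_top_of_le_ne_top (measure_closedBall_lt_top (x := (0 : 𝔼[M])) (r := r)).ne
        (measure_mono fun v hv => by simpa using hv.2)
    refine (norm_setIntegral_le_of_norm_le_const (C := A * (r / 2) ^ (1 - β))
      ((measure_mono hS).trans_lt hfin.lt_top) fun v hv => ?_).trans ?_
    · have hv' : ‖v‖ < ε := by simpa using hv.1.1
      refine (hUA v hv').trans (mul_le_mul_of_nonneg_left ?_ hA)
      exact Real.rpow_le_rpow_of_nonpos (by positivity) (hlow r hr hKr v hv' hv.1.2).2.le
        (by linarith)
    · refine (mul_le_mul_of_nonneg_left ((measureReal_mono hS hfin).trans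
        (volume_real_annulus_le hr.le (by positivity) hKr le_rfl)) (by positivity)).trans
        (le_of_eq ?_)
      have h1 : (r / 2) ^ (1 - β) = 2⁻¹ ^ (1 - β) * r ^ (1 - β) := by
        rw [div_eq_inv_mul, Real.mul_rpow (by norm_num) hr.le]
      have h2 : r ^ ((M : ℝ) + 2 - β) = r ^ (1 - β) * (r ^ M * r) := by
        rw [← Real.rpow_natCast r M, ← Real.rpow_add_one hr.ne', ← Real.rpow_add hr]
        congr 1
        ring
      rw [h1, h2]
      ring
  have hzero : Tendsto (fun r : ℝ => A * 2⁻¹ ^ (1 - β) * (vol * (M * K)) * r ^ (M + 2 - β)) (𝓝[>] 0)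
      (𝓝 0) := by
    have h1 : ContinuousAt (fun r : ℝ => A * 2⁻¹ ^ (1 - β) * (vol * (M * K)) * r ^ (M + 2 - β)) 0 :=
      continuousAt_const.mul (Real.continuousAt_rpow_const _ _ (Or.inr (by linarith)))
    have h2 := h1.tendsto.mono_left (nhdsWithin_le_nhds (s := Ioi 0))
    rwa [Real.zero_rpow (by linarith), mul_zero] at h2
  have hKr : ∀ᶠ r in 𝓝[>] (0 : ℝ), K * r ≤ 1 := by
    have h1 : ContinuousAt (fun r : ℝ => K * r) 0 := by fun_prop
    exact ((h1.eventually_lt_const (by simp)).filter_mono nhdsWithin_le_nhds).mono fun r h => le_of_lt h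
  have h0 := squeeze_zero_norm' (hKr.and self_mem_nhdsWithin |>.mono fun r hr =>
    (Real.norm_eq_abs _).le.trans (hdiff r hr.2 hr.1)) hzero
  simpa using h0.add hB

/-! ### Surface integrals in the centred chart -/

namespace IsCenteredChart

variable {M : ℕ} {E : Set 𝔼[M + 1]} {h : 𝔼[M + 1] → ℝ} {Et : ℝ → Set 𝔼[M + 1]} {C t₀ : ℝ}
  {p : 𝔼[M + 1]} {ι : (𝔼[M] × ℝ) ≃L[ℝ] 𝔼[M + 1]} {γ : 𝔼[M] → ℝ} {ε : ℝ}
  {Γ : ℝ × 𝔼[M] → ℝ} {K β : ℝ}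

theorem mem_frontier (hc : IsCenteredChart E h Et p ι γ ε Γ K) (hE : IsOpen E) :
    p ∈ frontier E := by
  obtain ⟨η, -, hch⟩ := hc.moving.chart
  exact hch.mem_frontier hE

theorem contDiffOn (hc : IsCenteredChart E h Et p ι γ ε Γ K) :
    ContDiffOn ℝ 1 γ (Metric.ball 0 ε) := by
  obtain ⟨η, -, hch⟩ := hc.moving.chart
  exact hch.contDiffOn.of_le (by norm_cast)

theorem continuousOn_norm_graph (hc : IsCenteredChart E h Et p ι γ ε Γ K) :
    ContinuousOn (fun v => ‖ι (v, γ v)‖) (Metric.ball 0 ε) := by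
  have h1 := hc.contDiffOn.continuousOn
  fun_prop

theorem norm_graph_le (hc : IsCenteredChart E h Et p ι γ ε Γ K) {v : 𝔼[M]} (hv : ‖v‖ < ε) :
    ‖v‖ ≤ ‖ι (v, γ v)‖ ∧ ‖ι (v, γ v)‖ ≤ ‖v‖ * (1 + K * ‖v‖) := by
  refine ⟨hc.moving.frame.norm_fst_le (v, γ v), (hc.moving.frame.norm_le _).trans ?_⟩
  have := hc.abs_graph_le v hv
  simp only
  nlinarith

theorem mem_image_graphMap (hc : IsCenteredChart E h Et p ι γ ε Γ K) (hE : IsOpen E)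
    {x : 𝔼[M + 1]} (hx : x ∈ frontier E) (hxp : ‖x - p‖ < ε) :
    x ∈ graphMap ι p γ '' Metric.ball 0 ε := by
  obtain ⟨η, hη, hch⟩ := hc.moving.chart
  obtain ⟨h1, h2⟩ := hch.exists_eq_graphMap hE hx hxp (hxp.trans_le hη)
  exact ⟨_, h1, h2⟩

theorem image_graphMap_subset (hc : IsCenteredChart E h Et p ι γ ε Γ K) (hE : IsOpen E) :
    graphMap ι p γ '' Metric.ball 0 ε ⊆ frontier E := by
  obtain ⟨η, hη, hch⟩ := hc.moving.chart
  rintro _ ⟨v, hv, rfl⟩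
  exact hch.graphMap_mem_frontier hE hv

/-- In the chart, the area element times the relative velocity is the time derivative of `Γ`. The
removed Euclidean ball becomes `‖ι (v, γ v)‖ ≤ r`, a quadratic perturbation of `‖v‖ ≤ r`, so the
surface principal value is half the symmetrized integral. -/
theorem tendsto_integral_nearKernel_mul (hc : IsCenteredChart E h Et p ι γ ε Γ K)
    (hP : IsPerturbationFamily E h Et C t₀) (hβ : 1 < β) (hβM : β < M + 2) :
    Tendsto (fun r : ℝ => ∫ x in {x | r < ‖x - p‖}, nearKernel β ε (x - p) *
        relativeVelocity E h (h p • outerNormal E p) x ∂(μHE[M].restrict (frontier E))) (𝓝[>] 0)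
      (𝓝 (2⁻¹ * ∫ v in Metric.ball 0 ε,
        (nearKernel β ε (ι (v, Γ (0, v))) * fderiv ℝ Γ (0, v) (1, 0) +
          nearKernel β ε (ι (-v, Γ (0, -v))) * fderiv ℝ Γ (0, -v) (1, 0)))) := by
  have hε := hc.moving.pos
  have hE := hP.smooth.isOpen
  set U : 𝔼[M] → ℝ := fun v => nearKernel β ε (ι (v, Γ (0, v))) * fderiv ℝ Γ (0, v) (1, 0) with hU
  have hUm := hc.aestronglyMeasurable_nearKernel_graph β
  have hUA : ∀ v, ‖v‖ < ε → |U v| ≤ K * ‖v‖ ^ (1 - β) := by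
    intro v hv
    by_cases hv0 : v = 0
    · have h1 := (hc.abs_fderiv_le 0 0 (by simpa) (by simpa)).1
      rw [norm_zero, mul_zero] at h1
      simp only [hU, hv0, abs_nonpos_iff.1 h1, mul_zero, abs_zero]
      have := hc.nonneg
      positivity
    · have h1 := (hc.abs_fderiv_le 0 v (by simpa) hv).1
      have h2 : nearKernel β ε (ι (v, Γ (0, v))) ≤ ‖v‖ ^ (-β) :=
        hc.nearKernel_fiber_le (by linarith) hv0 _
      rw [abs_mul, abs_of_nonneg (nearKernel_nonneg _ _ _)]
      calc nearKernel β ε (ι (v, Γ (0, v))) * |fderiv ℝ Γ (0, v) (1, 0)|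
          ≤ ‖v‖ ^ (-β) * (K * ‖v‖) := by gcongr
        _ = K * ‖v‖ ^ (1 - β) := by
          rw [show 1 - β = -β + 1 by ring, Real.rpow_add_one (norm_ne_zero_iff.2 hv0)]
          ring
  have hkey := tendsto_integral_inter_gt hε hc.nonneg hc.nonneg hβ hβM hUm hUA
    (hc.hasDerivAt_integral_evenSign hP (by linarith) hβM).1 (n := fun v => ‖ι (v, γ v)‖)
    fun v hv => hc.norm_graph_le hv
  refine hkey.congr fun r => ?_
  have hm : MeasurableSet {x : 𝔼[M + 1] | r < ‖x - p‖} :=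
    (isOpen_lt continuous_const (continuous_id.sub continuous_const).norm).measurableSet
  rw [Measure.restrict_restrict hm]
  set S := Metric.ball (0 : 𝔼[M]) ε ∩ (fun v => ‖ι (v, γ v)‖) ⁻¹' Ioi r with hS
  have hSo : IsOpen S := hc.continuousOn_norm_graph.isOpen_inter_preimage Metric.isOpen_ball isOpen_Ioi
  have hn : ∀ v, ‖graphMap ι p γ v - p‖ = ‖ι (v, γ v)‖ := fun v => by simp [graphMap]
  rw [setIntegral_eq_of_subset_of_forall_sdiff_eq_zero (s := graphMap ι p γ '' S)
    (hm.inter isClosed_frontier.measurableSet)]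
  · have hJ := continuousOn_areaElement Metric.isOpen_ball hc.contDiffOn
    have hJU : ∀ v ∈ Metric.ball (0 : 𝔼[M]) ε, U v = areaElement γ v *
        (nearKernel β ε (ι (v, γ v)) *
          relativeVelocity E h (h p • outerNormal E p) (graphMap ι p γ v)) := fun v hv => by
      rw [mem_ball_zero_iff] at hv
      simp only [hU]
      rw [hc.moving.apply_zero v hv, hc.moving.fderiv_zero hv]
      ring
    have hg : AEStronglyMeasurable (fun v => nearKernel β ε (ι (v, γ v)) *
        relativeVelocity E h (h p • outerNormal E p) (graphMap ι p γ v))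
        (volume.restrict (Metric.ball 0 ε)) := by
      refine (((hJ.inv₀ fun v _ => (areaElement_pos γ v).ne').aestronglyMeasurable
        measurableSet_ball).mul hUm).congr ?_
      filter_upwards [ae_restrict_mem measurableSet_ball] with v hv
      simp only [Pi.mul_apply, Pi.inv_apply]
      change (areaElement γ v)⁻¹ * U v = _
      rw [hJU v hv, inv_mul_cancel_left₀ (areaElement_pos γ v).ne']
    rw [(hc.moving.frame.integral_graph p hSo (hc.contDiffOn.mono inter_subset_left)
      (hg.mono_measure (Measure.restrict_mono inter_subset_left le_rfl)) fun v _ => by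
        simp only [graphMap, add_sub_cancel_left]).2]
    exact setIntegral_congr_fun hSo.measurableSet fun v hv => hJU v hv.1
  · rintro _ ⟨v, hv, rfl⟩
    refine ⟨?_, hc.image_graphMap_subset hE ⟨v, hv.1, rfl⟩⟩
    change r < ‖graphMap ι p γ v - p‖
    rw [hn]
    exact hv.2
  · rintro x ⟨⟨hxr, hxf⟩, hxS⟩
    rcases lt_or_ge ‖x - p‖ ε with hx | hx
    · obtain ⟨v, hv, rfl⟩ := hc.mem_image_graphMap hE hxf hx
      refine absurd ⟨v, ⟨hv, ?_⟩, rfl⟩ hxS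
      change r < ‖ι (v, γ v)‖
      rw [← hn]
      exact hxr
    · rw [nearKernel_eq_zero (by linarith) hε hx, zero_mul]

/-- Near `p` the factor `1 - ⟨ν(x), ν(p)⟩` is `1 - (areaElement γ v)⁻¹`, of second order in `v`,
which again leaves `‖v‖ ^ (2 - β)`. Away from `p` it is at most 2 and the weighted area is finite.
-/
theorem integrableOn_potential (hc : IsCenteredChart E h Et p ι γ ε Γ K)
    (hE : IsSmoothOpenSet E) (hβ : 0 < β) (hβM : β < M + 2)
    (hw : IntegrableOn (fun x => (1 + ‖x‖) ^ (-β)) (frontier E) μHE[M]) :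
    IntegrableOn (fun x => ‖x - p‖ ^ (-β) * (1 - inner ℝ (outerNormal E x) (outerNormal E p)))
      (frontier E) μHE[M] := by
  have hε := hc.moving.pos
  have hp := hc.mem_frontier hE.isOpen
  have hfm : MeasurableSet (frontier E) := isClosed_frontier.measurableSet
  have hm : MeasurableSet {x : 𝔼[M + 1] | ε ≤ ‖x - p‖} :=
    (isClosed_le continuous_const (continuous_id.sub continuous_const).norm).measurableSet
  have hin : ContinuousOn (fun x => 1 - inner ℝ (outerNormal E x) (outerNormal E p)) (frontier E) :=
    continuousOn_const.sub (hE.continuousOn_outerNormal.inner continuousOn_const)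
  have hmeas : AEStronglyMeasurable (fun x => ‖x - p‖ ^ (-β) *
      (1 - inner ℝ (outerNormal E x) (outerNormal E p))) (μHE[M].restrict (frontier E)) :=
    AEStronglyMeasurable.mul (Measurable.aestronglyMeasurable (by fun_prop))
      (hin.aestronglyMeasurable hfm)
  have hfar : IntegrableOn (fun x => ‖x - p‖ ^ (-β) *
      (1 - inner ℝ (outerNormal E x) (outerNormal E p))) (frontier E ∩ {x | ε ≤ ‖x - p‖}) μHE[M] := by
    obtain ⟨A, hA, -⟩ := exists_farKernel_le hβ.le hε p
    refine ((hw.mono_set inter_subset_left).const_mul (A * 2)).mono'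
      (hmeas.mono_measure (Measure.restrict_mono inter_subset_left le_rfl)) ?_
    filter_upwards [ae_restrict_mem (hfm.inter hm)] with x hx
    have h1 := hA x
    rw [farKernel, max_eq_left hx.2, abs_of_nonneg (by positivity)] at h1
    have h2 := abs_real_inner_le_norm (outerNormal E x) (outerNormal E p)
    rw [hE.norm_outerNormal hx.1, hE.norm_outerNormal hp, one_mul, _root_.abs_le] at h2
    rw [norm_mul, Real.norm_of_nonneg (by positivity), Real.norm_of_nonneg (by linarith)]
    calc ‖x - p‖ ^ (-β) * (1 - inner ℝ (outerNormal E x) (outerNormal E p))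
        ≤ (A * (1 + ‖x‖) ^ (-β)) * 2 := by
          refine mul_le_mul h1 (by linarith) (by linarith) (le_trans (by positivity) h1)
      _ = _ := by ring
  have hnear : IntegrableOn (fun x => ‖x - p‖ ^ (-β) *
      (1 - inner ℝ (outerNormal E x) (outerNormal E p))) (graphMap ι p γ '' Metric.ball 0 ε)
      μHE[M] := by
    obtain ⟨η, -, hch⟩ := hc.moving.chart
    have hJ := continuousOn_areaElement Metric.isOpen_ball hc.contDiffOn
    have hg : AEStronglyMeasurable (fun v => ‖ι (v, γ v)‖ ^ (-β) * (1 - (areaElement γ v)⁻¹))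
        (volume.restrict (Metric.ball 0 ε)) := by
      refine AEStronglyMeasurable.mul ?_ ((continuousOn_const.sub
        (hJ.inv₀ fun v _ => (areaElement_pos γ v).ne')).aestronglyMeasurable measurableSet_ball)
      exact ((hc.continuousOn_norm_graph.aemeasurable measurableSet_ball).pow_const
        _).aestronglyMeasurable
    refine (hc.moving.frame.integral_graph p Metric.isOpen_ball hc.contDiffOn hg
      fun v hv => ?_).1.2 ?_
    · rw [hch.outerNormal_graphMap hE hv, ← hc.normal, hc.moving.frame.inner_graphNormal]
      simp [graphMap]
    · refine ((integrableOn_norm_rpow_neg (show β - 2 < M by linarith)).const_mul (K ^ 2)).mono'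
        ((hJ.aestronglyMeasurable measurableSet_ball).mul hg) ?_
      filter_upwards [ae_restrict_mem measurableSet_ball] with v hv
      rw [mem_ball_zero_iff] at hv
      have hJ1 := one_le_areaElement γ v
      have hJ2 : areaElement γ v - 1 ≤ (K * ‖v‖) ^ 2 := by
        have h1 := hc.norm_fderiv_le v hv
        have h2 : ‖fderiv ℝ γ v‖ ^ 2 ≤ (K * ‖v‖) ^ 2 := by gcongr
        have h3 : areaElement γ v ≤ 1 + ‖fderiv ℝ γ v‖ ^ 2 := by
          rw [areaElement, Real.sqrt_le_left (by positivity)]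
          nlinarith [sq_nonneg ‖fderiv ℝ γ v‖]
        linarith
      have h4 : areaElement γ v * (‖ι (v, γ v)‖ ^ (-β) * (1 - (areaElement γ v)⁻¹)) =
          ‖ι (v, γ v)‖ ^ (-β) * (areaElement γ v - 1) := by
        have := (areaElement_pos γ v).ne'
        field_simp
      rw [h4, Real.norm_of_nonneg (mul_nonneg (by positivity) (by linarith))]
      by_cases hv0 : v = 0
      · have : areaElement γ v - 1 = 0 := by
          refine le_antisymm (hJ2.trans (by simp [hv0])) (by linarith)
        rw [this, mul_zero]
        positivity
      · have h5 : ‖ι (v, γ v)‖ ^ (-β) ≤ ‖v‖ ^ (-β) :=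
          Real.rpow_le_rpow_of_nonpos (norm_pos_iff.2 hv0) (hc.norm_graph_le hv).1 (by linarith)
        calc ‖ι (v, γ v)‖ ^ (-β) * (areaElement γ v - 1)
            ≤ ‖v‖ ^ (-β) * (K * ‖v‖) ^ 2 := by gcongr
          _ = K ^ 2 * (‖v‖ ^ 2 * ‖v‖ ^ (-β)) := by ring
          _ ≤ _ := mul_le_mul_of_nonneg_left (sq_mul_rpow_neg_le (norm_nonneg v) β) (sq_nonneg K)
  refine (hnear.union hfar).mono_set fun x hx => ?_
  rcases lt_or_ge ‖x - p‖ ε with h1 | h1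
  · exact Or.inl (hc.mem_image_graphMap hE.isOpen hx h1)
  · exact Or.inr ⟨hx, h1⟩

end IsCenteredChart

/-! ### The nonlocal mean curvature -/

section Volume

variable {M : ℕ} {β r : ℝ}

theorem integrable_farKernel (hβ : (M : ℝ) + 1 < β) (hr : 0 < r) :
    Integrable (farKernel β r : 𝔼[M + 1] → ℝ) := by
  have hM : (0 : ℝ) ≤ M := M.cast_nonneg
  obtain ⟨A, hA, -⟩ := exists_farKernel_le (X := 𝔼[M + 1]) (show 0 ≤ β by linarith) hr 0
  have h1 : Integrable (fun x : 𝔼[M + 1] => (1 + ‖x‖) ^ (-β)) :=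
    integrable_one_add_norm (by simpa using hβ)
  refine (h1.const_mul A).mono' (continuous_farKernel β hr).aestronglyMeasurable
    (Eventually.of_forall fun x => ?_)
  simpa using hA x

theorem measurableSet_norm_gt {X : Type*} [NormedAddCommGroup X] [MeasurableSpace X]
    [OpensMeasurableSpace X] (p : X) (r : ℝ) : MeasurableSet {x : X | r < ‖x - p‖} :=
  (isOpen_lt continuous_const (continuous_id.sub continuous_const).norm).measurableSet

theorem integrableOn_norm_rpow_gt (hβ : (M : ℝ) + 1 < β) (hr : 0 < r) :
    IntegrableOn (fun z : 𝔼[M + 1] => ‖z‖ ^ (-β)) {z | r < ‖z‖} := by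
  refine (integrable_farKernel hβ hr).integrableOn.congr_fun (fun z hz => ?_)
    (by simpa using measurableSet_norm_gt (0 : 𝔼[M + 1]) r)
  rw [farKernel, max_eq_left (le_of_lt hz)]

theorem integrableOn_nearKernel_gt (hβ : (M : ℝ) + 1 < β) {ρ : ℝ} (hρ : 0 < ρ) (hr : 0 < r) :
    IntegrableOn (nearKernel β ρ : 𝔼[M + 1] → ℝ) {z | r < ‖z‖} :=
  (integrableOn_norm_rpow_gt hβ hr).mono' (measurable_nearKernel β ρ).aestronglyMeasurable
    (Eventually.of_forall fun z => by
      rw [Real.norm_of_nonneg (nearKernel_nonneg _ _ _)]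
      exact nearKernel_le_norm_rpow hρ z)

theorem integrable_signFunction_mul {F : Set 𝔼[M + 1]} (hF : MeasurableSet F) (p : 𝔼[M + 1])
    {μ : Measure 𝔼[M + 1]} {k : 𝔼[M + 1] → ℝ} (hk : Integrable k μ) :
    Integrable (fun z => signFunction F (p + z) * k z) μ :=
  hk.bdd_mul (c := 1) ((measurable_signFunction hF).comp (measurable_const_add p)).aestronglyMeasurable
    (Eventually.of_forall fun z => by rw [Real.norm_eq_abs, abs_signFunction])

/-- The sign is `2 χ_F - 1`; this is the source of the factor 2 in the far part of the variation. -/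
theorem integral_signFunction_mul {F : Set 𝔼[M + 1]} (hF : MeasurableSet F) (p : 𝔼[M + 1])
    {k : 𝔼[M + 1] → ℝ} (hk : Integrable k) :
    ∫ z, signFunction F (p + z) * k z = 2 * (∫ x in F, k (x - p)) - ∫ z, k z := by
  have h1 : ∫ z, signFunction F (p + z) * k z = ∫ x, signFunction F x * k (x - p) := by
    rw [← integral_add_left_eq_self (fun x => signFunction F x * k (x - p)) p]
    simp
  have h2 : ∀ x, signFunction F x * k (x - p) =
      2 * F.indicator (fun x => k (x - p)) x - k (x - p) := fun x => by
    by_cases hx : x ∈ F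
    · rw [signFunction_of_mem hx, indicator_of_mem hx]
      ring
    · rw [signFunction_of_notMem hx, indicator_of_notMem hx]
      ring
  have hk' : Integrable fun x => k (x - p) := hk.comp_sub_right p
  rw [h1]
  simp_rw [h2]
  rw [integral_sub ((hk'.indicator hF).const_mul 2) hk', integral_const_mul, integral_indicator hF,
    integral_sub_right_eq_self (μ := volume) k p]

end Volume

section MeanCurvature

variable {M : ℕ} {Et : ℝ → Set 𝔼[M + 1]} {s : ℝ}

theorem meanCurvatureIntegrand_add (p d z : 𝔼[M + 1]) (t : ℝ) :
    meanCurvatureIntegrand s (Et t) (p + t • d) (p + t • d + z) =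
      signFunction (translatedSet Et d t) (p + z) * ‖z‖ ^ (-(((M + 1 : ℕ) : ℝ) + s)) := by
  have h1 : signFunction (Et t) (p + t • d + z) = signFunction (translatedSet Et d t) (p + z) := by
    have h2 : p + t • d + z ∈ Et t ↔ p + z ∈ translatedSet Et d t := by
      rw [translatedSet, mem_ofPred_eq, add_right_comm]
    by_cases hx : p + z ∈ translatedSet Et d t
    · rw [signFunction_of_mem hx, signFunction_of_mem (h2.2 hx)]
    · rw [signFunction_of_notMem hx, signFunction_of_notMem (mt h2.1 hx)]
  rw [← h1, Real.rpow_neg (norm_nonneg z), meanCurvatureIntegrand, add_sub_cancel_left,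
    div_eq_mul_inv]
  rfl

theorem integral_meanCurvatureIntegrand (p d : 𝔼[M + 1]) (t r : ℝ) :
    ∫ x in {x | r < ‖x - (p + t • d)‖}, meanCurvatureIntegrand s (Et t) (p + t • d) x =
      ∫ z in {z | r < ‖z‖}, signFunction (translatedSet Et d t) (p + z) *
        ‖z‖ ^ (-(((M + 1 : ℕ) : ℝ) + s)) := by
  rw [← (measurePreserving_add_left volume (p + t • d)).setIntegral_preimage_emb
    (MeasurableEquiv.addLeft (p + t • d)).measurableEmbedding]
  simp only [meanCurvatureIntegrand_add, preimage_ofPred_eq, add_sub_cancel_left]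

theorem integrableOn_meanCurvatureIntegrand (hs : 0 < s) {p d : 𝔼[M + 1]} {t : ℝ}
    (hF : MeasurableSet (translatedSet Et d t)) {r : ℝ} (hr : 0 < r) :
    IntegrableOn (meanCurvatureIntegrand s (Et t) (p + t • d)) {x | r < ‖x - (p + t • d)‖} := by
  rw [← (measurePreserving_add_left volume (p + t • d)).integrableOn_comp_preimage
    (MeasurableEquiv.addLeft (p + t • d)).measurableEmbedding]
  simp only [Function.comp_def, meanCurvatureIntegrand_add, preimage_ofPred_eq, add_sub_cancel_left]
  exact integrable_signFunction_mul hF p (integrableOn_norm_rpow_gt (by push_cast; linarith) hr)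

end MeanCurvature

namespace IsCenteredChart

variable {M : ℕ} {E : Set 𝔼[M + 1]} {h : 𝔼[M + 1] → ℝ} {Et : ℝ → Set 𝔼[M + 1]} {C t₀ : ℝ}
  {p : 𝔼[M + 1]} {ι : (𝔼[M] × ℝ) ≃L[ℝ] 𝔼[M + 1]} {γ : 𝔼[M] → ℝ} {ε : ℝ}
  {Γ : ℝ × 𝔼[M] → ℝ} {K β s : ℝ}

/-- The near part converges after symmetrization, the far part absolutely. The limit is expressed
through quantities whose derivatives in `t` are already known. -/
theorem tendsto_integral_signFunction (hc : IsCenteredChart E h Et p ι γ ε Γ K)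
    (hP : IsPerturbationFamily E h Et C t₀) (hβ : (M : ℝ) + 1 < β) (hβM : β < M + 2) {t : ℝ}
    (ht : |t| < ε) (ht' : |t| < t₀) :
    Tendsto (fun r : ℝ => ∫ z in {z | r < ‖z‖},
        signFunction (translatedSet Et (h p • outerNormal E p) t) (p + z) * ‖z‖ ^ (-β)) (𝓝[>] 0)
      (𝓝 ((∫ z, evenSign (translatedSet Et (h p • outerNormal E p) t) p z * nearKernel β ε z) +
        (2 * (∫ x in translatedSet Et (h p • outerNormal E p) t, farKernel β ε (x - p)) -
          ∫ z : 𝔼[M + 1], farKernel β ε z))) := by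
  have hM : (0 : ℝ) ≤ M := M.cast_nonneg
  have hβ0 : 0 < β := by linarith
  have hε := hc.moving.pos
  set F := translatedSet Et (h p • outerNormal E p) t
  have hF : MeasurableSet F := (hP.isOpen_translatedSet _ ht').measurableSet
  have hfar := integrable_farKernel hβ hε
  have hS : Integrable fun z => evenSign F p z * nearKernel β ε z :=
    (hc.moving.frame.measurePreserving.integrable_comp_emb
      ι.toHomeomorph.measurableEmbedding).1
      (hc.integrable_evenSign_mul_nearKernel hP hβ0 hβM ht ht')
  have h1 := tendsto_integral_signFunction_mul hF (p := p) (nearKernel_zero β ε hβ0 hε)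
    (nearKernel_neg β ε) (fun r hr => integrableOn_nearKernel_gt hβ hε hr) hS
  have h2 := tendsto_setIntegral_norm_sub_gt (integrable_signFunction_mul hF p hfar) (p := 0)
    (by
      filter_upwards [compl_mem_ae_iff.2 (measure_singleton (0 : 𝔼[M + 1]))] with z hz h0
      exact absurd h0 hz)
  rw [integral_signFunction_mul hF p hfar] at h2
  refine (h1.add h2).congr' ?_
  filter_upwards [self_mem_nhdsWithin] with r hr
  simp only [sub_zero]
  rw [← integral_add (integrable_signFunction_mul hF p (integrableOn_nearKernel_gt hβ hε hr))
    (integrable_signFunction_mul hF p hfar.integrableOn)]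
  refine setIntegral_congr_fun (by simpa using measurableSet_norm_gt (0 : 𝔼[M + 1]) r)
    fun z hz => ?_
  have hz0 : z ≠ 0 := norm_pos_iff.1 (lt_trans hr hz)
  rw [← mul_add, nearKernel_add_farKernel hβ0.le hε hz0]

theorem tendsto_meanCurvature (hc : IsCenteredChart E h Et p ι γ ε Γ K)
    (hP : IsPerturbationFamily E h Et C t₀) (hs : 0 < s) (hs' : s < 1) {t : ℝ}
    (ht : |t| < ε) (ht' : |t| < t₀) :
    Tendsto (fun r : ℝ => ∫ x in {x | r < ‖x - normalShift E h t p‖},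
        meanCurvatureIntegrand s (Et t) (normalShift E h t p) x) (𝓝[>] 0)
      (𝓝 ((∫ z, evenSign (translatedSet Et (h p • outerNormal E p) t) p z *
          nearKernel (((M + 1 : ℕ) : ℝ) + s) ε z) +
        (2 * (∫ x in translatedSet Et (h p • outerNormal E p) t,
          farKernel (((M + 1 : ℕ) : ℝ) + s) ε (x - p)) -
          ∫ z : 𝔼[M + 1], farKernel (((M + 1 : ℕ) : ℝ) + s) ε z))) := by
  have h1 : normalShift E h t p = p + t • h p • outerNormal E p := by
    rw [normalShift, smul_smul]
  simp_rw [h1, integral_meanCurvatureIntegrand]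
  exact hc.tendsto_integral_signFunction hP (by push_cast; linarith) (by push_cast; linarith) ht ht'

theorem pvConverges_meanCurvature (hc : IsCenteredChart E h Et p ι γ ε Γ K)
    (hP : IsPerturbationFamily E h Et C t₀) (hs : 0 < s) (hs' : s < 1) {t : ℝ}
    (ht : |t| < ε) (ht' : |t| < t₀) :
    PVConverges volume (meanCurvatureIntegrand s (Et t) (normalShift E h t p))
      (normalShift E h t p) := by
  refine ⟨fun r hr => ?_, _, hc.tendsto_meanCurvature hP hs hs' ht ht'⟩
  rw [normalShift, ← smul_smul]
  exact integrableOn_meanCurvatureIntegrand hs (hP.isOpen_translatedSet _ ht').measurableSet hr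

theorem hasDerivAt_nonlocalMeanCurvature (hc : IsCenteredChart E h Et p ι γ ε Γ K)
    (hP : IsPerturbationFamily E h Et C t₀) (hs : 0 < s) (hs' : s < 1)
    (hw : IntegrableOn (fun x => (1 + ‖x‖) ^ (-(((M + 1 : ℕ) : ℝ) + s))) (frontier E) μHE[M]) :
    HasDerivAt (fun t : ℝ => nonlocalMeanCurvature s (Et t) (normalShift E h t p))
      ((∫ v in Metric.ball 0 ε, (nearKernel (((M + 1 : ℕ) : ℝ) + s) ε (ι (v, Γ (0, v))) *
          fderiv ℝ Γ (0, v) (1, 0) + nearKernel (((M + 1 : ℕ) : ℝ) + s) ε (ι (-v, Γ (0, -v))) *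
            fderiv ℝ Γ (0, -v) (1, 0))) +
        2 * ∫ x in frontier E, farKernel (((M + 1 : ℕ) : ℝ) + s) ε (x - p) *
          relativeVelocity E h (h p • outerNormal E p) x ∂μHE[M]) 0 := by
  have hM : (0 : ℝ) ≤ M := M.cast_nonneg
  have hε := hc.moving.pos
  have ht₀ := hP.pos
  set β := ((M + 1 : ℕ) : ℝ) + s with hβdef
  have hβ : (M : ℝ) + 1 < β := by rw [hβdef]; push_cast; linarith
  have hβM : β < M + 2 := by rw [hβdef]; push_cast; linarith
  obtain ⟨A, hA, hAL⟩ := exists_farKernel_le (show 0 ≤ β by linarith) hε p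
  have h1 := (hc.hasDerivAt_integral_evenSign hP (show 0 < β by linarith) hβM).2
  have h2 := hP.hasDerivAt_integral_of_decay ⟨p, hc.mem_frontier hP.smooth.isOpen⟩
    (h p • outerNormal E p) hβ hw
    ((continuous_farKernel β hε).comp (continuous_id.sub continuous_const)) hA hAL
  refine (h1.add ((h2.const_mul 2).sub_const
    (∫ z : 𝔼[M + 1], farKernel β ε z))).congr_of_eventuallyEq ?_
  have hsmall : ∀ᶠ t in 𝓝 (0 : ℝ), |t| < ε ∧ |t| < t₀ :=
    ((show ContinuousAt (fun t : ℝ => |t|) 0 by fun_prop).eventually_lt_const (by simpa)).and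
      ((show ContinuousAt (fun t : ℝ => |t|) 0 by fun_prop).eventually_lt_const (by simpa))
  filter_upwards [hsmall] with t ht
  exact (hc.tendsto_meanCurvature hP hs hs' ht.1 ht.2).limUnder_eq

end IsCenteredChart

/-! ### The nonlocal Jacobi operator -/

namespace IsCenteredChart

variable {M : ℕ} {E : Set 𝔼[M + 1]} {h : 𝔼[M + 1] → ℝ} {Et : ℝ → Set 𝔼[M + 1]} {C t₀ : ℝ}
  {p : 𝔼[M + 1]} {ι : (𝔼[M] × ℝ) ≃L[ℝ] 𝔼[M + 1]} {γ : 𝔼[M] → ℝ} {ε : ℝ}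
  {Γ : ℝ × 𝔼[M] → ℝ} {K β s : ℝ}

/-- Off the ball of radius `r` the kernel coincides with its regular part cut at `r`, which decays
like the weight. -/
theorem integrableOn_rpow_mul_relativeVelocity (hP : IsPerturbationFamily E h Et C t₀)
    (d : 𝔼[M + 1]) (hβ : 0 ≤ β)
    (hw : IntegrableOn (fun x => (1 + ‖x‖) ^ (-β)) (frontier E) μHE[M]) {r : ℝ} (hr : 0 < r) :
    IntegrableOn (fun x => ‖x - p‖ ^ (-β) * relativeVelocity E h d x) {x | r < ‖x - p‖}
      (μHE[M].restrict (frontier E)) := by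
  obtain ⟨A, hA, -⟩ := exists_farKernel_le hβ hr p
  have h1 := hP.integrableOn_mul_relativeVelocity d hw
    ((continuous_farKernel β hr).comp (continuous_id.sub continuous_const)).aestronglyMeasurable hA
  refine IntegrableOn.congr_fun (Integrable.integrableOn h1) (fun x hx => ?_)
    (measurableSet_norm_gt p r)
  simp only [Function.comp_apply, Pi.sub_apply, id_eq]
  rw [farKernel, max_eq_left (le_of_lt hx)]

theorem relativeVelocity_self (hE : IsSmoothOpenSet E) (hp : p ∈ frontier E) :
    relativeVelocity E h (h p • outerNormal E p) p = 0 := by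
  rw [relativeVelocity, inner_smul_right, real_inner_self_eq_norm_sq, hE.norm_outerNormal hp]
  ring

theorem tendsto_integral_rpow_mul_relativeVelocity (hc : IsCenteredChart E h Et p ι γ ε Γ K)
    (hP : IsPerturbationFamily E h Et C t₀) (hβ : 1 < β) (hβM : β < M + 2)
    (hw : IntegrableOn (fun x => (1 + ‖x‖) ^ (-β)) (frontier E) μHE[M]) :
    Tendsto (fun r : ℝ => ∫ x in {x | r < ‖x - p‖}, ‖x - p‖ ^ (-β) *
        relativeVelocity E h (h p • outerNormal E p) x ∂(μHE[M].restrict (frontier E))) (𝓝[>] 0)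
      (𝓝 ((2⁻¹ * ∫ v in Metric.ball 0 ε,
          (nearKernel β ε (ι (v, Γ (0, v))) * fderiv ℝ Γ (0, v) (1, 0) +
            nearKernel β ε (ι (-v, Γ (0, -v))) * fderiv ℝ Γ (0, -v) (1, 0))) +
        ∫ x in frontier E, farKernel β ε (x - p) *
          relativeVelocity E h (h p • outerNormal E p) x ∂μHE[M])) := by
  have hε := hc.moving.pos
  have hβ0 : 0 ≤ β := by linarith
  obtain ⟨A, hA, -⟩ := exists_farKernel_le hβ0 hε p
  have hfar := hP.integrableOn_mul_relativeVelocity (h p • outerNormal E p) hw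
    ((continuous_farKernel β hε).comp (continuous_id.sub continuous_const)).aestronglyMeasurable hA
  simp only [Function.comp_apply, Pi.sub_apply, id_eq] at hfar
  have h1 := hc.tendsto_integral_nearKernel_mul hP hβ hβM
  have h2 := tendsto_setIntegral_norm_sub_gt hfar (p := p) (Eventually.of_forall fun x hx => by
    rw [hx, relativeVelocity_self hP.smooth (hc.mem_frontier hP.smooth.isOpen), mul_zero])
  refine (h1.add h2).congr' ?_
  filter_upwards [self_mem_nhdsWithin] with r hr
  have hsplit : EqOn (fun x => nearKernel β ε (x - p) *
        relativeVelocity E h (h p • outerNormal E p) x)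
      (fun x => ‖x - p‖ ^ (-β) * relativeVelocity E h (h p • outerNormal E p) x -
        farKernel β ε (x - p) * relativeVelocity E h (h p • outerNormal E p) x)
      {x | r < ‖x - p‖} := fun x hx => by
    have hx0 : x - p ≠ 0 := norm_pos_iff.1 (lt_trans hr hx)
    simp only
    rw [← nearKernel_add_farKernel hβ0 hε hx0]
    ring
  rw [setIntegral_congr_fun (measurableSet_norm_gt p r) hsplit,
    integral_sub (integrableOn_rpow_mul_relativeVelocity hP _ hβ0 hw hr)
      (Integrable.integrableOn hfar), sub_add_cancel]

theorem jacobiPotentialIntegrand_eq (hE : IsSmoothOpenSet E) (hp : p ∈ frontier E)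
    (x : 𝔼[M + 1]) :
    jacobiPotentialIntegrand s E p x = ‖x - p‖ ^ (-(((M + 1 : ℕ) : ℝ) + s)) *
      (1 - inner ℝ (outerNormal E x) (outerNormal E p)) := by
  rw [jacobiPotentialIntegrand, inner_sub_left, real_inner_self_eq_norm_sq, hE.norm_outerNormal hp,
    norm_sub_rev, Real.rpow_neg (norm_nonneg _)]
  ring

/-- The relative velocity equals `(h(x) - h(p)) + h(p) (1 - ⟨ν(x), ν(p)⟩)`. The potential term is
absolutely integrable, so convergence of the principal value with the relative velocity gives that
of the Jacobi integrand. -/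
theorem jacobiIntegrand_eq (hE : IsSmoothOpenSet E) (hp : p ∈ frontier E) (x : 𝔼[M + 1]) :
    jacobiIntegrand s h p x = ‖x - p‖ ^ (-(((M + 1 : ℕ) : ℝ) + s)) *
      relativeVelocity E h (h p • outerNormal E p) x - h p * jacobiPotentialIntegrand s E p x := by
  rw [jacobiPotentialIntegrand_eq hE hp, jacobiIntegrand, relativeVelocity, inner_smul_right,
    norm_sub_rev, Real.rpow_neg (norm_nonneg _)]
  ring

theorem integrable_jacobiPotentialIntegrand (hc : IsCenteredChart E h Et p ι γ ε Γ K)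
    (hE : IsSmoothOpenSet E) (hs : 0 < s) (hs' : s < 1)
    (hw : IntegrableOn (fun x => (1 + ‖x‖) ^ (-(((M + 1 : ℕ) : ℝ) + s))) (frontier E) μHE[M]) :
    IntegrableOn (jacobiPotentialIntegrand s E p) (frontier E) μHE[M] := by
  have h1 := hc.integrableOn_potential hE (by positivity) (by push_cast; linarith) hw
  refine Integrable.congr h1 (Eventually.of_forall fun x => ?_)
  exact (jacobiPotentialIntegrand_eq hE (hc.mem_frontier hE.isOpen) x).symm

theorem integrableOn_jacobiIntegrand (hc : IsCenteredChart E h Et p ι γ ε Γ K)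
    (hP : IsPerturbationFamily E h Et C t₀) (hs : 0 < s) (hs' : s < 1)
    (hw : IntegrableOn (fun x => (1 + ‖x‖) ^ (-(((M + 1 : ℕ) : ℝ) + s))) (frontier E) μHE[M])
    {r : ℝ} (hr : 0 < r) :
    IntegrableOn (jacobiIntegrand s h p) {x | r < ‖x - p‖} (μHE[M].restrict (frontier E)) := by
  have hp := hc.mem_frontier hP.smooth.isOpen
  have h1 := integrableOn_rpow_mul_relativeVelocity (p := p) hP (h p • outerNormal E p)
    (by positivity) hw hr
  have h2 : Integrable (jacobiPotentialIntegrand s E p) (μHE[M].restrict (frontier E)) :=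
    hc.integrable_jacobiPotentialIntegrand hP.smooth hs hs' hw
  refine (Integrable.sub h1 (h2.integrableOn.const_mul (h p))).congr
    (Eventually.of_forall fun x => ?_)
  exact (jacobiIntegrand_eq hP.smooth hp x).symm

theorem tendsto_jacobiIntegrand (hc : IsCenteredChart E h Et p ι γ ε Γ K)
    (hP : IsPerturbationFamily E h Et C t₀) (hs : 0 < s) (hs' : s < 1)
    (hw : IntegrableOn (fun x => (1 + ‖x‖) ^ (-(((M + 1 : ℕ) : ℝ) + s))) (frontier E) μHE[M]) :
    Tendsto (fun r : ℝ => ∫ x in {x | r < ‖x - p‖}, jacobiIntegrand s h p x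
        ∂(μHE[M].restrict (frontier E))) (𝓝[>] 0)
      (𝓝 ((2⁻¹ * ∫ v in Metric.ball 0 ε,
          (nearKernel (((M + 1 : ℕ) : ℝ) + s) ε (ι (v, Γ (0, v))) * fderiv ℝ Γ (0, v) (1, 0) +
            nearKernel (((M + 1 : ℕ) : ℝ) + s) ε (ι (-v, Γ (0, -v))) *
              fderiv ℝ Γ (0, -v) (1, 0))) +
        (∫ x in frontier E, farKernel (((M + 1 : ℕ) : ℝ) + s) ε (x - p) *
          relativeVelocity E h (h p • outerNormal E p) x ∂μHE[M]) -
        h p * ∫ x in frontier E, jacobiPotentialIntegrand s E p x ∂μHE[M])) := by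
  have hM : (0 : ℝ) ≤ M := M.cast_nonneg
  have hp := hc.mem_frontier hP.smooth.isOpen
  have hpot : Integrable (jacobiPotentialIntegrand s E p) (μHE[M].restrict (frontier E)) :=
    hc.integrable_jacobiPotentialIntegrand hP.smooth hs hs' hw
  have h1 := hc.tendsto_integral_rpow_mul_relativeVelocity hP (by push_cast; linarith)
    (by push_cast; linarith) hw
  have h2 := (tendsto_setIntegral_norm_sub_gt hpot (p := p) (Eventually.of_forall fun x hx => by
    simp [hx, jacobiPotentialIntegrand])).const_mul (h p)
  refine (h1.sub h2).congr' ?_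
  filter_upwards [self_mem_nhdsWithin] with r hr
  rw [← integral_const_mul, ← integral_sub
    (integrableOn_rpow_mul_relativeVelocity hP _ (by positivity) hw hr)
    (hpot.integrableOn.const_mul (h p))]
  simp_rw [← jacobiIntegrand_eq hP.smooth hp]

end IsCenteredChart

theorem mainTheorem5 {N : ℕ} {s : ℝ} (hs : 0 < s) (hs' : s < 1)
    {E : Set (EuclideanSpace ℝ (Fin N))} (hE : IsSmoothOpenSet E)
    (hArea : Integrable (fun x => (1 + ‖x‖) ^ (-((N : ℝ) + s))) (surfaceMeasure E))
    {h : EuclideanSpace ℝ (Fin N) → ℝ} (hh : ContDiffOn ℝ ∞ h (frontier E))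
    (hb : ∃ C : ℝ, ∀ x ∈ frontier E, |h x| ≤ C)
    {Et : ℝ → Set (EuclideanSpace ℝ (Fin N))}
    (hEt : ∀ᶠ t in 𝓝 (0 : ℝ), IsNormalPerturbation E h t (Et t))
    {p : EuclideanSpace ℝ (Fin N)} (hp : p ∈ frontier E) :
    (∀ᶠ t in 𝓝 (0 : ℝ), PVConverges volume
      (meanCurvatureIntegrand s (Et t) (normalShift E h t p)) (normalShift E h t p)) ∧
    PVConverges (surfaceMeasure E) (jacobiIntegrand s h p) p ∧
    Integrable (jacobiPotentialIntegrand s E p) (surfaceMeasure E) ∧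
    HasDerivAt (fun t : ℝ => nonlocalMeanCurvature s (Et t) (normalShift E h t p))
      (2 * nonlocalJacobi s E h p) 0 := by
  -- For `N = 0` the space is a point and no set has boundary points. For `N = M + 1` the dimension
  -- `N - 1` of the surface measure reduces to `M` by definition.
  obtain _ | M := N
  · rcases E.eq_empty_or_nonempty with rfl | hne
    · simp at hp
    · simp [Subsingleton.eq_univ_of_nonempty hne] at hp
  obtain ⟨C, hC⟩ := hb
  obtain ⟨t₀, ht₀, hpert⟩ := Metric.eventually_nhds_iff.1 hEt
  have hP : IsPerturbationFamily E h Et C t₀ :=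
    ⟨hE, hh, (abs_nonneg _).trans (hC p hp), hC, ht₀, fun t ht => hpert (by simpa using ht)⟩
  obtain ⟨ι, γ, ε, Γ, K, hc⟩ := hP.exists_isCenteredChart hp
  have hε := hc.moving.pos
  have hw : IntegrableOn (fun x => (1 + ‖x‖) ^ (-(((M + 1 : ℕ) : ℝ) + s))) (frontier E) μHE[M] :=
    hArea
  have hJ := hc.tendsto_jacobiIntegrand hP hs hs' hw
  refine ⟨?_, ⟨fun r hr => hc.integrableOn_jacobiIntegrand hP hs hs' hw hr, _, hJ⟩,
    hc.integrable_jacobiPotentialIntegrand hE hs hs' hw, ?_⟩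
  · have hsmall : ∀ᶠ t in 𝓝 (0 : ℝ), |t| < ε ∧ |t| < t₀ :=
      ((show ContinuousAt (fun t : ℝ => |t|) 0 by fun_prop).eventually_lt_const (by simpa)).and
        ((show ContinuousAt (fun t : ℝ => |t|) 0 by fun_prop).eventually_lt_const (by simpa))
    filter_upwards [hsmall] with t ht
    exact hc.pvConverges_meanCurvature hP hs hs' ht.1 ht.2
  -- The potential term subtracted in the principal value cancels the one added in the Jacobi
  -- operator. What remains is half the symmetrized near integral plus the far integral, and
  -- doubling it gives the derivative.
  · convert hc.hasDerivAt_nonlocalMeanCurvature hP hs hs' hw using 1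
    have h1 : principalValue (surfaceMeasure E) (jacobiIntegrand s h p) p = _ := hJ.limUnder_eq
    have h2 : ∫ x, jacobiPotentialIntegrand s E p x ∂(surfaceMeasure E) =
      ∫ x in frontier E, jacobiPotentialIntegrand s E p x ∂μHE[M] := rfl
    rw [nonlocalJacobi, h1, h2]
    ring
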